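/- Throughout, locally compact groups are Hausdorff. For a locally compact group $G$ with left Haar measure $dg$ (also written $dy$), let $L(G)$ be its group von Neumann algebra, generated by the left regular representation $\lambda$ on $L^2(G)$. Let $M_0A(G)$ be the space of completely bounded Fourier multipliers of $G$, that is, of the functions $\varphi\colon G\to\mathbb C$ for which there is a normal completely bounded linear map $M_\varphi\colon L(G)\to L(G)$ with $M_\varphi(\lambda(g))=\varphi(g)\lambda(g)$ for all $g\in G$; put $\|\varphi\|_{M_0A(G)}=\|M_\varphi\|_{\mathrm{cb}}$. The weak$^*$ topology on $M_0A(G)$ is the one given by its predual $M_0A(G)_*$, the completion of $L^1(G)$ in the norm $\|f\|=\sup\{|\int_G f\varphi\,dg| : \|\varphi\|_{M_0A(G)}\le 1\}$. A left invariant mean on $M_0A(G)$ is a positive linear functional $m$ with $\|m\|=m(1)=1$ (norm with respect to $\|\cdot\|_\infty$) and $m(L_g\varphi)=m(\varphi)$ for all $g\in G$, $\varphi\in M_0A(G)$, where $(L_g\varphi)(h)=\varphi(g^{-1}h)$. The group $G$ has property (T$^*$) if $M_0A(G)$ has a unique left invariant mean and this mean is weak$^*$ continuous. Let $G$ and $H$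 be locally compact groups and let $\pi\colon H\to G$ be a continuous group homomorphism with dense image. (a) If $H$ has property (T$^*$), then $G$ has property (T$^*$). (b) There is a non-negative function $u\in C_c(G)$ with $\|u\|_1=1$ and $u=u^*$, where $u^*(x)=\Delta(x^{-1})\overline{u(x^{-1})}$ and $\Delta$ is the modular function of $G$. For every such $u$, the formula $T\varphi=(u*\varphi)\circ\pi$, where $(u*\varphi)(x)=\int_G u(y)\varphi(y^{-1}x)\,dy$, defines a linear map $T\colon M_0A(G)\to M_0A(H)$ that is weak$^*$--weak$^*$ continuous. If $m_H$ is a left invariant mean on $M_0A(H)$, then $m_H\circ T$ is the unique left invariant mean $m_G$ on $M_0A(G)$; that is, $m_G=m_H\circ T$. -/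

import Mathlib

open MeasureTheory
open scoped ComplexOrder ENNReal NNReal

namespace PropertyTStar

/-! ### Operators on Hilbert spaces: ultraweak topology and matrix amplifications -/

section Operators

variable {E : Type*} [NormedAddCommGroup E] [InnerProductSpace ℂ E]

/-- The functional `x ↦ ∑ₙ ⟨x ξₙ, ηₙ⟩` on `B(E)` given by square-summable sequences `ξ`, `η` in `E`.
Mathlib's inner product is conjugate-linear in the first variable. -/
noncomputable def vectorFunctional (ξ η : lp (fun _ : ℕ => E) 2) (x : E →L[ℂ] E) : ℂ :=
  ∑' n, inner ℂ (η n) (x (ξ n))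

/-- The ultraweak (σ-weak) topology on `B(E)`: the coarsest topology making all functionals
`x ↦ ∑ₙ ⟨x ξₙ, ηₙ⟩` with `∑ ‖ξₙ‖² < ∞` and `∑ ‖ηₙ‖² < ∞` continuous. -/
@[reducible]
noncomputable def ultraweakTopology (E : Type*) [NormedAddCommGroup E] [InnerProductSpace ℂ E] :
    TopologicalSpace (E →L[ℂ] E) :=
  ⨅ (ξ : lp (fun _ : ℕ => E) 2) (η : lp (fun _ : ℕ => E) 2),
    TopologicalSpace.induced (vectorFunctional ξ η) inferInstance

/-- An `n × n` matrix of operators on `E`, regarded as an operator on the Hilbert space direct sum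
`Eⁿ`; this is the identification `Mₙ(B(E)) = B(Eⁿ)`. -/
noncomputable def matrixOp {n : ℕ} (a : Matrix (Fin n) (Fin n) (E →L[ℂ] E)) :
    PiLp 2 (fun _ : Fin n => E) →L[ℂ] PiLp 2 (fun _ : Fin n => E) :=
  (PiLp.continuousLinearEquiv 2 ℂ (fun _ : Fin n => E)).symm.toContinuousLinearMap ∘L
    (ContinuousLinearMap.pi fun i => ∑ j, a i j ∘L ContinuousLinearMap.proj j) ∘L
      (PiLp.continuousLinearEquiv 2 ℂ (fun _ : Fin n => E)).toContinuousLinearMap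

theorem matrixOp_apply {n : ℕ} (a : Matrix (Fin n) (Fin n) (E →L[ℂ] E))
    (v : PiLp 2 (fun _ : Fin n => E)) (i : Fin n) : matrixOp a v i = ∑ j, a i j (v j) := by
  simp [matrixOp]

theorem matrixOp_add {n : ℕ} (a b : Matrix (Fin n) (Fin n) (E →L[ℂ] E)) :
    matrixOp (a + b) = matrixOp a + matrixOp b := by
  ext v i
  simp [matrixOp_apply, Finset.sum_add_distrib]

theorem matrixOp_smul {n : ℕ} (c : ℂ) (a : Matrix (Fin n) (Fin n) (E →L[ℂ] E)) :
    matrixOp (c • a) = c • matrixOp a := by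
  ext v i
  simp [matrixOp_apply, Finset.smul_sum]

/-- Square-summable sequences of vectors give absolutely convergent sums in the definition of the
ultraweak topology. -/
theorem summable_vectorFunctional (ξ η : lp (fun _ : ℕ => E) 2) (x : E →L[ℂ] E) :
    Summable fun n => inner ℂ (η n) (x (ξ n)) := by
  have h : Summable fun n => ‖η n‖ * ‖ξ n‖ :=
    lp.summable_mul (by rw [Real.holderConjugate_iff]; norm_num) η ξ
  refine Summable.of_norm_bounded (h.mul_left ‖x‖) fun n => ?_
  calc ‖inner ℂ (η n) (x (ξ n))‖ ≤ ‖η n‖ * ‖x (ξ n)‖ := norm_inner_le_norm _ _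
    _ ≤ ‖η n‖ * (‖x‖ * ‖ξ n‖) := by gcongr; exact x.le_opNorm _
    _ = ‖x‖ * (‖η n‖ * ‖ξ n‖) := by ring

theorem vectorFunctional_add (ξ η : lp (fun _ : ℕ => E) 2) (x y : E →L[ℂ] E) :
    vectorFunctional ξ η (x + y) = vectorFunctional ξ η x + vectorFunctional ξ η y := by
  simp only [vectorFunctional, add_apply, inner_add_right]
  exact (summable_vectorFunctional ξ η x).tsum_add (summable_vectorFunctional ξ η y)

theorem vectorFunctional_smul (ξ η : lp (fun _ : ℕ => E) 2) (c : ℂ) (x : E →L[ℂ] E) :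
    vectorFunctional ξ η (c • x) = c * vectorFunctional ξ η x := by
  simp only [vectorFunctional, smul_apply, inner_smul_right, tsum_mul_left]

/-- The ultraweak topology restricted to a `*`-subalgebra of `B(E)`. -/
@[reducible]
noncomputable def ultraweakOn [CompleteSpace E] (A : StarSubalgebra ℂ (E →L[ℂ] E)) :
    TopologicalSpace A :=
  TopologicalSpace.induced Subtype.val (ultraweakTopology E)

/-- A linear map between operator algebras is normal if it is ultraweakly continuous. -/
def IsNormalMap [CompleteSpace E] {A : StarSubalgebra ℂ (E →L[ℂ] E)} (M : A →ₗ[ℂ] A) : Prop :=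
  @Continuous A A (ultraweakOn A) (ultraweakOn A) M

theorem isNormalMap_iff [CompleteSpace E] {A : StarSubalgebra ℂ (E →L[ℂ] E)} (M : A →ₗ[ℂ] A) :
    IsNormalMap M ↔ ∀ ξ η : lp (fun _ : ℕ => E) 2,
      @Continuous A ℂ (ultraweakOn A) inferInstance
        (fun x => vectorFunctional ξ η (M x : E →L[ℂ] E)) := by
  unfold IsNormalMap
  conv_lhs => rw [ultraweakOn.eq_def, continuous_induced_rng, ultraweakTopology]
  simp only [continuous_iInf_rng, continuous_induced_rng]
  rfl

/-- `C ≥ 0` bounds all the amplifications `M ⊗ idₙ : Mₙ(A) → Mₙ(A)` of the linear map `M`,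
where `Mₙ(A)` carries the norm of `B(Eⁿ)`. -/
def IsCBBound [CompleteSpace E] {A : StarSubalgebra ℂ (E →L[ℂ] E)} (M : A →ₗ[ℂ] A) (C : ℝ) :
    Prop :=
  0 ≤ C ∧ ∀ (n : ℕ) (a : Matrix (Fin n) (Fin n) A),
    ‖matrixOp (Matrix.of fun i j => (M (a i j) : E →L[ℂ] E))‖ ≤
      C * ‖matrixOp (Matrix.of fun i j => (a i j : E →L[ℂ] E))‖

/-- Complete boundedness: the amplifications are uniformly bounded. -/
def IsCompletelyBounded [CompleteSpace E] {A : StarSubalgebra ℂ (E →L[ℂ] E)} (M : A →ₗ[ℂ] A) :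
    Prop :=
  ∃ C, IsCBBound M C

/-- The completely bounded norm `‖M‖_cb = supₙ ‖M ⊗ idₙ‖`, as the least uniform bound of the
amplifications. -/
noncomputable def cbNorm [CompleteSpace E] {A : StarSubalgebra ℂ (E →L[ℂ] E)} (M : A →ₗ[ℂ] A) :
    ℝ :=
  sInf {C | IsCBBound M C}

end Operators

/-! ### The group von Neumann algebra and completely bounded Fourier multipliers -/

section Group

variable (G : Type*) [Group G] [TopologicalSpace G] [IsTopologicalGroup G] [LocallyCompactSpace G]
  [MeasurableSpace G] [BorelSpace G]

/-- The Hilbert space `L²(G)` for a left Haar measure. -/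
noncomputable abbrev LTwo : Type _ := Lp ℂ 2 (Measure.haar : Measure G)

variable {G}

/-- The left regular representation, `(λ(g)ξ)(h) = ξ(g⁻¹h)`. -/
noncomputable def leftRegular (g : G) : LTwo G →L[ℂ] LTwo G :=
  (Lp.compMeasurePreservingₗᵢ ℂ (fun h : G => g⁻¹ * h)
    (measurePreserving_mul_left Measure.haar g⁻¹)).toContinuousLinearMap

variable (G)

/-- The group von Neumann algebra `L(G)`: the double commutant of `λ(G)` in `B(L²(G))`. -/
noncomputable def groupVN : StarSubalgebra ℂ (LTwo G →L[ℂ] LTwo G) :=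
  StarSubalgebra.centralizer ℂ
    (StarSubalgebra.centralizer ℂ (Set.range (leftRegular (G := G))) : Set (LTwo G →L[ℂ] LTwo G))

variable {G}

theorem leftRegular_mem (g : G) : leftRegular g ∈ groupVN G := by
  have h : Set.range (leftRegular (G := G)) ⊆ groupVN G := by
    intro x hx
    rw [groupVN, StarSubalgebra.coe_centralizer_centralizer]
    exact Set.subset_centralizer_centralizer (Or.inl hx)
  exact h ⟨g, rfl⟩

/-- `λ(g)` as an element of `L(G)`. -/
noncomputable def vnUnitary (g : G) : groupVN G := ⟨leftRegular g, leftRegular_mem g⟩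

/-- `M` is the multiplier map `M_φ` on `L(G)` of the function `φ`: the normal linear map with
`M_φ (λ(g)) = φ(g) λ(g)`. As `λ(G)` spans an ultraweakly dense subspace of `L(G)`, there is at most
one such map. -/
def IsMultiplierMap (φ : G → ℂ) (M : groupVN G →ₗ[ℂ] groupVN G) : Prop :=
  IsNormalMap M ∧ ∀ g : G, M (vnUnitary g) = φ g • vnUnitary g

variable (G)

/-- The space `M₀A(G)` of completely bounded Fourier multipliers of `G`. -/
def M0A : Submodule ℂ (G → ℂ) where
  carrier := {φ | ∃ M : groupVN G →ₗ[ℂ] groupVN G, IsMultiplierMap φ M ∧ IsCompletelyBounded M}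
  zero_mem' := by
    refine ⟨0, ⟨?_, fun g => by simp⟩, 0, le_rfl, fun n a => ?_⟩
    · rw [isNormalMap_iff]
      intro ξ η
      have h : (fun x : groupVN G => vectorFunctional ξ η
          (((0 : groupVN G →ₗ[ℂ] groupVN G) x : groupVN G) : LTwo G →L[ℂ] LTwo G)) =
            fun _ => 0 := by
        funext x
        simp [vectorFunctional]
      rw [h]
      exact @continuous_const _ _ (ultraweakOn (groupVN G)) _ _
    · have h : matrixOp (Matrix.of fun i j : Fin n =>
          (((0 : groupVN G →ₗ[ℂ] groupVN G) (a i j) : groupVN G) : LTwo G →L[ℂ] LTwo G)) = 0 := by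
        ext v i
        simp [matrixOp_apply]
      rw [h]
      simp
  add_mem' := by
    rintro φ ψ ⟨M, ⟨hM, hMφ⟩, C, hC, hMC⟩ ⟨N, ⟨hN, hNψ⟩, D, hD, hND⟩
    refine ⟨M + N, ⟨?_, fun g => ?_⟩, C + D, add_nonneg hC hD, fun n a => ?_⟩
    · rw [isNormalMap_iff] at hM hN ⊢
      intro ξ η
      have h : (fun x : groupVN G => vectorFunctional ξ η
          (((M + N) x : groupVN G) : LTwo G →L[ℂ] LTwo G)) = fun x =>
            vectorFunctional ξ η (M x : LTwo G →L[ℂ] LTwo G) +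
              vectorFunctional ξ η (N x : LTwo G →L[ℂ] LTwo G) := by
        funext x
        rw [← vectorFunctional_add]
        rfl
      rw [h]
      exact @Continuous.add _ _ _ _ _ (ultraweakOn (groupVN G)) _ _ (hM ξ η) (hN ξ η)
    · rw [LinearMap.add_apply, hMφ, hNψ, ← add_smul]
      rfl
    · have h : (Matrix.of fun i j : Fin n =>
          (((M + N) (a i j) : groupVN G) : LTwo G →L[ℂ] LTwo G)) =
            (Matrix.of fun i j => (M (a i j) : LTwo G →L[ℂ] LTwo G)) +
              (Matrix.of fun i j => (N (a i j) : LTwo G →L[ℂ] LTwo G)) := rfl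
      rw [h, matrixOp_add, add_mul]
      exact (norm_add_le _ _).trans (add_le_add (hMC n a) (hND n a))
  smul_mem' := by
    rintro c φ ⟨M, ⟨hM, hMφ⟩, C, hC, hMC⟩
    refine ⟨c • M, ⟨?_, fun g => ?_⟩, ‖c‖ * C, mul_nonneg (norm_nonneg _) hC, fun n a => ?_⟩
    · rw [isNormalMap_iff] at hM ⊢
      intro ξ η
      have h : (fun x : groupVN G => vectorFunctional ξ η
          (((c • M) x : groupVN G) : LTwo G →L[ℂ] LTwo G)) = fun x =>
            c * vectorFunctional ξ η (M x : LTwo G →L[ℂ] LTwo G) := by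
        funext x
        rw [← vectorFunctional_smul]
        rfl
      rw [h]
      exact @Continuous.mul _ _ _ _ _ (ultraweakOn (groupVN G)) _ _
        (@continuous_const _ _ (ultraweakOn (groupVN G)) _ _) (hM ξ η)
    · rw [LinearMap.smul_apply, hMφ, smul_smul]
      rfl
    · have h : (Matrix.of fun i j : Fin n =>
          (((c • M) (a i j) : groupVN G) : LTwo G →L[ℂ] LTwo G)) =
            c • (Matrix.of fun i j => (M (a i j) : LTwo G →L[ℂ] LTwo G)) := rfl
      rw [h, matrixOp_smul, norm_smul, mul_assoc]
      exact mul_le_mul_of_nonneg_left (hMC n a) (norm_nonneg _)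

variable {G}

/-- Constant functions with value `1` are completely bounded multipliers. -/
theorem one_mem_M0A : (fun _ : G => (1 : ℂ)) ∈ M0A G := by
  refine ⟨LinearMap.id, ⟨?_, fun g => by simp⟩, 1, zero_le_one, fun n a => by simp⟩
  exact @continuous_id _ (ultraweakOn (groupVN G))

/-- The norm `‖φ‖_{M₀A(G)} = ‖M_φ‖_cb`. The infimum is over a single element, as `M_φ` is unique. -/
noncomputable def m0aNorm (φ : M0A G) : ℝ :=
  sInf {r | ∃ M : groupVN G →ₗ[ℂ] groupVN G,
    IsMultiplierMap (φ : G → ℂ) M ∧ IsCompletelyBounded M ∧ r = cbNorm M}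

/-! ### The weak* topology on `M₀A(G)` -/

/-- The pairing `⟨f, φ⟩ = ∫ f φ` of an integrable function with a multiplier. -/
noncomputable def pairing (f : G → ℂ) (φ : M0A G) : ℂ :=
  ∫ g, f g * (φ : G → ℂ) g ∂(Measure.haar : Measure G)

variable (G)

/-- The predual `M₀A(G)_*`: the completion of `L¹(G)` in the norm
`‖f‖ = sup {|⟨f, φ⟩| : ‖φ‖_{M₀A(G)} ≤ 1}`. As this is the norm of `f` as a functional on `M₀A(G)`,
the completion is the norm closure of `L¹(G)` in the dual of `M₀A(G)`, i.e. it consists of the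
linear functionals that are uniform limits, on the unit ball, of functionals `⟨f, ·⟩`. -/
def predual : Set (Module.Dual ℂ (M0A G)) :=
  {l | ∀ ε : ℝ, 0 < ε → ∃ f : G → ℂ, Integrable f (Measure.haar : Measure G) ∧
    ∀ φ : M0A G, m0aNorm φ ≤ 1 → ‖l φ - pairing f φ‖ ≤ ε}

/-- The weak* topology on `M₀A(G)`: the coarsest topology for which all elements of the predual
are continuous. -/
@[reducible]
noncomputable def weakStarTopology : TopologicalSpace (M0A G) :=
  ⨅ l ∈ predual G, TopologicalSpace.induced (fun φ => l φ) inferInstance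

variable {G}

/-! ### Invariant means and property (T*) -/

/-- `m` is a mean on `M₀A(G)`: a positive linear functional with `‖m‖ = m(1) = 1`, the norm of `m`
being taken with respect to the uniform norm. -/
structure IsMean (m : M0A G →ₗ[ℂ] ℂ) : Prop where
  nonneg : ∀ φ : M0A G, (∀ g, 0 ≤ (φ : G → ℂ) g) → 0 ≤ m φ
  map_one : m ⟨fun _ => 1, one_mem_M0A⟩ = 1
  norm_le : ∀ (φ : M0A G) (C : ℝ), (∀ g, ‖(φ : G → ℂ) g‖ ≤ C) → ‖m φ‖ ≤ C

/-- A left invariant mean: `m(L_g φ) = m(φ)`, where `(L_g φ)(h) = φ(g⁻¹h)`. -/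
structure IsLeftInvariantMean (m : M0A G →ₗ[ℂ] ℂ) : Prop extends IsMean m where
  left_invariant : ∀ (g : G) (φ ψ : M0A G),
    (∀ h, (ψ : G → ℂ) h = (φ : G → ℂ) (g⁻¹ * h)) → m ψ = m φ

variable (G)

/-- Property (T*): the unique left invariant mean on `M₀A(G)` is weak* continuous. -/
def HasPropertyTStar : Prop :=
  ∃ m : M0A G →ₗ[ℂ] ℂ, IsLeftInvariantMean m ∧
    (∀ m' : M0A G →ₗ[ℂ] ℂ, IsLeftInvariantMean m' → m' = m) ∧
    @Continuous (M0A G) ℂ (weakStarTopology G) inferInstance m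

variable {G}

/-! ### Convolution -/

/-- The modular function `Δ`, normalised by `μ(A g) = Δ(g) μ(A)` for left Haar measure `μ`.
Mathlib's `modularCharacterFun` is normalised by `μ(A g⁻¹)`. -/
noncomputable def modularFunction (g : G) : ℝ := (Measure.modularCharacterFun g⁻¹ : ℝ)

/-- The functions used for smoothing: non-negative `u ∈ C_c(G)` with `‖u‖₁ = 1` and `u = u*`,
where `u*(x) = Δ(x⁻¹) u(x⁻¹)` for real-valued `u`. -/
structure IsSmoothingFunction (u : G → ℝ) : Prop where
  continuous : Continuous u
  hasCompactSupport : HasCompactSupport u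
  nonneg : ∀ x, 0 ≤ u x
  integral_eq_one : ∫ x, u x ∂(Measure.haar : Measure G) = 1
  self_adjoint : ∀ x, u x = modularFunction x⁻¹ * u x⁻¹

/-- The convolution `(u * φ)(x) = ∫ u(y) φ(y⁻¹x) dy`. -/
noncomputable def groupConvolution (u : G → ℝ) (φ : G → ℂ) (x : G) : ℂ :=
  ∫ y, (u y : ℂ) * φ (y⁻¹ * x) ∂(Measure.haar : Measure G)

end Group

end PropertyTStar

open PropertyTStar

set_option autoImplicit false

/-! Three facts carry the theorem: `T` is a well-defined contraction, left invariant means are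
unique, and `mH ∘ T` is invariant.

A completely bounded multiplier `φ` of norm at most `C` makes the kernel `(y, z) ↦ φ(yz)` a Schur
multiplier of norm at most `C` (`schurBound_of_isCBBound`). Conversely, put `ψ = (f * φ) ∘ π`. A
substitution gives `ψ(st⁻¹) = ∫ f(π(s)y) φ(y⁻¹π(t)⁻¹) dy`, so row `s` of the kernel of `ψ` is an
average of rows of the kernel of `φ`, with a weight that moves continuously in `L¹(G)` with `s`.
Cutting `H` into finitely many pieces on which the weight is nearly constant gives finite sums of
vector functionals, bounded by `C‖f‖₁` in every matrix amplification. They converge in norm to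
functionals `x ↦ ⟨η, M x ξ⟩`, which define the multiplier map `M` of `ψ`
(`SchurBound.exists_isMultiplierForm`, `IsMultiplierForm.exists_isMultiplierMap`). Normality is
automatic because norm limits of vector functionals are given by square-summable sequences.

Uniqueness (`eq_of_left_right_invariant`): let `m` be left invariant and `n` right invariant.
Averaging the kernel `φ(sᵢtⱼ)` alternately over rows by `n` and over columns by `m` turns it into a
triangular kernel with value `n(φ)` for `j ≤ i` and `m(φ)` for `j > i`. The Hilbert matrix `1/(i-j)`
is bounded on `ℓ²`, so the Schur bound allows only linear growth of its entry sum after this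
truncation. The actual growth is at least of order `N log N` unless `m(φ) = n(φ)`. The involution
turns a left invariant mean into a right invariant functional, so any two left invariant means
agree.

Invariance (`isLeftInvariantMean_comp_smoothing`): for fixed `φ`, the functional `f ↦ mH((f * φ) ∘
π)` on `C_c(G)` is `L¹`-bounded and invariant under translation by `π(H)`, hence by density under
`G`, so it is a multiple of the Haar integral. Translating `φ` only changes the weight `u` into
another one of integral one.

Weak* continuity comes from mapping preduals to preduals: for `f ∈ C_c(H)` Fubini and inversion give
an integrable `v` with `⟨f, Tφ⟩ = ⟨v, φ⟩`, and contractivity of `T` transfers uniform limits on the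
unit ball. Part (a) then follows by composing. -/

namespace PropertyTStar

/-! ### The predual of `B(E)`: norm limits of vector functionals come from square-summable
sequences. -/

section NuclearFunctionals

variable {E : Type*} [NormedAddCommGroup E] [InnerProductSpace ℂ E]

/-- The vector functional `x ↦ ⟨η, x ξ⟩` as a bounded functional on `B(E)`. -/
noncomputable def vecFun (ξ η : E) : StrongDual ℂ (E →L[ℂ] E) :=
  (innerSL ℂ η) ∘L (ContinuousLinearMap.apply ℂ E ξ)

theorem vecFun_apply (ξ η : E) (x : E →L[ℂ] E) : vecFun ξ η x = inner ℂ η (x ξ) := by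
  simp [vecFun]

theorem norm_vecFun_le (ξ η : E) : ‖vecFun ξ η‖ ≤ ‖ξ‖ * ‖η‖ := by
  refine ContinuousLinearMap.opNorm_le_bound _ (by positivity) fun x => ?_
  rw [vecFun_apply]
  calc ‖inner ℂ η (x ξ)‖ ≤ ‖η‖ * ‖x ξ‖ := norm_inner_le_norm _ _
    _ ≤ ‖η‖ * (‖x‖ * ‖ξ‖) := by gcongr; exact x.le_opNorm _
    _ = _ := by ring

/-- The vector functional of the normalised vectors. -/
noncomputable def unitVecFun (p : E × E) : StrongDual ℂ (E →L[ℂ] E) :=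
  vecFun ((‖p.1‖⁻¹ : ℂ) • p.1) ((‖p.2‖⁻¹ : ℂ) • p.2)

theorem norm_normalize_le (v : E) : ‖(‖v‖⁻¹ : ℂ) • v‖ ≤ 1 := by
  rw [norm_smul, norm_inv, Complex.norm_real, norm_norm]
  rcases eq_or_ne ‖v‖ 0 with h | h
  · simp [h]
  · rw [inv_mul_cancel₀ h]

theorem norm_smul_normalize (v : E) : (‖v‖ : ℂ) • (‖v‖⁻¹ : ℂ) • v = v := by
  rcases eq_or_ne v 0 with h | h
  · simp [h]
  · rw [smul_smul, mul_inv_cancel₀ (by simpa using h), one_smul]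

theorem norm_unitVecFun_le (p : E × E) : ‖unitVecFun p‖ ≤ 1 :=
  (norm_vecFun_le _ _).trans (mul_le_one₀ (norm_normalize_le _) (norm_nonneg _)
    (norm_normalize_le _))

theorem smul_unitVecFun (ξ η : E) : ((‖ξ‖ * ‖η‖ : ℝ) : ℂ) • unitVecFun (ξ, η) = vecFun ξ η := by
  ext x
  have h1 := norm_smul_normalize ξ
  have h2 := norm_smul_normalize η
  conv_rhs => rw [vecFun_apply, ← h1, ← h2, map_smul, inner_smul_left, inner_smul_right]
  simp only [unitVecFun, smul_apply, vecFun_apply, smul_eq_mul,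
    Complex.conj_ofReal]
  push_cast
  ring

theorem summable_norm_lp_one {ι : Type*} (c : lp (fun _ : ι => ℂ) 1) : Summable fun i => ‖c i‖ := by
  simpa using (lp.memℓp c).summable (by norm_num)

theorem norm_lp_one {ι : Type*} (c : lp (fun _ : ι => ℂ) 1) : ‖c‖ = ∑' i, ‖c i‖ := by
  simpa using lp.norm_eq_tsum_rpow (p := 1) (by norm_num) c

section LpOne

variable {ι F : Type*} [NormedAddCommGroup F] [NormedSpace ℂ F] [CompleteSpace F]

omit [CompleteSpace F] in
theorem norm_smul_le_of_norm_le_one {v : ι → F} (hv : ∀ i, ‖v i‖ ≤ 1)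
    (c : lp (fun _ : ι => ℂ) 1) (i : ι) : ‖c i • v i‖ ≤ ‖c i‖ := by
  rw [norm_smul]
  exact mul_le_of_le_one_right (norm_nonneg _) (hv i)

theorem summable_lp_one_smul {v : ι → F} (hv : ∀ i, ‖v i‖ ≤ 1) (c : lp (fun _ : ι => ℂ) 1) :
    Summable fun i => c i • v i :=
  Summable.of_norm_bounded (summable_norm_lp_one c) (norm_smul_le_of_norm_le_one hv c)

/-- The bounded map `c ↦ ∑ cᵢ vᵢ` on `ℓ¹` for a family of vectors in the unit ball. -/
noncomputable def lpOneLift (v : ι → F) (hv : ∀ i, ‖v i‖ ≤ 1) : lp (fun _ : ι => ℂ) 1 →L[ℂ] F :=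
  LinearMap.mkContinuous
    { toFun := fun c : lp (fun _ : ι => ℂ) 1 => ∑' i, c i • v i
      map_add' := fun c d => by
        rw [← (summable_lp_one_smul hv c).tsum_add (summable_lp_one_smul hv d)]
        exact tsum_congr fun i => by rw [← add_smul]; rfl
      map_smul' := fun a c => by
        rw [RingHom.id_apply, ← tsum_const_smul'']
        exact tsum_congr fun i => by rw [← smul_assoc]; rfl } 1 fun c => by
    rw [one_mul, norm_lp_one]
    exact tsum_of_norm_bounded (summable_norm_lp_one c).hasSum (norm_smul_le_of_norm_le_one hv c)

theorem lpOneLift_apply {v : ι → F} (hv : ∀ i, ‖v i‖ ≤ 1) (c : lp (fun _ : ι => ℂ) 1) :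
    lpOneLift v hv c = ∑' i, c i • v i := rfl

theorem lpOneLift_single [DecidableEq ι] {v : ι → F} (hv : ∀ i, ‖v i‖ ≤ 1) (i : ι) (a : ℂ) :
    lpOneLift v hv (lp.single 1 i a) = a • v i := by
  rw [lpOneLift_apply, tsum_eq_single i]
  · simp
  · intro j hj
    simp [hj]

end LpOne

variable (E) in
/-- The map `c ↦ ∑ c(ξ, η) ω(ξ, η)` from `ℓ¹(E × E)` to the dual of `B(E)`, where `ω(ξ, η)` is the
vector functional of the normalised vectors. -/
noncomputable def nuclearMap : lp (fun _ : E × E => ℂ) 1 →L[ℂ] StrongDual ℂ (E →L[ℂ] E) :=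
  lpOneLift (F := StrongDual ℂ (E →L[ℂ] E)) unitVecFun norm_unitVecFun_le

theorem nuclearMap_single [DecidableEq (E × E)] (p : E × E) (a : ℂ) :
    nuclearMap E (lp.single 1 p a) = a • unitVecFun p := by
  exact lpOneLift_single (F := StrongDual ℂ (E →L[ℂ] E)) norm_unitVecFun_le _ _

/-- A functional on `ℓ¹(E × E)` of norm at most one which factors through `nuclearMap` is given by
an operator of norm at most one. -/
theorem exists_operator_of_functional [CompleteSpace E]
    (g : StrongDual ℂ (lp (fun _ : E × E => ℂ) 1))
    (hg : ‖g‖ ≤ 1) (hker : ∀ c, nuclearMap E c = 0 → g c = 0) :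
    ∃ x : E →L[ℂ] E, ‖x‖ ≤ 1 ∧ ∀ c, g c = nuclearMap E c x := by
  classical
  have hfac : ∀ c d, nuclearMap E c = nuclearMap E d → g c = g d := fun c d h => by
    have := hker (c - d) (by rw [map_sub, h, sub_self])
    rwa [map_sub, sub_eq_zero] at this
  -- A weighted point mass lying over `vecFun ξ η`. It is not additive in `ξ` or `η`, but `g`
  -- applied to it is, since `g` sees only the image under `nuclearMap`.
  let s : E → E → lp (fun _ : E × E => ℂ) 1 := fun ξ η =>
    lp.single 1 (ξ, η) ((‖ξ‖ * ‖η‖ : ℝ) : ℂ)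
  have hs : ∀ ξ η, nuclearMap E (s ξ η) = vecFun ξ η := fun ξ η => by
    rw [nuclearMap_single, smul_unitVecFun]
  have hbound : ∀ ξ η, ‖g (s ξ η)‖ ≤ 1 * ‖η‖ * ‖ξ‖ := fun ξ η => by
    refine (g.le_opNorm _).trans ?_
    refine (mul_le_mul_of_nonneg_right hg (norm_nonneg _)).trans ?_
    rw [lp.norm_single (by norm_num)]
    simp [mul_comm]
  let b : E →ₗ⋆[ℂ] E →ₗ[ℂ] ℂ := LinearMap.mk₂'ₛₗ (starRingEnd ℂ) (RingHom.id ℂ)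
    (fun η ξ => g (s ξ η))
    (fun η η' ξ => by
      rw [← map_add]; apply hfac; rw [map_add]; simp only [hs]
      ext x; simp [vecFun_apply])
    (fun a η ξ => by
      rw [← map_smul]; apply hfac
      rw [map_smul]; simp only [hs]
      ext x; simp [vecFun_apply, mul_comm])
    (fun η ξ ξ' => by
      rw [← map_add]; apply hfac; rw [map_add]; simp only [hs]
      ext x; simp [vecFun_apply])
    (fun a η ξ => by
      rw [← map_smul]; apply hfac
      rw [map_smul]; simp only [hs]
      ext x; simp [vecFun_apply])
  let B : E →L⋆[ℂ] E →L[ℂ] ℂ := b.mkContinuous₂ 1 fun η ξ => hbound ξ η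
  let y := InnerProductSpace.continuousLinearMapOfBilin B
  have hy : ∀ ξ η, inner ℂ (y η) ξ = g (s ξ η) := fun ξ η => by
    rw [InnerProductSpace.continuousLinearMapOfBilin_apply]; rfl
  refine ⟨ContinuousLinearMap.adjoint y, ?_, fun c => ?_⟩
  · rw [LinearIsometryEquiv.norm_map]
    refine ContinuousLinearMap.opNorm_le_bound _ zero_le_one fun η => ?_
    rcases eq_or_ne (y η) 0 with h | h
    · rw [h, norm_zero]; positivity
    · have := hbound (y η) η
      rw [← hy, inner_self_eq_norm_sq_to_K] at this
      have h2 : ‖y η‖ * ‖y η‖ ≤ (1 * ‖η‖) * ‖y η‖ := by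
        simpa [sq] using this
      exact le_of_mul_le_mul_right h2 (norm_pos_iff.2 h)
  -- Both sides are continuous in `c`, so unit point masses suffice; the one at `p` has the same
  -- image as `s` at the normalised vectors.
  · have hc : HasSum (fun p => lp.single 1 p (c p)) c := lp.hasSum_single (by norm_num) c
    have h1 := hc.mapL g
    have h2 := hc.mapL ((ContinuousLinearMap.apply ℂ ℂ (ContinuousLinearMap.adjoint y)) ∘L
      nuclearMap E)
    refine h1.unique (h2.congr_fun fun p => ?_)
    have key : ∀ p : E × E, ∀ a : ℂ, lp.single (E := fun _ : E × E => ℂ) 1 p a =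
        a • lp.single 1 p (1 : ℂ) := fun p a => by
      rw [← lp.single_smul]; simp
    rw [key p, map_smul, map_smul]
    congr 1
    have : nuclearMap E (lp.single 1 p 1) =
        nuclearMap E (s ((‖p.1‖⁻¹ : ℂ) • p.1) ((‖p.2‖⁻¹ : ℂ) • p.2)) := by
      rw [hs, nuclearMap_single, one_smul]; rfl
    rw [ContinuousLinearMap.comp_apply, hfac _ _ this, this, hs, ← hy]
    simp [vecFun_apply, ContinuousLinearMap.adjoint_inner_right, mul_comm]

/-- Hahn–Banach gives a functional of norm at most one attaining the quotient norm of `c` modulo the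
kernel. It is evaluation at an operator in the unit ball, so the quotient norm is at most
`‖nuclearMap E c‖`. -/
theorem exists_nuclearMap_eq_norm_le [CompleteSpace E] (c : lp (fun _ : E × E => ℂ) 1) :
    ∃ d, nuclearMap E d = nuclearMap E c ∧ ‖d‖ ≤ 2 * ‖nuclearMap E c‖ := by
  rcases eq_or_ne (nuclearMap E c) 0 with h0 | h0
  · exact ⟨0, by rw [h0, map_zero], by simp⟩
  let N := LinearMap.ker (nuclearMap E).toLinearMap
  have : IsClosed (N : Set (lp (fun _ : E × E => ℂ) 1)) := (nuclearMap E).isClosed_ker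
  obtain ⟨F, hF, hFc⟩ := exists_dual_vector'' ℂ (N.mkQ c)
  let π : lp (fun _ : E × E => ℂ) 1 →L[ℂ] (lp (fun _ : E × E => ℂ) 1 ⧸ N) :=
    N.mkQ.mkContinuous 1 fun m => by
      rw [one_mul]; exact Submodule.Quotient.norm_mk_le N m
  have hπ : ‖π‖ ≤ 1 := LinearMap.mkContinuous_norm_le _ zero_le_one _
  obtain ⟨x, hx, hxc⟩ := exists_operator_of_functional (F ∘L π)
    ((ContinuousLinearMap.opNorm_comp_le _ _).trans
      (mul_le_one₀ hF (norm_nonneg _) hπ)) (fun d hd => by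
        have : π d = 0 := (Submodule.Quotient.mk_eq_zero N).2 hd
        simp [this])
  have hnorm : ‖N.mkQ c‖ ≤ ‖nuclearMap E c‖ := by
    have h1 : ((‖N.mkQ c‖ : ℝ) : ℂ) = nuclearMap E c x := by
      rw [← hxc]; exact hFc.symm
    have h2 : ‖N.mkQ c‖ = ‖nuclearMap E c x‖ := by
      rw [← h1]; simp
    rw [h2]
    exact ((nuclearMap E c).le_opNorm x).trans (mul_le_of_le_one_right (norm_nonneg _) hx)
  -- The slack allowed here is `‖nuclearMap E c‖` itself, whence the factor `2`.
  obtain ⟨d, hd, hdn⟩ := Submodule.Quotient.norm_mk_lt (N.mkQ c) (norm_pos_iff.2 h0)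
  refine ⟨d, ?_, by linarith⟩
  have : d - c ∈ N := (Submodule.Quotient.eq N).1 hd
  have h3 : nuclearMap E (d - c) = 0 := this
  rwa [map_sub, sub_eq_zero] at h3

/-- Norm control of preimages lets successive corrections be summed in the complete space `ℓ¹`, so
the range is closed. -/
theorem closure_range_nuclearMap_subset [CompleteSpace E] {ω : StrongDual ℂ (E →L[ℂ] E)}
    (hω : ω ∈ (LinearMap.range (nuclearMap E).toLinearMap).topologicalClosure) :
    ∃ c, nuclearMap E c = ω := by
  let f : NormedAddGroupHom (lp (fun _ : E × E => ℂ) 1) (StrongDual ℂ (E →L[ℂ] E)) :=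
    { (nuclearMap E).toLinearMap.toAddMonoidHom with
      bound' := ⟨‖nuclearMap E‖, fun c => (nuclearMap E).le_opNorm c⟩ }
  have h := controlled_closure_of_complete (f := f)
    (K := (LinearMap.range (nuclearMap E).toLinearMap).toAddSubgroup) (C := 2) (ε := 1)
    (by norm_num) (by norm_num) (by
      rintro _ ⟨c, rfl⟩
      obtain ⟨d, hd, hdn⟩ := exists_nuclearMap_eq_norm_le c
      exact ⟨d, hd, hdn⟩)
  obtain ⟨c, hc, -⟩ := h ω hω
  exact ⟨c, hc⟩

omit [InnerProductSpace ℂ E] in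
theorem memℓp_two_of_sq {ι : Type*} (v : ι → E) (h : Summable fun i => ‖v i‖ ^ 2) :
    Memℓp v 2 := by
  apply memℓp_gen
  simpa using h

/-- Each coefficient splits as `(c p / √‖c p‖) · √‖c p‖`, giving two square-summable families. The
support of `c` is countable, so both can be placed along `ℕ` and extended by zero. -/
theorem exists_vectorFunctional_of_nuclearMap (c : lp (fun _ : E × E => ℂ) 1) :
    ∃ ξ η : lp (fun _ : ℕ => E) 2, ∀ x, nuclearMap E c x = vectorFunctional ξ η x := by
  have hs := summable_norm_lp_one c
  have hcount : (Function.support fun p => ‖c p‖).Countable := hs.countable_support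
  set S := Function.support fun p => ‖c p‖ with hS
  have : Countable S := hcount.to_subtype
  obtain ⟨e, he⟩ := exists_injective_nat S
  let u : S → E := fun p => (c p / (√‖c p‖ : ℝ) : ℂ) • ((‖p.1.1‖⁻¹ : ℂ) • p.1.1)
  let v : S → E := fun p => ((√‖c p‖ : ℝ) : ℂ) • ((‖p.1.2‖⁻¹ : ℂ) • p.1.2)
  have hsq : ∀ p : S, 0 < √‖c p‖ := fun p => Real.sqrt_pos.2 (lt_of_le_of_ne (norm_nonneg _)
    (Ne.symm p.2))
  have hu : ∀ p, ‖u p‖ ^ 2 ≤ ‖c p‖ := fun p => by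
    have h1 : ‖(c p / (√‖c p‖ : ℝ) : ℂ)‖ = √‖c p‖ := by
      rw [norm_div, Complex.norm_real, Real.norm_of_nonneg (Real.sqrt_nonneg _), Real.div_sqrt]
    have h2 : ‖u p‖ ≤ √‖c p‖ := by
      rw [norm_smul, h1]
      exact mul_le_of_le_one_right (Real.sqrt_nonneg _) (norm_normalize_le _)
    calc ‖u p‖ ^ 2 ≤ √‖c p‖ ^ 2 := by gcongr
      _ = _ := Real.sq_sqrt (norm_nonneg _)
  have hv : ∀ p, ‖v p‖ ^ 2 ≤ ‖c p‖ := fun p => by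
    have h2 : ‖v p‖ ≤ √‖c p‖ := by
      rw [norm_smul, Complex.norm_real, Real.norm_of_nonneg (Real.sqrt_nonneg _)]
      exact mul_le_of_le_one_right (Real.sqrt_nonneg _) (norm_normalize_le _)
    calc ‖v p‖ ^ 2 ≤ √‖c p‖ ^ 2 := by gcongr
      _ = _ := Real.sq_sqrt (norm_nonneg _)
  have hsS : Summable fun p : S => ‖c p‖ := hs.subtype _
  have hext : ∀ w : S → E, (∀ p, ‖w p‖ ^ 2 ≤ ‖c p‖) → Memℓp (Function.extend e w 0) 2 := by
    intro w hw
    apply memℓp_two_of_sq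
    have h1 : (fun n => ‖Function.extend e w 0 n‖ ^ 2) =
        Function.extend e (fun p => ‖w p‖ ^ 2) 0 := by
      funext n
      by_cases hn : ∃ p, e p = n
      · obtain ⟨p, rfl⟩ := hn
        simp [he.extend_apply]
      · simp [Function.extend_apply' _ _ _ hn]
    rw [h1]
    exact (summable_extend_zero he).2 (Summable.of_nonneg_of_le (fun p => by positivity) hw hsS)
  refine ⟨⟨_, hext u hu⟩, ⟨_, hext v hv⟩, fun x => ?_⟩
  have h1 : (fun n => inner ℂ (Function.extend e v 0 n) (x (Function.extend e u 0 n))) =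
      Function.extend e (fun p => inner ℂ (v p) (x (u p))) 0 := by
    funext n
    by_cases hn : ∃ p, e p = n
    · obtain ⟨p, rfl⟩ := hn
      simp [he.extend_apply]
    · simp [Function.extend_apply' _ _ _ hn]
  have h2 : vectorFunctional ⟨_, hext u hu⟩ ⟨_, hext v hv⟩ x =
      ∑' n, inner ℂ (Function.extend e v 0 n) (x (Function.extend e u 0 n)) := rfl
  rw [h2, h1, tsum_extend_zero he, nuclearMap, lpOneLift_apply]
  have hsum := summable_lp_one_smul (F := StrongDual ℂ (E →L[ℂ] E)) norm_unitVecFun_le c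
  have h3 : (∑' p, c p • unitVecFun p) x = ∑' p, c p * unitVecFun p x := by
    have := (hsum.hasSum.mapL (ContinuousLinearMap.apply ℂ ℂ x)).tsum_eq
    simpa using this.symm
  rw [h3]
  have h4 : Function.support (fun p => c p * unitVecFun p x) ⊆ S := by
    intro p hp
    simp only [hS, Function.mem_support, ne_eq, norm_eq_zero] at hp ⊢
    exact fun h => hp (by rw [h, zero_mul])
  rw [← tsum_subtype_eq_of_support_subset h4]
  refine tsum_congr fun p => ?_
  have h5 : ((√‖c p‖ : ℝ) : ℂ) ≠ 0 := by exact_mod_cast (hsq p).ne'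
  simp only [u, v, map_smul, inner_smul_left, unitVecFun, vecFun_apply, inner_smul_right,
    Complex.conj_ofReal]
  field_simp

variable (E) in
/-- The norm closure of the span of the vector functionals: the predual of `B(E)`. -/
noncomputable def normalFunctionals : Submodule ℂ (StrongDual ℂ (E →L[ℂ] E)) :=
  (Submodule.span ℂ (Set.range fun p : E × E => vecFun p.1 p.2)).topologicalClosure

theorem vecFun_mem_normalFunctionals (ξ η : E) : vecFun ξ η ∈ normalFunctionals E :=
  Submodule.le_topologicalClosure _ (Submodule.subset_span ⟨(ξ, η), rfl⟩)

theorem exists_vectorFunctional_of_mem [CompleteSpace E] {ω : StrongDual ℂ (E →L[ℂ] E)}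
    (hω : ω ∈ normalFunctionals E) :
    ∃ ξ η : lp (fun _ : ℕ => E) 2, ∀ x, ω x = vectorFunctional ξ η x := by
  classical
  have : normalFunctionals E ≤
      (LinearMap.range (nuclearMap E).toLinearMap).topologicalClosure := by
    refine Submodule.topologicalClosure_mono (Submodule.span_le.2 ?_)
    rintro _ ⟨p, rfl⟩
    exact ⟨lp.single 1 p ((‖p.1‖ * ‖p.2‖ : ℝ) : ℂ), by
      rw [ContinuousLinearMap.coe_coe, nuclearMap_single, smul_unitVecFun]⟩
  obtain ⟨c, rfl⟩ := closure_range_nuclearMap_subset (this hω)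
  exact exists_vectorFunctional_of_nuclearMap c

end NuclearFunctionals

/-! ### Countable ampliations and the double commutant argument. -/

section Amplification

variable {E : Type*} [NormedAddCommGroup E] [InnerProductSpace ℂ E]

theorem opNorm_le_of_inner {F F' : Type*} [NormedAddCommGroup F] [InnerProductSpace ℂ F]
    [NormedAddCommGroup F'] [InnerProductSpace ℂ F'] {T : F →L[ℂ] F'} {K : ℝ} (hK : 0 ≤ K)
    (h : ∀ v w, ‖inner ℂ w (T v)‖ ≤ K * ‖v‖ * ‖w‖) : ‖T‖ ≤ K := by
  refine ContinuousLinearMap.opNorm_le_bound _ hK fun v => ?_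
  rcases eq_or_ne (T v) 0 with h0 | h0
  · rw [h0, norm_zero]; positivity
  · have := h v (T v)
    rw [inner_self_eq_norm_sq_to_K] at this
    have h2 : ‖T v‖ * ‖T v‖ ≤ (K * ‖v‖) * ‖T v‖ := by simpa [sq] using this
    exact le_of_mul_le_mul_right h2 (norm_pos_iff.2 h0)

omit [InnerProductSpace ℂ E] in
theorem norm_sq_lp_two (v : lp (fun _ : ℕ => E) 2) : ‖v‖ ^ 2 = ∑' n, ‖v n‖ ^ 2 := by
  simpa using lp.norm_rpow_eq_tsum (p := 2) (by norm_num) v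

omit [InnerProductSpace ℂ E] in
theorem summable_sq_lp_two (v : lp (fun _ : ℕ => E) 2) : Summable fun n => ‖v n‖ ^ 2 := by
  simpa using (lp.memℓp v).summable (by norm_num)

theorem summable_norm_sq_apply (a : E →L[ℂ] E) (v : lp (fun _ : ℕ => E) 2) :
    Summable fun n => ‖a (v n)‖ ^ 2 := by
  refine Summable.of_nonneg_of_le (fun n => by positivity) (fun n => ?_)
    ((summable_sq_lp_two v).mul_left (‖a‖ ^ 2))
  rw [← mul_pow]
  exact pow_le_pow_left₀ (norm_nonneg _) (a.le_opNorm _) 2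

/-- The diagonal operator `a ⊕ a ⊕ ⋯` on the direct sum of countably many copies of `E`. -/
noncomputable def ampliation (a : E →L[ℂ] E) :
    lp (fun _ : ℕ => E) 2 →L[ℂ] lp (fun _ : ℕ => E) 2 :=
  LinearMap.mkContinuous
    { toFun := fun v => ⟨fun n => a (v n), memℓp_two_of_sq _ (summable_norm_sq_apply a v)⟩
      map_add' := fun v w => by ext n; exact map_add a (v n) (w n)
      map_smul' := fun c v => by ext n; simp } ‖a‖ fun v => by
    refine le_of_sq_le_sq ?_ (by positivity)
    rw [mul_pow, norm_sq_lp_two, norm_sq_lp_two, ← tsum_mul_left]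
    refine (summable_norm_sq_apply a v).tsum_le_tsum (fun n => ?_)
      ((summable_sq_lp_two v).mul_left (‖a‖ ^ 2))
    rw [← mul_pow]
    exact pow_le_pow_left₀ (norm_nonneg _) (a.le_opNorm _) 2

theorem ampliation_apply (a : E →L[ℂ] E) (v : lp (fun _ : ℕ => E) 2) (n : ℕ) :
    ampliation a v n = a (v n) := rfl

theorem inner_ampliation (a : E →L[ℂ] E) (ξ η : lp (fun _ : ℕ => E) 2) :
    inner ℂ η (ampliation a ξ) = vectorFunctional ξ η a :=
  lp.inner_eq_tsum _ _

theorem ampliation_single (a : E →L[ℂ] E) (n : ℕ) (e : E) :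
    ampliation a (lp.single 2 n e) = lp.single 2 n (a e) := by
  ext m
  rw [ampliation_apply]
  rcases eq_or_ne m n with rfl | h
  · simp
  · simp [h]

/-- A normal functional which vanishes on a self-adjoint set of operators closed under products
vanishes on its double commutant. -/
theorem vectorFunctional_eq_zero_of_commutant [CompleteSpace E] {S : Set (E →L[ℂ] E)}
    (hone : 1 ∈ S) (hmul : ∀ a ∈ S, ∀ b ∈ S, a * b ∈ S) (hstar : ∀ a ∈ S, star a ∈ S)
    {ξ η : lp (fun _ : ℕ => E) 2} (h : ∀ a ∈ S, vectorFunctional ξ η a = 0) {x : E →L[ℂ] E}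
    (hx : ∀ y : E →L[ℂ] E, (∀ a ∈ S, a * y = y * a) → x * y = y * x) :
    vectorFunctional ξ η x = 0 := by
  -- The closed cyclic subspace of `ξ` under the ampliation of `S`. The hypothesis on `ξ` and `η`
  -- says that `η` is orthogonal to it, and the aim is that `x ⊕ x ⊕ ⋯` leaves it invariant.
  set K : Submodule ℂ (lp (fun _ : ℕ => E) 2) :=
    (Submodule.span ℂ ((fun a => ampliation a ξ) '' S)).topologicalClosure with hK
  have hKc : IsClosed (K : Set (lp (fun _ : ℕ => E) 2)) := Submodule.isClosed_topologicalClosure _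
  have : CompleteSpace K := hKc.completeSpace_coe
  have hinv : ∀ a ∈ S, ∀ v ∈ K, ampliation a v ∈ K := by
    intro a ha v hv
    have hmap : Submodule.span ℂ ((fun a => ampliation a ξ) '' S) ≤
        K.comap (ampliation a).toLinearMap := by
      refine Submodule.span_le.2 ?_
      rintro _ ⟨b, hb, rfl⟩
      exact Submodule.le_topologicalClosure _ (Submodule.subset_span ⟨a * b, hmul a ha b hb, rfl⟩)
    have hcl : IsClosed ((K.comap (ampliation a).toLinearMap : Submodule ℂ _) :
        Set (lp (fun _ : ℕ => E) 2)) := hKc.preimage (ampliation a).continuous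
    exact Submodule.topologicalClosure_minimal _ hmap hcl hv
  have hadj : ∀ (a : E →L[ℂ] E) (v w : lp (fun _ : ℕ => E) 2),
      inner ℂ (ampliation a v) w = inner ℂ v (ampliation (star a) w) := by
    intro a v w
    rw [lp.inner_eq_tsum, lp.inner_eq_tsum]
    refine tsum_congr fun n => ?_
    rw [ampliation_apply, ampliation_apply, ContinuousLinearMap.star_eq_adjoint,
      ContinuousLinearMap.adjoint_inner_right]
  have hcomm : ∀ a ∈ S, ∀ v, K.starProjection (ampliation a v) =
      ampliation a (K.starProjection v) := by
    intro a ha v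
    refine Submodule.eq_starProjection_of_mem_of_inner_eq_zero
      (hinv a ha _ (Submodule.starProjection_apply_mem K v)) fun w hw => ?_
    rw [← map_sub, hadj]
    exact Submodule.starProjection_inner_eq_zero v _ (hinv _ (hstar a ha) w hw)
  -- The matrix entries of the projection onto `K`. They commute with `S`, hence with `x`, and so
  -- the projection commutes with the ampliation of `x`.
  let p : ℕ → ℕ → E →L[ℂ] E := fun m n =>
    (lp.evalCLM ℂ (fun _ : ℕ => E) 2 m) ∘L K.starProjection ∘L
      (lp.singleContinuousLinearMap ℂ (fun _ : ℕ => E) 2 n)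
  have hp : ∀ m n e, p m n e = K.starProjection (lp.single 2 n e) m := fun m n e => rfl
  have hxp : ∀ m n, x * p m n = p m n * x := by
    intro m n
    refine hx _ fun a ha => ?_
    ext e
    simp only [mul_apply_eq_comp, hp]
    rw [← ampliation_single, hcomm a ha, ampliation_apply]
  have hxP : ∀ v, K.starProjection (ampliation x v) = ampliation x (K.starProjection v) := by
    intro v
    have hv : HasSum (fun n => lp.single 2 n (v n)) v := lp.hasSum_single (by norm_num) v
    have h1 := hv.mapL (K.starProjection ∘L ampliation x)
    have h2 := hv.mapL (ampliation x ∘L K.starProjection)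
    refine h1.unique (h2.congr_fun fun n => ?_)
    ext m
    simp only [ContinuousLinearMap.comp_apply]
    rw [ampliation_single, ampliation_apply, ← hp, ← hp]
    exact (congrArg (fun T : E →L[ℂ] E => T (v n)) (hxp m n)).symm
  have hξ : ξ ∈ K := Submodule.le_topologicalClosure _ (Submodule.subset_span ⟨1, hone, rfl⟩)
  have hxξ : ampliation x ξ ∈ K := by
    rw [← Submodule.starProjection_eq_self_iff.2 hξ, ← hxP]
    exact Submodule.starProjection_apply_mem K _
  have hη : K ≤ (ℂ ∙ η)ᗮ := by
    refine Submodule.topologicalClosure_minimal _ (Submodule.span_le.2 ?_)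
      (Submodule.isClosed_orthogonal _)
    rintro _ ⟨a, ha, rfl⟩
    rw [SetLike.mem_coe, Submodule.mem_orthogonal_singleton_iff_inner_right, inner_ampliation]
    exact h a ha
  rw [← inner_ampliation]
  exact Submodule.mem_orthogonal_singleton_iff_inner_right.1 (hη hxξ)

end Amplification

/-! ### Scalar matrices acting on Hilbert space valued vectors. -/

section ScalarMatrices

/-- `K ≥ 0` bounds the norm of the scalar matrix `b` as an operator between `ℓ²`-spaces. -/
def MatBound {ι κ : Type*} [Fintype ι] [Fintype κ] (b : ι → κ → ℂ) (K : ℝ) : Prop :=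
  0 ≤ K ∧ ∀ (c : κ → ℂ) (d : ι → ℂ),
    ‖∑ i, ∑ j, b i j * (starRingEnd ℂ (d i) * c j)‖ ≤ K * √(∑ j, ‖c j‖ ^ 2) * √(∑ i, ‖d i‖ ^ 2)

variable {ι κ : Type*} [Fintype ι] [Fintype κ] {F : Type*} [NormedAddCommGroup F]
  [InnerProductSpace ℂ F]

/-- A bound for a scalar matrix also bounds its Hilbert space valued amplification. -/
theorem MatBound.inner {b : ι → κ → ℂ} {K : ℝ} (h : MatBound b K) (v : κ → F) (w : ι → F) :
    ‖∑ i, ∑ j, b i j * inner ℂ (w i) (v j)‖ ≤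
      K * √(∑ j, ‖v j‖ ^ 2) * √(∑ i, ‖w i‖ ^ 2) := by
  -- In an orthonormal basis of the finite-dimensional span, the form is a sum of scalar forms, one
  -- for each coordinate; Cauchy–Schwarz recombines them.
  let U : Submodule ℂ F := Submodule.span ℂ (Set.range v ∪ Set.range w)
  have : FiniteDimensional ℂ U :=
    FiniteDimensional.span_of_finite ℂ ((Set.finite_range v).union (Set.finite_range w))
  let e := stdOrthonormalBasis ℂ U
  let v' : κ → U := fun j => ⟨v j, Submodule.subset_span (Or.inl ⟨j, rfl⟩)⟩
  let w' : ι → U := fun i => ⟨w i, Submodule.subset_span (Or.inr ⟨i, rfl⟩)⟩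
  have hin : ∀ i j, Inner.inner ℂ (w i) (v j) =
      ∑ k, starRingEnd ℂ (e.repr (w' i) k) * e.repr (v' j) k := by
    intro i j
    change Inner.inner ℂ (w' i) (v' j) = _
    rw [← e.sum_inner_mul_inner]
    refine Finset.sum_congr rfl fun k _ => ?_
    rw [e.repr_apply_apply, e.repr_apply_apply, inner_conj_symm]
  have hv : ∑ j, ‖v j‖ ^ 2 = ∑ k, √(∑ j, ‖e.repr (v' j) k‖ ^ 2) ^ 2 := by
    simp_rw [Real.sq_sqrt (Finset.sum_nonneg fun _ _ => sq_nonneg _)]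
    rw [Finset.sum_comm]
    refine Finset.sum_congr rfl fun j _ => ?_
    rw [← EuclideanSpace.norm_sq_eq, LinearIsometryEquiv.norm_map]; rfl
  have hw : ∑ i, ‖w i‖ ^ 2 = ∑ k, √(∑ i, ‖e.repr (w' i) k‖ ^ 2) ^ 2 := by
    simp_rw [Real.sq_sqrt (Finset.sum_nonneg fun _ _ => sq_nonneg _)]
    rw [Finset.sum_comm]
    refine Finset.sum_congr rfl fun j _ => ?_
    rw [← EuclideanSpace.norm_sq_eq, LinearIsometryEquiv.norm_map]; rfl
  have hsum : ∑ i, ∑ j, b i j * Inner.inner ℂ (w i) (v j) =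
      ∑ k, ∑ i, ∑ j, b i j * (starRingEnd ℂ (e.repr (w' i) k) * e.repr (v' j) k) := by
    simp_rw [hin, Finset.mul_sum]
    rw [Finset.sum_comm' (t' := Finset.univ) (s' := fun _ => Finset.univ) (by simp)]
    rw [Finset.sum_comm]
    refine (Finset.sum_congr rfl fun i _ => ?_).trans Finset.sum_comm
    rw [Finset.sum_comm]
  rw [hsum]
  calc _ ≤ ∑ k, K * (√(∑ j, ‖e.repr (v' j) k‖ ^ 2) * √(∑ i, ‖e.repr (w' i) k‖ ^ 2)) := by
        refine norm_sum_le_of_le _ fun k _ => ?_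
        rw [← mul_assoc]
        exact h.2 (fun j => e.repr (v' j) k) (fun i => e.repr (w' i) k)
    _ ≤ _ := by
        rw [← Finset.mul_sum, mul_assoc, hv, hw]
        gcongr
        · exact h.1
        · exact Real.sum_mul_le_sqrt_mul_sqrt _ _ _

end ScalarMatrices

/-! ### The left regular representation: unitarity and strong continuity. -/

section RegularRepresentation

variable {G : Type*} [Group G] [TopologicalSpace G] [IsTopologicalGroup G]
  [LocallyCompactSpace G] [MeasurableSpace G] [BorelSpace G]

theorem coeFn_leftRegular (g : G) (f : LTwo G) :
    leftRegular g f =ᵐ[(Measure.haar : Measure G)] fun h => f (g⁻¹ * h) :=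
  Lp.coeFn_compMeasurePreserving f (measurePreserving_mul_left Measure.haar g⁻¹)

theorem leftRegular_one : leftRegular (1 : G) = 1 := by
  ext1 f
  refine Lp.ext ((coeFn_leftRegular 1 f).trans ?_)
  simp

theorem leftRegular_mul (g h : G) : leftRegular (g * h) = leftRegular g * leftRegular h := by
  ext1 f
  refine Lp.ext ((coeFn_leftRegular (g * h) f).trans ?_)
  refine Filter.EventuallyEq.symm ((coeFn_leftRegular g (leftRegular h f)).trans ?_)
  have := (measurePreserving_mul_left (Measure.haar : Measure G) g⁻¹).quasiMeasurePreserving.ae_eq_comp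
    (coeFn_leftRegular h f)
  refine this.trans (Filter.Eventually.of_forall fun x => ?_)
  simp [mul_assoc]

theorem norm_leftRegular_apply (g : G) (f : LTwo G) : ‖leftRegular g f‖ = ‖f‖ :=
  (Lp.compMeasurePreservingₗᵢ ℂ (fun h : G => g⁻¹ * h)
    (measurePreserving_mul_left Measure.haar g⁻¹)).norm_map f

theorem inner_leftRegular_leftRegular (g : G) (f f' : LTwo G) :
    inner ℂ (leftRegular g f) (leftRegular g f') = inner ℂ f f' :=
  (Lp.compMeasurePreservingₗᵢ ℂ (fun h : G => g⁻¹ * h)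
    (measurePreserving_mul_left Measure.haar g⁻¹)).inner_map_map f f'

theorem leftRegular_inv_apply (g : G) (f : LTwo G) : leftRegular g⁻¹ (leftRegular g f) = f := by
  have := leftRegular_mul g⁻¹ g
  rw [inv_mul_cancel, leftRegular_one] at this
  exact (congrArg (fun T : LTwo G →L[ℂ] LTwo G => T f) this).symm

theorem inner_leftRegular_right (g : G) (f f' : LTwo G) :
    inner ℂ f (leftRegular g f') = inner ℂ (leftRegular g⁻¹ f) f' := by
  rw [← inner_leftRegular_leftRegular g⁻¹, leftRegular_inv_apply]

theorem star_leftRegular (g : G) : star (leftRegular g) = leftRegular g⁻¹ := by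
  rw [ContinuousLinearMap.star_eq_adjoint]
  refine (ContinuousLinearMap.eq_adjoint_iff _ _).2 (fun x y => ?_) |>.symm
  rw [inner_leftRegular_right]

theorem continuous_leftRegular_apply (f : LTwo G) : Continuous fun g : G => leftRegular g f := by
  let c : C(G, C(G, G)) := (ContinuousMap.mk (fun a : G × G => a.1⁻¹ * a.2) (by fun_prop)).curry
  exact (continuous_const (y := f)).compMeasurePreservingLp c.continuous
    (fun g => measurePreserving_mul_left Measure.haar g⁻¹) (by norm_num)

theorem exists_unit_LTwo : ∃ ζ : LTwo G, ‖ζ‖ = 1 := by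
  obtain ⟨K, hK, hK1⟩ := exists_compact_mem_nhds (1 : G)
  have hK' : (interior K).Nonempty := ⟨1, mem_interior_iff_mem_nhds.2 hK1⟩
  have hpos : 0 < (Measure.haar : Measure G) (interior K) :=
    isOpen_interior.measure_pos _ hK'
  have hfin : (Measure.haar : Measure G) (interior K) ≠ ⊤ :=
    ((measure_mono interior_subset).trans_lt hK.measure_lt_top).ne
  let f : LTwo G := indicatorConstLp 2 isOpen_interior.measurableSet hfin (1 : ℂ)
  have hf : 0 < ‖f‖ := by
    rw [norm_indicatorConstLp (by norm_num) (by norm_num)]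
    have : 0 < (Measure.haar : Measure G).real (interior K) := ENNReal.toReal_pos hpos.ne' hfin
    simp only [norm_one, one_mul]
    positivity
  refine ⟨(‖f‖⁻¹ : ℂ) • f, ?_⟩
  rw [norm_smul, norm_inv, Complex.norm_real, norm_norm, inv_mul_cancel₀ hf.ne']

end RegularRepresentation

/-! ### From completely bounded multipliers to Schur multipliers. -/

section SchurBound

/-- The kernel `(y, z) ↦ φ(yz)` is a Schur multiplier of norm at most `C`. -/
def SchurBound {G : Type*} [Group G] (φ : G → ℂ) (C : ℝ) : Prop :=
  0 ≤ C ∧ ∀ (n : ℕ) (y z : Fin n → G) (b : Fin n → Fin n → ℂ) (K : ℝ), MatBound b K →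
    MatBound (fun i j => φ (y i * z j) * b i j) (C * K)

theorem SchurBound.of_forall_lt {G : Type*} [Group G] {φ : G → ℂ} {C : ℝ} (hC : 0 ≤ C)
    (h : ∀ ε, 0 < ε → SchurBound φ (C + ε)) : SchurBound φ C := by
  refine ⟨hC, fun n y z b K hb => ⟨mul_nonneg hC hb.1, fun c d => ?_⟩⟩
  have hlim : Filter.Tendsto (fun ε : ℝ => (C + ε) * K * √(∑ j, ‖c j‖ ^ 2) * √(∑ i, ‖d i‖ ^ 2))
      (nhdsWithin 0 (Set.Ioi 0)) (nhds ((C + 0) * K * √(∑ j, ‖c j‖ ^ 2) * √(∑ i, ‖d i‖ ^ 2))) := by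
    refine Filter.Tendsto.mono_left (Continuous.tendsto (by fun_prop) 0) nhdsWithin_le_nhds
  rw [add_zero] at hlim
  refine ge_of_tendsto hlim ?_
  filter_upwards [self_mem_nhdsWithin] with ε hε
  exact ((h ε hε).2 n y z b K hb).2 c d

/-- This is the case of one-by-one matrices. -/
theorem SchurBound.norm_le {G : Type*} [Group G] {φ : G → ℂ} {C : ℝ} (h : SchurBound φ C) (g : G) :
    ‖φ g‖ ≤ C := by
  have hb : MatBound (fun _ _ : Fin 1 => (1 : ℂ)) 1 := by
    refine ⟨zero_le_one, fun c d => ?_⟩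
    simp [Real.sqrt_sq, mul_comm]
  have := (h.2 1 (fun _ => g) (fun _ => 1) _ 1 hb).2 (fun _ => 1) (fun _ => 1)
  simpa using this

variable {G : Type*} [Group G] [TopologicalSpace G] [IsTopologicalGroup G]
  [LocallyCompactSpace G] [MeasurableSpace G] [BorelSpace G]

/-- Since `λ(yᵢzⱼ) = λ(yᵢ)λ(zⱼ)`, the unitaries can be moved onto the vectors without changing
norms, which leaves the scalar matrix `b`. -/
theorem norm_matrixOp_regular_le {n : ℕ} (y z : Fin n → G) {b : Fin n → Fin n → ℂ} {K : ℝ}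
    (hb : MatBound b K) :
    ‖matrixOp (Matrix.of fun i j => b i j • leftRegular (y i * z j))‖ ≤ K := by
  refine opNorm_le_of_inner hb.1 fun v w => ?_
  have h := hb.inner (fun j => leftRegular (z j) (v j)) (fun i => leftRegular (y i)⁻¹ (w i))
  simp_rw [norm_leftRegular_apply] at h
  rw [← PiLp.norm_eq_of_L2, ← PiLp.norm_eq_of_L2] at h
  refine le_trans (le_of_eq ?_) h
  rw [PiLp.inner_apply]
  congr 1
  refine Finset.sum_congr rfl fun i _ => ?_
  rw [matrixOp_apply, inner_sum]
  refine Finset.sum_congr rfl fun j _ => ?_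
  rw [Matrix.of_apply, smul_apply, inner_smul_right, leftRegular_mul,
    mul_apply_eq_comp, inner_leftRegular_right]

theorem inner_matrixOp {E : Type*} [NormedAddCommGroup E] [InnerProductSpace ℂ E] {n : ℕ}
    (a : Matrix (Fin n) (Fin n) (E →L[ℂ] E)) (v w : PiLp 2 (fun _ : Fin n => E)) :
    inner ℂ w (matrixOp a v) = ∑ i, ∑ j, inner ℂ (w i) (a i j (v j)) := by
  rw [PiLp.inner_apply]
  exact Finset.sum_congr rfl fun i _ => by rw [matrixOp_apply, inner_sum]

theorem IsCBBound.norm_sum_inner_le {E : Type*} [NormedAddCommGroup E] [InnerProductSpace ℂ E]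
    [CompleteSpace E] {A : StarSubalgebra ℂ (E →L[ℂ] E)} {M : A →ₗ[ℂ] A} {C : ℝ}
    (hC : IsCBBound M C) {n : ℕ} (a : Matrix (Fin n) (Fin n) A) {K : ℝ}
    (hK : ‖matrixOp (Matrix.of fun i j => (a i j : E →L[ℂ] E))‖ ≤ K)
    (v w : PiLp 2 (fun _ : Fin n => E)) :
    ‖∑ i, ∑ j, inner ℂ (w i) ((M (a i j) : E →L[ℂ] E) (v j))‖ ≤ C * K * ‖v‖ * ‖w‖ := by
  have h := inner_matrixOp (Matrix.of fun i j => (M (a i j) : E →L[ℂ] E)) v w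
  simp only [Matrix.of_apply] at h
  rw [← h]
  calc _ ≤ ‖w‖ * ‖matrixOp (Matrix.of fun i j => (M (a i j) : E →L[ℂ] E)) v‖ :=
        norm_inner_le_norm _ _
    _ ≤ ‖w‖ * ((C * K) * ‖v‖) := by
      gcongr
      exact ContinuousLinearMap.le_of_opNorm_le _
        ((hC.2 n a).trans (mul_le_mul_of_nonneg_left hK hC.1)) v
    _ = _ := by ring

/-- A completely bounded multiplier defines a bounded Schur multiplier. -/
theorem schurBound_of_isCBBound {φ : G → ℂ} {M : groupVN G →ₗ[ℂ] groupVN G}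
    (hM : ∀ g : G, M (vnUnitary g) = φ g • vnUnitary g) {C : ℝ} (hC : IsCBBound M C) :
    SchurBound φ C := by
  refine ⟨hC.1, fun n y z b K hb => ⟨mul_nonneg hC.1 hb.1, fun c d => ?_⟩⟩
  obtain ⟨ζ, hζ⟩ := exists_unit_LTwo (G := G)
  -- The translates of `ζ` are chosen so that `⟨λ(yᵢ)ζ, λ(yᵢzⱼ)λ(zⱼ)⁻¹ζ⟩ = 1`; pairing with them
  -- recovers the scalar entries `φ(yᵢzⱼ) b i j`.
  let v : PiLp 2 (fun _ : Fin n => LTwo G) :=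
    WithLp.toLp 2 fun j => c j • leftRegular (z j)⁻¹ ζ
  let w : PiLp 2 (fun _ : Fin n => LTwo G) :=
    WithLp.toLp 2 fun i => d i • leftRegular (y i) ζ
  have hv : ‖v‖ = √(∑ j, ‖c j‖ ^ 2) := by
    rw [PiLp.norm_eq_of_L2]
    simp [v, norm_smul, norm_leftRegular_apply, hζ]
  have hw : ‖w‖ = √(∑ j, ‖d j‖ ^ 2) := by
    rw [PiLp.norm_eq_of_L2]
    simp [w, norm_smul, norm_leftRegular_apply, hζ]
  have h3 := hC.norm_sum_inner_le (fun i j => b i j • vnUnitary (y i * z j))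
    (norm_matrixOp_regular_le y z hb) v w
  rw [hv, hw] at h3
  refine le_trans (le_of_eq ?_) h3
  congr 1
  refine Finset.sum_congr rfl fun i _ => Finset.sum_congr rfl fun j _ => ?_
  have h4 : ((M (b i j • vnUnitary (y i * z j)) : groupVN G) : LTwo G →L[ℂ] LTwo G) =
      (b i j * φ (y i * z j)) • leftRegular (y i * z j) := by
    rw [map_smul, hM, smul_smul]; rfl
  have h5 : leftRegular (z j) (leftRegular (z j)⁻¹ ζ) = ζ := by
    simpa using leftRegular_inv_apply (z j)⁻¹ ζ
  have h6 : inner ℂ (leftRegular (y i) ζ) (leftRegular (y i * z j) (leftRegular (z j)⁻¹ ζ)) =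
      (1 : ℂ) := by
    rw [leftRegular_mul, mul_apply_eq_comp, h5, inner_leftRegular_leftRegular,
      inner_self_eq_norm_sq_to_K, hζ]
    simp
  rw [h4]
  simp only [v, w, smul_apply, inner_smul_right, inner_smul_left, map_smul]
  rw [h6]
  ring

theorem continuous_vectorFunctional_leftRegular (ξ η : lp (fun _ : ℕ => LTwo G) 2) :
    Continuous fun g : G => vectorFunctional ξ η (leftRegular g) := by
  have hs : Summable fun n => ‖η n‖ * ‖ξ n‖ :=
    lp.summable_mul (by rw [Real.holderConjugate_iff]; norm_num) η ξ
  refine continuous_tsum (fun n => ?_) hs fun n g => ?_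
  · exact continuous_const.inner (continuous_leftRegular_apply _)
  · exact (norm_inner_le_norm _ _).trans (by rw [norm_leftRegular_apply])

theorem continuous_vnUnitary :
    @Continuous G (groupVN G) _ (ultraweakOn (groupVN G)) (vnUnitary (G := G)) := by
  rw [ultraweakOn.eq_def, continuous_induced_rng, ultraweakTopology]
  simp only [continuous_iInf_rng, continuous_induced_rng]
  exact continuous_vectorFunctional_leftRegular

/-- Normality makes `g ↦ φ(g)⟨λ(g₀)ζ, λ(g)ζ⟩` continuous, and the coefficient on the right does not
vanish near `g₀`. -/
theorem IsMultiplierMap.continuous {φ : G → ℂ} {M : groupVN G →ₗ[ℂ] groupVN G}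
    (hM : IsMultiplierMap φ M) : Continuous φ := by
  classical
  obtain ⟨ζ, hζ⟩ := exists_unit_LTwo (G := G)
  refine continuous_iff_continuousAt.2 fun g₀ => ?_
  have hn := (isNormalMap_iff M).1 hM.1 (lp.single 2 0 ζ) (lp.single 2 0 (leftRegular g₀ ζ))
  have hvf : ∀ x : LTwo G →L[ℂ] LTwo G, vectorFunctional (lp.single 2 0 ζ)
      (lp.single 2 0 (leftRegular g₀ ζ)) x = inner ℂ (leftRegular g₀ ζ) (x ζ) := by
    intro x
    rw [vectorFunctional, tsum_eq_single 0]
    · simp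
    · intro n hn; simp [hn]
  have h1 : Continuous fun g : G => φ g * inner ℂ (leftRegular g₀ ζ) (leftRegular g ζ) := by
    have := @Continuous.comp _ _ _ _ (ultraweakOn (groupVN G)) _ _ _ hn continuous_vnUnitary
    refine this.congr fun g => ?_
    rw [Function.comp_apply, hvf, hM.2]
    change inner ℂ (leftRegular g₀ ζ) (φ g • leftRegular g ζ) = _
    rw [inner_smul_right]
  have h2 : Continuous fun g : G => inner ℂ (leftRegular g₀ ζ) (leftRegular g ζ) :=
    continuous_const.inner (continuous_leftRegular_apply _)
  have h3 : inner ℂ (leftRegular g₀ ζ) (leftRegular g₀ ζ) ≠ (0 : ℂ) := by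
    rw [inner_self_eq_norm_sq_to_K, norm_leftRegular_apply, hζ]; simp
  refine (h1.continuousAt.div h2.continuousAt h3).congr ?_
  filter_upwards [h2.continuousAt.eventually_ne h3] with g hg
  exact mul_div_cancel_right₀ _ hg

theorem M0A.continuous (φ : M0A G) : Continuous (φ : G → ℂ) := by
  obtain ⟨M, hM, -⟩ := φ.2
  exact hM.continuous

theorem M0A.exists_schurBound (φ : M0A G) : ∃ C, SchurBound (φ : G → ℂ) C := by
  obtain ⟨M, hM, C, hC⟩ := φ.2
  exact ⟨C, schurBound_of_isCBBound hM.2 hC⟩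

theorem cbNorm_nonneg {M : groupVN G →ₗ[ℂ] groupVN G} : 0 ≤ cbNorm M :=
  Real.sInf_nonneg fun _ h => h.1

/-- Both infima defining the norm are approached up to `ε`, and Schur bounds are closed under `ε →
0`; uniqueness of the multiplier map is not needed. -/
theorem schurBound_of_m0aNorm_le {φ : M0A G} {C : ℝ} (hC : 0 ≤ C) (h : m0aNorm φ ≤ C) :
    SchurBound (φ : G → ℂ) C := by
  refine SchurBound.of_forall_lt hC fun ε hε => ?_
  obtain ⟨M₀, hM₀, hM₀'⟩ := φ.2
  obtain ⟨r, ⟨M, hM, hMcb, rfl⟩, hr⟩ := exists_lt_of_csInf_lt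
    (s := {r | ∃ M : groupVN G →ₗ[ℂ] groupVN G,
      IsMultiplierMap (φ : G → ℂ) M ∧ IsCompletelyBounded M ∧ r = cbNorm M})
    ⟨_, M₀, hM₀, hM₀', rfl⟩ (show m0aNorm φ < C + ε by linarith)
  obtain ⟨D, hD, hDr⟩ := exists_lt_of_csInf_lt (s := {C | IsCBBound M C}) hMcb hr
  have hb : IsCBBound M (C + ε) := ⟨by linarith, fun n a => (hD.2 n a).trans
    (mul_le_mul_of_nonneg_right hDr.le (norm_nonneg _))⟩
  exact schurBound_of_isCBBound hM.2 hb

theorem m0aNorm_le {φ : M0A G} {M : groupVN G →ₗ[ℂ] groupVN G}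
    (hM : IsMultiplierMap (φ : G → ℂ) M) {C : ℝ} (hC : IsCBBound M C) : m0aNorm φ ≤ C := by
  refine (csInf_le (s := {r | ∃ M : groupVN G →ₗ[ℂ] groupVN G,
      IsMultiplierMap (φ : G → ℂ) M ∧ IsCompletelyBounded M ∧ r = cbNorm M})
    ⟨0, ?_⟩ ⟨M, hM, ⟨C, hC⟩, rfl⟩).trans (csInf_le (s := {C | IsCBBound M C}) ⟨0, ?_⟩ hC)
  · rintro _ ⟨N, -, -, rfl⟩
    exact cbNorm_nonneg
  · exact fun _ h => h.1

end SchurBound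

/-! ### Hilbert's inequality and the unboundedness of triangular truncation. -/

section HilbertMatrix

open Complex in
theorem integral_exp_two_pi (k : ℤ) :
    ∫ θ in (0 : ℝ)..1, exp (2 * Real.pi * I * k * θ) = if k = 0 then 1 else 0 := by
  split_ifs with hk
  · simp [hk]
  · have hc : (2 * Real.pi * I * k : ℂ) ≠ 0 := by
      simp [Real.pi_ne_zero, hk]
    rw [integral_exp_mul_complex hc]
    have : exp (2 * Real.pi * I * k * (1 : ℝ)) = 1 := by
      rw [Complex.exp_eq_one_iff]
      exact ⟨k, by push_cast; ring⟩
    rw [this, Complex.ofReal_zero, mul_zero, Complex.exp_zero, sub_self, zero_div]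

open Complex in
-- These Fourier coefficients exhibit the Hilbert matrix as the Toeplitz matrix of a bounded
-- function. At `k = 0` both sides vanish, the right one by the convention `1 / 0 = 0`.
theorem integral_sawtooth_mul_exp (k : ℤ) :
    ∫ θ in (0 : ℝ)..1, ((θ : ℂ) - 1 / 2) * exp (2 * Real.pi * I * k * θ) =
      1 / (2 * Real.pi * I * k) := by
  rcases eq_or_ne k 0 with hk | hk
  · subst hk
    have : ∫ θ in (0 : ℝ)..1, ((θ : ℂ) - 1 / 2) = ((∫ θ in (0 : ℝ)..1, (θ - 1 / 2) : ℝ) : ℂ) := by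
      rw [← intervalIntegral.integral_ofReal]; push_cast; rfl
    simp only [Int.cast_zero, mul_zero, zero_mul, Complex.exp_zero, mul_one, div_zero]
    rw [this, intervalIntegral.integral_sub (by simp) (by simp)]
    norm_num
  · have hc : (2 * Real.pi * I * k : ℂ) ≠ 0 := by
      simp [Real.pi_ne_zero, hk]
    set a : ℂ := 2 * Real.pi * I * k with ha
    have he : exp (a * (1 : ℝ)) = 1 := by
      rw [Complex.exp_eq_one_iff]
      exact ⟨k, by rw [ha]; push_cast; ring⟩
    have hd : ∀ θ ∈ Set.uIcc (0 : ℝ) 1,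
        HasDerivAt (fun θ : ℝ => (((θ : ℂ) - 1 / 2) / a - 1 / a ^ 2) * exp (a * θ))
          (((θ : ℂ) - 1 / 2) * exp (a * θ)) θ := by
      intro θ _
      have h1 : HasDerivAt (fun θ : ℝ => (((θ : ℂ) - 1 / 2) / a - 1 / a ^ 2)) (1 / a) θ :=
        ((((hasDerivAt_id θ).ofReal_comp).sub_const _).div_const a).sub_const _
      have h2 : HasDerivAt (fun θ : ℝ => exp (a * θ)) (exp (a * θ) * (a * 1)) θ :=
        (((hasDerivAt_id θ).ofReal_comp).const_mul a).cexp
      refine (h1.mul h2).congr_deriv ?_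
      have h3 : 1 / a ^ 2 * a = 1 / a := by field_simp
      have h4 : ((θ : ℂ) - 1 / 2) / a * a = (θ : ℂ) - 1 / 2 := div_mul_cancel₀ _ hc
      linear_combination (exp (a * θ)) * h4 - (exp (a * θ)) * h3
    rw [intervalIntegral.integral_eq_sub_of_hasDerivAt hd
      (Continuous.intervalIntegrable (by fun_prop) _ _), he]
    simp only [ofReal_one, ofReal_zero, mul_zero, Complex.exp_zero]
    field_simp
    ring

open Complex in
theorem integral_normSq_trigPolynomial {n : ℕ} (c : Fin n → ℂ) :
    ∫ θ in (0 : ℝ)..1, ‖∑ j, c j * exp (-(2 * Real.pi * I * (j : ℕ) * θ))‖ ^ 2 =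
      ∑ j, ‖c j‖ ^ 2 := by
  have h1 : ∀ θ : ℝ, ((‖∑ j, c j * exp (-(2 * Real.pi * I * (j : ℕ) * θ))‖ ^ 2 : ℝ) : ℂ) =
      ∑ i, ∑ j, (c j * starRingEnd ℂ (c i)) *
        exp (2 * Real.pi * I * (((i : ℕ) : ℤ) - ((j : ℕ) : ℤ) : ℤ) * θ) := by
    intro θ
    push_cast
    rw [← Complex.conj_mul', map_sum, Finset.sum_mul_sum]
    refine Finset.sum_congr rfl fun i _ => Finset.sum_congr rfl fun j _ => ?_
    rw [map_mul, ← Complex.exp_conj]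
    simp only [map_neg, map_mul, Complex.conj_ofReal, Complex.conj_I, map_ofNat, map_natCast]
    rw [show (2 * Real.pi * I * (((i : ℕ) : ℂ) - ((j : ℕ) : ℂ)) * θ : ℂ) =
      -(2 * Real.pi * -I * (i : ℕ) * θ) + -(2 * Real.pi * I * (j : ℕ) * θ) by ring, Complex.exp_add]
    ring
  apply Complex.ofReal_injective
  rw [← intervalIntegral.integral_ofReal]
  simp_rw [h1]
  rw [intervalIntegral.integral_finsetSum
    (fun i _ => Continuous.intervalIntegrable (by fun_prop) _ _)]
  push_cast
  refine Finset.sum_congr rfl fun i _ => ?_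
  rw [intervalIntegral.integral_finsetSum
    (fun i _ => Continuous.intervalIntegrable (by fun_prop) _ _)]
  simp_rw [intervalIntegral.integral_const_mul]
  have h2 : ∀ j : Fin n, ∫ θ in (0 : ℝ)..1,
      exp (2 * Real.pi * I * (((i : ℕ) : ℂ) - ((j : ℕ) : ℂ)) * θ) = if i = j then 1 else 0 := by
    intro j
    have := integral_exp_two_pi (((i : ℕ) : ℤ) - ((j : ℕ) : ℤ))
    push_cast at this
    rw [this]
    refine if_congr ?_ rfl rfl
    rw [sub_eq_zero, Nat.cast_inj, Fin.ext_iff]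
  simp_rw [h2]
  simp [Complex.mul_conj']

/-- Hilbert's inequality for the matrix `1 / (i - j)`. -/
theorem matBound_hilbert (n : ℕ) :
    MatBound (fun i j : Fin n => 1 / (((i : ℕ) : ℂ) - ((j : ℕ) : ℂ))) Real.pi := by
  refine ⟨Real.pi_pos.le, fun c d => ?_⟩
  let P : (Fin n → ℂ) → ℝ → ℂ := fun c θ =>
    ∑ j, c j * Complex.exp (-(2 * Real.pi * Complex.I * (j : ℕ) * θ))
  have hP : ∀ c, Continuous (P c) := fun c => by fun_prop
  -- The form is `2πi` times the integral of the sawtooth against a product of two trigonometric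
  -- polynomials; the diagonal entries `1 / 0` are zero.
  have hrep : ∑ i : Fin n, ∑ j : Fin n, 1 / (((i : ℕ) : ℂ) - ((j : ℕ) : ℂ)) * (starRingEnd ℂ (d i) * c j) =
      (2 * Real.pi * Complex.I) *
        ∫ θ in (0 : ℝ)..1, ((θ : ℂ) - 1 / 2) * (starRingEnd ℂ (P d θ) * P c θ) := by
    have h1 : ∀ θ : ℝ, ((θ : ℂ) - 1 / 2) * (starRingEnd ℂ (P d θ) * P c θ) =
        ∑ i, ∑ j, (starRingEnd ℂ (d i) * c j) * (((θ : ℂ) - 1 / 2) *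
          Complex.exp (2 * Real.pi * Complex.I * (((i : ℕ) : ℂ) - ((j : ℕ) : ℂ)) * θ)) := by
      intro θ
      simp only [P]
      rw [map_sum, Finset.sum_mul_sum, Finset.mul_sum]
      refine Finset.sum_congr rfl fun i _ => ?_
      rw [Finset.mul_sum]
      refine Finset.sum_congr rfl fun j _ => ?_
      rw [map_mul, ← Complex.exp_conj]
      simp only [map_neg, map_mul, Complex.conj_ofReal, Complex.conj_I, map_ofNat, map_natCast]
      rw [show (2 * Real.pi * Complex.I * (((i : ℕ) : ℂ) - ((j : ℕ) : ℂ)) * θ : ℂ) =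
        -(2 * Real.pi * -Complex.I * (i : ℕ) * θ) + -(2 * Real.pi * Complex.I * (j : ℕ) * θ) by ring,
        Complex.exp_add]
      ring
    simp_rw [h1]
    rw [intervalIntegral.integral_finsetSum
      (fun i _ => Continuous.intervalIntegrable (by fun_prop) _ _), Finset.mul_sum]
    refine Finset.sum_congr rfl fun i _ => ?_
    rw [intervalIntegral.integral_finsetSum
      (fun i _ => Continuous.intervalIntegrable (by fun_prop) _ _), Finset.mul_sum]
    refine Finset.sum_congr rfl fun j _ => ?_
    rw [intervalIntegral.integral_const_mul]
    have := integral_sawtooth_mul_exp (((i : ℕ) : ℤ) - ((j : ℕ) : ℤ))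
    push_cast at this
    rw [this, ← one_div_mul_one_div]
    have hpi : (2 * Real.pi * Complex.I : ℂ) ≠ 0 := by simp [Real.pi_ne_zero]
    linear_combination -(1 / (((i : ℕ) : ℂ) - ((j : ℕ) : ℂ)) * (starRingEnd ℂ (d i) * c j)) *
      mul_one_div_cancel hpi
  -- The sawtooth is at most `1/2` in absolute value, and the arithmetic–geometric mean inequality
  -- stands in for Cauchy–Schwarz; the product bound is recovered by scaling.
  have hgen : ∀ c d : Fin n → ℂ, ‖∫ θ in (0 : ℝ)..1, ((θ : ℂ) - 1 / 2) *
      (starRingEnd ℂ (P d θ) * P c θ)‖ ≤ (1 / 2) * ((∑ j, ‖c j‖ ^ 2 + ∑ i, ‖d i‖ ^ 2) / 2) := by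
    intro c d
    rw [← integral_normSq_trigPolynomial c, ← integral_normSq_trigPolynomial d,
      ← intervalIntegral.integral_add (Continuous.intervalIntegrable (by fun_prop) _ _)
        (Continuous.intervalIntegrable (by fun_prop) _ _), ← intervalIntegral.integral_div,
      ← intervalIntegral.integral_const_mul]
    refine intervalIntegral.norm_integral_le_of_norm_le zero_le_one
      (Filter.Eventually.of_forall fun θ hθ => ?_) (Continuous.intervalIntegrable (by fun_prop) _ _)
    rw [norm_mul, norm_mul, RCLike.norm_conj]
    have h1 : ‖((θ : ℂ) - 1 / 2)‖ ≤ 1 / 2 := by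
      rw [show ((θ : ℂ) - 1 / 2) = ((θ - 1 / 2 : ℝ) : ℂ) by push_cast; rfl, Complex.norm_real,
        Real.norm_eq_abs, abs_le]
      constructor <;> linarith [hθ.1, hθ.2]
    refine mul_le_mul h1 ?_ (by positivity) (by norm_num)
    change ‖P d θ‖ * ‖P c θ‖ ≤ (‖P c θ‖ ^ 2 + ‖P d θ‖ ^ 2) / 2
    nlinarith [sq_nonneg (‖P d θ‖ - ‖P c θ‖)]
  rw [hrep, norm_mul]
  have hnorm : ‖(2 * Real.pi * Complex.I : ℂ)‖ = 2 * Real.pi := by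
    simp [abs_of_pos Real.pi_pos]
  rw [hnorm]
  set x := √(∑ j, ‖c j‖ ^ 2) with hx
  set y := √(∑ i, ‖d i‖ ^ 2) with hy
  have hscale : ∀ (a : ℝ) (c : Fin n → ℂ) θ, P (fun j => (a : ℂ) * c j) θ = a * P c θ := by
    intro a c θ
    simp only [P, Finset.mul_sum, mul_assoc]
  have hx2 : ∑ j, ‖c j‖ ^ 2 = x ^ 2 := (Real.sq_sqrt (Finset.sum_nonneg fun _ _ => sq_nonneg _)).symm
  have hy2 : ∑ j, ‖d j‖ ^ 2 = y ^ 2 := (Real.sq_sqrt (Finset.sum_nonneg fun _ _ => sq_nonneg _)).symm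
  have hx0 : 0 ≤ x := Real.sqrt_nonneg _
  have hy0 : 0 ≤ y := Real.sqrt_nonneg _
  set Z := ∫ θ in (0 : ℝ)..1, ((θ : ℂ) - 1 / 2) * (starRingEnd ℂ (P d θ) * P c θ) with hZ
  -- Replacing `c` by `y • c` and `d` by `x • d` equalises the two norms, so the arithmetic mean
  -- becomes the product.
  have key : x * y * ‖Z‖ ≤ (1 / 2) * (x * y) * (x * y) := by
    have h := hgen (fun j => (y : ℂ) * c j) (fun i => (x : ℂ) * d i)
    simp_rw [hscale] at h
    have h1 : ∀ θ : ℝ, ((θ : ℂ) - 1 / 2) * (starRingEnd ℂ (x * P d θ) * (y * P c θ)) =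
        ((x * y : ℝ) : ℂ) * (((θ : ℂ) - 1 / 2) * (starRingEnd ℂ (P d θ) * P c θ)) := by
      intro θ
      rw [map_mul, Complex.conj_ofReal]; push_cast; ring
    simp_rw [h1] at h
    rw [intervalIntegral.integral_const_mul, norm_mul, Complex.norm_real,
      Real.norm_of_nonneg (by positivity)] at h
    simp_rw [norm_mul, mul_pow, Complex.norm_real, Real.norm_eq_abs, sq_abs] at h
    rw [← Finset.mul_sum, ← Finset.mul_sum, hx2, hy2] at h
    calc _ ≤ _ := h
      _ = _ := by ring
  rcases (mul_nonneg hx0 hy0).eq_or_lt with h0 | h0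
  · have : c = 0 ∨ d = 0 := by
      rcases mul_eq_zero.1 h0.symm with h | h
      · left
        rw [h] at hx2
        have := (Finset.sum_eq_zero_iff_of_nonneg (fun _ _ => sq_nonneg _)).1
          (hx2.trans (by norm_num))
        funext j; simpa using this j (Finset.mem_univ _)
      · right
        rw [h] at hy2
        have := (Finset.sum_eq_zero_iff_of_nonneg (fun _ _ => sq_nonneg _)).1
          (hy2.trans (by norm_num))
        funext j; simpa using this j (Finset.mem_univ _)
    have hZ0 : Z = 0 := by
      rcases this with h | h
      · simp [hZ, P, h]
      · simp [hZ, P, h]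
    rw [hZ0, norm_zero, mul_zero]
    have := Real.pi_pos
    positivity
  · have h2 : ‖Z‖ ≤ (1 / 2) * (x * y) := by
      refine le_of_mul_le_mul_left ?_ h0
      linarith
    calc 2 * Real.pi * ‖Z‖ ≤ 2 * Real.pi * ((1 / 2) * (x * y)) := by
          have := Real.pi_pos
          gcongr
      _ = _ := by ring

/-- Each of the `m` rows `i` with `m ≤ i < 2m` contains `1, 1/2, …, 1/i` below the diagonal, which
already dominates the `m`-th harmonic sum. -/
theorem sum_lower_hilbert (m : ℕ) :
    (m : ℝ) * ∑ k ∈ Finset.range m, (1 / ((k : ℝ) + 1)) ≤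
      ∑ i ∈ Finset.range (2 * m), ∑ j ∈ Finset.range (2 * m),
        if j ≤ i then 1 / ((i : ℝ) - j) else 0 := by
  have hnn : ∀ i j : ℕ, 0 ≤ if j ≤ i then 1 / ((i : ℝ) - j) else 0 := by
    intro i j
    split_ifs with h
    · have : (j : ℝ) ≤ i := by exact_mod_cast h
      exact one_div_nonneg.2 (by linarith)
    · exact le_rfl
  have hrow : ∀ i ∈ Finset.Ico m (2 * m), ∑ k ∈ Finset.range m, (1 / ((k : ℝ) + 1)) ≤
      ∑ j ∈ Finset.range (2 * m), if j ≤ i then 1 / ((i : ℝ) - j) else 0 := by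
    intro i hi
    rw [Finset.mem_Ico] at hi
    calc ∑ k ∈ Finset.range m, (1 / ((k : ℝ) + 1)) ≤ ∑ k ∈ Finset.range i, (1 / ((k : ℝ) + 1)) :=
          Finset.sum_le_sum_of_subset_of_nonneg (Finset.range_subset_range.2 hi.1)
            fun _ _ _ => by positivity
      _ = ∑ j ∈ Finset.range i, if j ≤ i then 1 / ((i : ℝ) - j) else 0 := by
          rw [← Finset.sum_range_reflect]
          refine Finset.sum_congr rfl fun j hj => ?_
          have hj' := Finset.mem_range.1 hj
          rw [if_pos hj'.le]
          congr 1
          rw [Nat.sub_sub, Nat.cast_sub (by omega)]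
          push_cast; ring
      _ ≤ _ := Finset.sum_le_sum_of_subset_of_nonneg
          (Finset.range_subset_range.2 hi.2.le) fun _ _ _ => hnn _ _
  calc _ = ∑ i ∈ Finset.Ico m (2 * m), ∑ k ∈ Finset.range m, (1 / ((k : ℝ) + 1)) := by
        rw [Finset.sum_const, Nat.card_Ico, nsmul_eq_mul]
        congr 2
        omega
    _ ≤ ∑ i ∈ Finset.Ico m (2 * m), ∑ j ∈ Finset.range (2 * m),
        if j ≤ i then 1 / ((i : ℝ) - j) else 0 := Finset.sum_le_sum hrow
    _ ≤ _ := by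
        refine Finset.sum_le_sum_of_subset_of_nonneg (fun i hi => ?_)
          fun i _ _ => Finset.sum_nonneg fun j _ => hnn i j
        rw [Finset.mem_Ico] at hi
        exact Finset.mem_range.2 hi.2

theorem sum_hilbert_eq_zero (n : ℕ) :
    ∑ i ∈ Finset.range n, ∑ j ∈ Finset.range n, 1 / ((i : ℂ) - j) = 0 := by
  have h : ∑ i ∈ Finset.range n, ∑ j ∈ Finset.range n, 1 / ((i : ℂ) - j) =
      -∑ i ∈ Finset.range n, ∑ j ∈ Finset.range n, 1 / ((i : ℂ) - j) := by
    conv_lhs => rw [Finset.sum_comm]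
    rw [← Finset.sum_neg_distrib]
    refine Finset.sum_congr rfl fun i _ => ?_
    rw [← Finset.sum_neg_distrib]
    refine Finset.sum_congr rfl fun j _ => ?_
    rw [← neg_sub, one_div_neg_eq_neg_one_div]
  exact self_eq_neg.1 h

/-- The main triangular truncations of bounded matrices with constant triangles grow at most
linearly only if both constants agree. -/
theorem eq_of_triangular_bound {α β : ℂ} {C : ℝ}
    (h : ∀ n : ℕ, ‖∑ i ∈ Finset.range n, ∑ j ∈ Finset.range n,
      (if j ≤ i then β else α) * (1 / ((i : ℂ) - j))‖ ≤ C * n) : α = β := by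
  by_contra hne
  have hpos : 0 < ‖β - α‖ := norm_pos_iff.2 (sub_ne_zero.2 (Ne.symm hne))
  -- The full antisymmetric sum is zero, so subtracting `α` times it leaves `β - α` times the lower
  -- triangle. The linear bound at size `2m` would then bound the harmonic series.
  have hbound : ∀ m : ℕ, 0 < m →
      ∑ k ∈ Finset.range m, (1 / ((k : ℝ) + 1)) ≤ 2 * C / ‖β - α‖ := by
    intro m hm
    have h1 : ∑ i ∈ Finset.range (2 * m), ∑ j ∈ Finset.range (2 * m),
        (if j ≤ i then β else α) * (1 / ((i : ℂ) - j)) = (β - α) *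
          ((∑ i ∈ Finset.range (2 * m), ∑ j ∈ Finset.range (2 * m),
            if j ≤ i then 1 / ((i : ℝ) - j) else 0 : ℝ) : ℂ) := by
      have h0 := congrArg (fun z => α * z) (sum_hilbert_eq_zero (2 * m))
      simp only [mul_zero] at h0
      rw [← sub_zero (∑ i ∈ Finset.range (2 * m), ∑ j ∈ Finset.range (2 * m), _), ← h0]
      push_cast
      simp_rw [Finset.mul_sum]
      rw [← Finset.sum_sub_distrib]
      refine Finset.sum_congr rfl fun i _ => ?_
      rw [← Finset.sum_sub_distrib]
      refine Finset.sum_congr rfl fun j _ => ?_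
      split_ifs <;> push_cast <;> ring
    have h2 := h (2 * m)
    rw [h1, norm_mul, Complex.norm_real] at h2
    have h3 := (sum_lower_hilbert m).trans (Real.le_norm_self _)
    have h4 : ‖β - α‖ * (m * ∑ k ∈ Finset.range m, (1 / ((k : ℝ) + 1))) ≤ C * (2 * m : ℕ) :=
      (mul_le_mul_of_nonneg_left h3 hpos.le).trans h2
    have hm' : (0 : ℝ) < m := by exact_mod_cast hm
    rw [le_div_iff₀ hpos]
    refine le_of_mul_le_mul_left ?_ hm'
    push_cast at h4
    linarith
  have htend := Real.tendsto_sum_range_one_div_nat_succ_atTop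
  obtain ⟨m, hm, hm0⟩ := ((htend.eventually_gt_atTop (2 * C / ‖β - α‖)).and
    (Filter.eventually_gt_atTop 0)).exists
  exact absurd (hbound m hm0) (not_le.2 hm)

end HilbertMatrix

/-! ### Normality and complete boundedness under composition, two-sided multiplication and `x ↦
M(x*)*`. -/

section OperatorMaps

variable {E : Type*} [NormedAddCommGroup E] [InnerProductSpace ℂ E] [CompleteSpace E]
  {A : StarSubalgebra ℂ (E →L[ℂ] E)}

theorem IsNormalMap.comp {M N : A →ₗ[ℂ] A} (hM : IsNormalMap M) (hN : IsNormalMap N) :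
    IsNormalMap (M ∘ₗ N) := by
  unfold IsNormalMap
  rw [LinearMap.coe_comp]
  exact @Continuous.comp _ _ _ (ultraweakOn A) (ultraweakOn A) (ultraweakOn A) _ _ hM hN

theorem IsCBBound.comp {M N : A →ₗ[ℂ] A} {C D : ℝ} (hM : IsCBBound M C) (hN : IsCBBound N D) :
    IsCBBound (M ∘ₗ N) (C * D) := by
  refine ⟨mul_nonneg hM.1 hN.1, fun n a => ?_⟩
  rw [mul_assoc]
  exact (hM.2 n (Matrix.of fun i j => N (a i j))).trans
    (mul_le_mul_of_nonneg_left (hN.2 n a) hM.1)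

theorem continuous_vectorFunctional (ξ η : lp (fun _ : ℕ => E) 2) :
    @Continuous A ℂ (ultraweakOn A) _ fun x => vectorFunctional ξ η (x : E →L[ℂ] E) := by
  rw [ultraweakOn.eq_def, ultraweakTopology, induced_iInf]
  refine continuous_iInf_dom (i := ξ) ?_
  rw [induced_iInf]
  refine continuous_iInf_dom (i := η) ?_
  rw [induced_compose]
  exact continuous_induced_dom

theorem isNormalMap_of_forall_exists {M : A →ₗ[ℂ] A}
    (h : ∀ ξ η : lp (fun _ : ℕ => E) 2, ∃ ξ' η' : lp (fun _ : ℕ => E) 2, ∀ x : A,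
      vectorFunctional ξ η (M x : E →L[ℂ] E) = vectorFunctional ξ' η' (x : E →L[ℂ] E)) :
    IsNormalMap M := by
  rw [isNormalMap_iff]
  intro ξ η
  obtain ⟨ξ', η', h'⟩ := h ξ η
  simp_rw [h']
  exact continuous_vectorFunctional ξ' η'

theorem isNormalMap_mulLeftRight (b c : A) : IsNormalMap (LinearMap.mulLeftRight ℂ (b, c)) := by
  refine isNormalMap_of_forall_exists fun ξ η =>
    ⟨ampliation c ξ, ampliation (star (b : E →L[ℂ] E)) η, fun x => ?_⟩
  refine tsum_congr fun n => ?_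
  rw [LinearMap.mulLeftRight_apply, ampliation_apply, ampliation_apply,
    ContinuousLinearMap.star_eq_adjoint, ContinuousLinearMap.adjoint_inner_left]
  rfl

omit [CompleteSpace E] in
theorem norm_toLp_apply_le {n : ℕ} (c : E →L[ℂ] E) (v : PiLp 2 (fun _ : Fin n => E)) :
    ‖(WithLp.toLp 2 fun i => c (v i) : PiLp 2 (fun _ : Fin n => E))‖ ≤ ‖c‖ * ‖v‖ := by
  refine le_of_sq_le_sq ?_ (by positivity)
  rw [mul_pow, PiLp.norm_sq_eq_of_L2, PiLp.norm_sq_eq_of_L2, Finset.mul_sum]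
  refine Finset.sum_le_sum fun i _ => ?_
  rw [← mul_pow]
  exact pow_le_pow_left₀ (norm_nonneg _) (c.le_opNorm _) 2

/-- In every amplification `b*` and `c` act diagonally on the two vectors, so they cost only their
norms. -/
theorem isCBBound_mulLeftRight (b c : A) :
    IsCBBound (LinearMap.mulLeftRight ℂ (b, c)) (‖b‖ * ‖c‖) := by
  refine ⟨by positivity, fun n a => opNorm_le_of_inner (by positivity) fun v w => ?_⟩
  let v' : PiLp 2 (fun _ : Fin n => E) := WithLp.toLp 2 fun i => (c : E →L[ℂ] E) (v i)
  let w' : PiLp 2 (fun _ : Fin n => E) := WithLp.toLp 2 fun i => (star (b : E →L[ℂ] E)) (w i)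
  have h : inner ℂ w (matrixOp (Matrix.of fun i j =>
      (LinearMap.mulLeftRight ℂ (b, c) (a i j) : E →L[ℂ] E)) v) =
      inner ℂ w' (matrixOp (Matrix.of fun i j => (a i j : E →L[ℂ] E)) v') := by
    rw [inner_matrixOp, inner_matrixOp]
    refine Finset.sum_congr rfl fun i _ => Finset.sum_congr rfl fun j _ => ?_
    change inner ℂ (w i) ((b : E →L[ℂ] E) ((a i j : E →L[ℂ] E) ((c : E →L[ℂ] E) (v j)))) =
      inner ℂ (star (b : E →L[ℂ] E) (w i)) ((a i j : E →L[ℂ] E) ((c : E →L[ℂ] E) (v j)))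
    rw [ContinuousLinearMap.star_eq_adjoint, ContinuousLinearMap.adjoint_inner_left]
  rw [h]
  have hv : ‖v'‖ ≤ ‖c‖ * ‖v‖ := norm_toLp_apply_le _ v
  have hw : ‖w'‖ ≤ ‖b‖ * ‖w‖ := by
    have := norm_toLp_apply_le (star (b : E →L[ℂ] E)) w
    rwa [norm_star] at this
  set T := matrixOp (Matrix.of fun i j => (a i j : E →L[ℂ] E))
  calc _ ≤ ‖w'‖ * ‖T v'‖ := norm_inner_le_norm _ _
    _ ≤ ‖w'‖ * (‖T‖ * ‖v'‖) := by gcongr; exact T.le_opNorm _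
    _ ≤ (‖b‖ * ‖w‖) * (‖T‖ * (‖c‖ * ‖v‖)) := by gcongr
    _ = _ := by ring

theorem norm_matrixOp_star {n : ℕ} (a : Matrix (Fin n) (Fin n) (E →L[ℂ] E)) :
    ‖matrixOp (Matrix.of fun i j => star (a j i))‖ = ‖matrixOp a‖ := by
  have h : matrixOp (Matrix.of fun i j => star (a j i)) =
      ContinuousLinearMap.adjoint (matrixOp a) := by
    refine (ContinuousLinearMap.eq_adjoint_iff _ _).2 fun x y => ?_
    rw [inner_matrixOp, ← inner_conj_symm, inner_matrixOp, map_sum, Finset.sum_comm]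
    refine Finset.sum_congr rfl fun i _ => ?_
    rw [map_sum]
    refine Finset.sum_congr rfl fun j _ => ?_
    rw [inner_conj_symm, Matrix.of_apply, ContinuousLinearMap.star_eq_adjoint,
      ContinuousLinearMap.adjoint_inner_left]
  rw [h, LinearIsometryEquiv.norm_map]

/-- The map `x ↦ M(x*)*`. -/
noncomputable def conjMap (M : A →ₗ[ℂ] A) : A →ₗ[ℂ] A where
  toFun x := star (M (star x))
  map_add' x y := by simp
  map_smul' c x := by simp

theorem conjMap_apply (M : A →ₗ[ℂ] A) (x : A) : conjMap M x = star (M (star x)) := rfl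

theorem vectorFunctional_star (ξ η : lp (fun _ : ℕ => E) 2) (x : E →L[ℂ] E) :
    vectorFunctional ξ η (star x) = starRingEnd ℂ (vectorFunctional η ξ x) := by
  rw [vectorFunctional, vectorFunctional, Complex.conj_tsum]
  refine tsum_congr fun n => ?_
  rw [inner_conj_symm, ContinuousLinearMap.star_eq_adjoint,
    ContinuousLinearMap.adjoint_inner_right]

theorem IsNormalMap.conjMap {M : A →ₗ[ℂ] A} (hM : IsNormalMap M) : IsNormalMap (conjMap M) := by
  have hstar : @Continuous A A (ultraweakOn A) (ultraweakOn A) star := by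
    refine continuous_induced_rng.2 ?_
    unfold ultraweakTopology
    simp only [continuous_iInf_rng, continuous_induced_rng]
    intro ξ η
    have : vectorFunctional ξ η ∘ Subtype.val ∘ (star : A → A) =
        fun x : A => starRingEnd ℂ (vectorFunctional η ξ (x : E →L[ℂ] E)) := by
      funext x
      exact vectorFunctional_star ξ η _
    rw [this]
    exact @Continuous.comp _ _ _ (ultraweakOn A) _ _ _ _ Complex.continuous_conj
      (continuous_vectorFunctional η ξ)
  change @Continuous A A (ultraweakOn A) (ultraweakOn A) (star ∘ M ∘ star)
  exact @Continuous.comp _ _ _ (ultraweakOn A) (ultraweakOn A) (ultraweakOn A) _ _ hstar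
    (@Continuous.comp _ _ _ (ultraweakOn A) (ultraweakOn A) (ultraweakOn A) _ _ hM hstar)

theorem IsCBBound.conjMap {M : A →ₗ[ℂ] A} {C : ℝ} (hM : IsCBBound M C) :
    IsCBBound (conjMap M) C := by
  refine ⟨hM.1, fun n a => ?_⟩
  have h := hM.2 n (Matrix.of fun i j => star (a j i))
  have h1 := norm_matrixOp_star (Matrix.of fun i j => (a i j : E →L[ℂ] E))
  have h2 := norm_matrixOp_star (Matrix.of fun i j => (M (star (a j i)) : E →L[ℂ] E))
  rw [← h1]
  exact h2.le.trans h

end OperatorMaps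

/-! ### Translates and the involution on `M₀A(G)`. -/

section Translates

variable {G : Type*} [Group G] [TopologicalSpace G] [IsTopologicalGroup G]
  [LocallyCompactSpace G] [MeasurableSpace G] [BorelSpace G]

theorem vnUnitary_mul (g h : G) : vnUnitary (g * h) = vnUnitary g * vnUnitary h :=
  Subtype.ext (leftRegular_mul g h)

theorem star_vnUnitary (g : G) : star (vnUnitary g) = vnUnitary g⁻¹ :=
  Subtype.ext (star_leftRegular g)

/-- The multiplier map is `x ↦ λ(a)⁻¹ M(λ(a) x λ(b)) λ(b)⁻¹`. -/
theorem translate_mem_M0A {φ : G → ℂ} (hφ : φ ∈ M0A G) (a b : G) :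
    (fun g => φ (a * g * b)) ∈ M0A G := by
  obtain ⟨M, ⟨hM, hMφ⟩, C, hC⟩ := hφ
  refine ⟨LinearMap.mulLeftRight ℂ (vnUnitary a⁻¹, vnUnitary b⁻¹) ∘ₗ M ∘ₗ
    LinearMap.mulLeftRight ℂ (vnUnitary a, vnUnitary b),
    ⟨(isNormalMap_mulLeftRight _ _).comp (hM.comp (isNormalMap_mulLeftRight _ _)), fun g => ?_⟩,
    _, (isCBBound_mulLeftRight _ _).comp (hC.comp (isCBBound_mulLeftRight _ _))⟩
  simp only [LinearMap.comp_apply, LinearMap.mulLeftRight_apply]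
  rw [← vnUnitary_mul, ← vnUnitary_mul, hMφ, mul_smul_comm, smul_mul_assoc, ← vnUnitary_mul,
    ← vnUnitary_mul]
  congr 2
  group

theorem star_mem_M0A {φ : G → ℂ} (hφ : φ ∈ M0A G) :
    (fun g => starRingEnd ℂ (φ g⁻¹)) ∈ M0A G := by
  obtain ⟨M, ⟨hM, hMφ⟩, C, hC⟩ := hφ
  refine ⟨conjMap M, ⟨hM.conjMap, fun g => ?_⟩, C, hC.conjMap⟩
  rw [conjMap_apply, star_vnUnitary, hMφ, star_smul, star_vnUnitary, inv_inv]
  rfl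

/-- The translate `g ↦ φ(agb)` of a multiplier. -/
def M0A.translate (φ : M0A G) (a b : G) : M0A G :=
  ⟨fun g => (φ : G → ℂ) (a * g * b), translate_mem_M0A φ.2 a b⟩

/-- The unit of `M₀A(G)`. -/
def M0A.one : M0A G := ⟨fun _ => 1, one_mem_M0A⟩

/-- The involution `φ*(g) = conj φ(g⁻¹)` on multipliers. -/
def M0A.adjoint (φ : M0A G) : M0A G := ⟨fun g => starRingEnd ℂ ((φ : G → ℂ) g⁻¹), star_mem_M0A φ.2⟩

/-- The functional `φ ↦ conj m(φ*)`. -/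
def adjointFunctional (m : M0A G →ₗ[ℂ] ℂ) : M0A G →ₗ[ℂ] ℂ where
  toFun φ := starRingEnd ℂ (m (M0A.adjoint φ))
  map_add' φ ψ := by
    have : M0A.adjoint (φ + ψ) = M0A.adjoint φ + M0A.adjoint ψ :=
      Subtype.ext (funext fun g => map_add (starRingEnd ℂ) _ _)
    rw [this, map_add, map_add]
  map_smul' c φ := by
    have : M0A.adjoint (c • φ) = starRingEnd ℂ c • M0A.adjoint φ :=
      Subtype.ext (funext fun g => map_mul (starRingEnd ℂ) _ _)
    rw [this, map_smul, smul_eq_mul, map_mul, Complex.conj_conj]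
    rfl

end Translates

/-! ### Uniqueness of the invariant mean. -/

section Uniqueness

variable {G : Type*} [Group G] [TopologicalSpace G] [IsTopologicalGroup G]
  [LocallyCompactSpace G] [MeasurableSpace G] [BorelSpace G]

/-- A functional of norm one on `M₀A(G)` with the uniform norm, taking the value one at the
constant function. -/
structure IsUnitalContraction (m : M0A G →ₗ[ℂ] ℂ) : Prop where
  map_one : m M0A.one = 1
  norm_le : ∀ (φ : M0A G) (C : ℝ), (∀ g, ‖(φ : G → ℂ) g‖ ≤ C) → ‖m φ‖ ≤ C

/-- Averaging some of the variables of a kernel `φ(st)` over a row of a matrix sum. -/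
theorem IsUnitalContraction.norm_sum_le {m : M0A G →ₗ[ℂ] ℂ} (hm : IsUnitalContraction m)
    {ι : Type*} (S : Finset ι) (P : ι → Prop) [DecidablePred P] (A : ι → ℂ) (ψ : ι → M0A G)
    (k : ι → ℂ) {γ : ℂ} (hγ : ∀ i, m (ψ i) = γ) {R : ℝ}
    (h : ∀ g, ‖∑ i ∈ S, (if P i then (ψ i : G → ℂ) g else k i) * A i‖ ≤ R) :
    ‖∑ i ∈ S, (if P i then γ else k i) * A i‖ ≤ R := by
  -- The whole sum is a multiplier in the free variable `g`, bounded uniformly by `R`, so `m` may be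
  -- applied to it at once.
  let Ψ : M0A G := ∑ i ∈ S, A i • (if P i then ψ i else k i • M0A.one)
  have hΨ : ∀ g, (Ψ : G → ℂ) g = ∑ i ∈ S, (if P i then (ψ i : G → ℂ) g else k i) * A i := by
    intro g
    simp only [Ψ, Submodule.coe_sum, Finset.sum_apply]
    refine Finset.sum_congr rfl fun i _ => ?_
    rw [mul_comm]
    split_ifs
    · rfl
    · change A i * (k i * 1) = _
      rw [mul_one]
  have hmΨ : m Ψ = ∑ i ∈ S, (if P i then γ else k i) * A i := by
    simp only [Ψ, map_sum, map_smul]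
    refine Finset.sum_congr rfl fun i _ => ?_
    rw [mul_comm]
    split_ifs
    · rw [hγ, smul_eq_mul]
    · rw [map_smul, hm.map_one, smul_eq_mul, smul_eq_mul, mul_one]
  rw [← hmΨ]
  exact hm.norm_le Ψ R fun g => by rw [hΨ]; exact h g

/-- The value of the kernel `φ(sᵢtⱼ)` after averaging all rows from `p` and columns from `q` on. -/
noncomputable def partialKernel (φ : G → ℂ) (α β : ℂ) (s t : ℕ → G) (p q i j : ℕ) : ℂ :=
  if i < p ∧ j < q then φ (s i * t j) else if j ≤ i then β else α

/-- The order of averaging decides the triangle: `n` removes the last remaining row, turning its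
entries up to the diagonal into `β`, and then `m` removes the last remaining column, turning its
entries above the diagonal into `α`. No step increases the bound `R`, because it holds for all
choices of the variable averaged out. -/
theorem norm_sum_triangular_le {m n : M0A G →ₗ[ℂ] ℂ} (hm : IsUnitalContraction m)
    (hn : IsUnitalContraction n) {φ : M0A G} {α β : ℂ}
    (hα : ∀ s, m (M0A.translate φ s 1) = α) (hβ : ∀ t, n (M0A.translate φ 1 t) = β)
    (N : ℕ) (A : ℕ → ℕ → ℂ) {R : ℝ}
    (h : ∀ s t : ℕ → G, ‖∑ i ∈ Finset.range N, ∑ j ∈ Finset.range N,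
      (φ : G → ℂ) (s i * t j) * A i j‖ ≤ R) :
    ‖∑ i ∈ Finset.range N, ∑ j ∈ Finset.range N, (if j ≤ i then β else α) * A i j‖ ≤ R := by
  -- Row `r` is averaged while column `r` is still present, so the diagonal entry receives `β`.
  have hrow : ∀ r : ℕ,
      (∀ s t : ℕ → G, ‖∑ x ∈ Finset.range N ×ˢ Finset.range N,
        partialKernel φ α β s t (r + 1) (r + 1) x.1 x.2 * A x.1 x.2‖ ≤ R) →
      ∀ s t : ℕ → G, ‖∑ x ∈ Finset.range N ×ˢ Finset.range N,
        partialKernel φ α β s t r (r + 1) x.1 x.2 * A x.1 x.2‖ ≤ R := by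
    intro r hr s t
    have := hn.norm_sum_le (Finset.range N ×ˢ Finset.range N)
      (fun x => x.1 = r ∧ x.2 < r + 1) (fun x => A x.1 x.2) (fun x => M0A.translate φ 1 (t x.2))
      (fun x => partialKernel φ α β s t r (r + 1) x.1 x.2) (γ := β) (fun x => hβ _) (R := R)
      (fun g => by
        refine le_trans (le_of_eq ?_) (hr (Function.update s r g) t)
        congr 1
        refine Finset.sum_congr rfl fun x _ => ?_
        congr 1
        obtain ⟨i, j⟩ := x
        simp only [M0A.translate, partialKernel, one_mul]
        rcases eq_or_ne i r with rfl | hi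
        · simp
        · have : i < r + 1 ↔ i < r := by omega
          simp [hi, this])
    refine le_trans (le_of_eq ?_) this
    congr 1
    refine Finset.sum_congr rfl fun x _ => ?_
    congr 1
    obtain ⟨i, j⟩ := x
    simp only [partialKernel]
    split_ifs <;> first | rfl | omega
  have hcol : ∀ r : ℕ,
      (∀ s t : ℕ → G, ‖∑ x ∈ Finset.range N ×ˢ Finset.range N,
        partialKernel φ α β s t r (r + 1) x.1 x.2 * A x.1 x.2‖ ≤ R) →
      ∀ s t : ℕ → G, ‖∑ x ∈ Finset.range N ×ˢ Finset.range N,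
        partialKernel φ α β s t r r x.1 x.2 * A x.1 x.2‖ ≤ R := by
    intro r hr s t
    have := hm.norm_sum_le (Finset.range N ×ˢ Finset.range N)
      (fun x => x.2 = r ∧ x.1 < r) (fun x => A x.1 x.2) (fun x => M0A.translate φ (s x.1) 1)
      (fun x => partialKernel φ α β s t r r x.1 x.2) (γ := α) (fun x => hα _) (R := R)
      (fun g => by
        refine le_trans (le_of_eq ?_) (hr s (Function.update t r g))
        congr 1
        refine Finset.sum_congr rfl fun x _ => ?_
        congr 1
        obtain ⟨i, j⟩ := x
        simp only [M0A.translate, partialKernel, mul_one]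
        rcases eq_or_ne j r with rfl | hj
        · simp
        · have : j < r + 1 ↔ j < r := by omega
          simp [hj, this])
    refine le_trans (le_of_eq ?_) this
    congr 1
    refine Finset.sum_congr rfl fun x _ => ?_
    congr 1
    obtain ⟨i, j⟩ := x
    simp only [partialKernel]
    split_ifs <;> first | rfl | omega
  -- The induction descends from the untouched kernel at `r = N` to the purely triangular one at `r
  -- = 0`.
  have hall : ∀ r : ℕ, r ≤ N → ∀ s t : ℕ → G, ‖∑ x ∈ Finset.range N ×ˢ Finset.range N,
      partialKernel φ α β s t r r x.1 x.2 * A x.1 x.2‖ ≤ R := by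
    intro r hr
    induction hr using Nat.decreasingInduction with
    | self =>
      intro s t
      refine le_trans (le_of_eq ?_) (h s t)
      rw [Finset.sum_product]
      congr 1
      refine Finset.sum_congr rfl fun i hi => Finset.sum_congr rfl fun j hj => ?_
      rw [partialKernel, if_pos ⟨Finset.mem_range.1 hi, Finset.mem_range.1 hj⟩]
    | of_succ r _ ih => exact hcol r (hrow r ih)
  have := hall 0 (Nat.zero_le _) 1 1
  rw [Finset.sum_product] at this
  simpa [partialKernel] using this

-- The Hilbert matrix is tested on all-ones vectors, each of norm `√N`; this yields linear growth.
omit [TopologicalSpace G] [IsTopologicalGroup G] [LocallyCompactSpace G] [MeasurableSpace G]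
  [BorelSpace G] in
theorem SchurBound.norm_sum_hilbert_le {φ : G → ℂ} {C : ℝ} (h : SchurBound φ C) (N : ℕ)
    (s t : ℕ → G) : ‖∑ i ∈ Finset.range N, ∑ j ∈ Finset.range N,
      φ (s i * t j) * (1 / ((i : ℂ) - j))‖ ≤ C * Real.pi * N := by
  have h1 := (h.2 N (fun i => s i) (fun j => t j) _ _ (matBound_hilbert N)).2
    (fun _ => 1) (fun _ => 1)
  simp only [map_one, mul_one, norm_one, one_pow, Finset.sum_const, Finset.card_univ,
    Fintype.card_fin, nsmul_eq_mul] at h1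
  rw [mul_assoc (C * Real.pi), Real.mul_self_sqrt (Nat.cast_nonneg _)] at h1
  refine le_trans (le_of_eq ?_) h1
  rw [Finset.sum_range]
  congr 1
  exact Finset.sum_congr rfl fun i _ => Finset.sum_range _

theorem eq_of_left_right_invariant {m n : M0A G →ₗ[ℂ] ℂ} (hm : IsUnitalContraction m)
    (hn : IsUnitalContraction n) (hml : ∀ φ s, m (M0A.translate φ s 1) = m φ)
    (hnr : ∀ φ t, n (M0A.translate φ 1 t) = n φ) : m = n := by
  ext φ
  obtain ⟨C, hC⟩ := M0A.exists_schurBound φ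
  refine eq_of_triangular_bound (C := C * Real.pi) fun N => ?_
  exact norm_sum_triangular_le hm hn (hml φ) (hnr φ) N _ (hC.norm_sum_hilbert_le N)

theorem IsLeftInvariantMean.isUnitalContraction {m : M0A G →ₗ[ℂ] ℂ}
    (hm : IsLeftInvariantMean m) : IsUnitalContraction m := ⟨hm.map_one, hm.norm_le⟩

/-- A left invariant mean on `M₀A(G)` is unique. -/
theorem IsLeftInvariantMean.unique {m m' : M0A G →ₗ[ℂ] ℂ} (hm : IsLeftInvariantMean m)
    (hm' : IsLeftInvariantMean m') : m = m' := by
  have hl : ∀ {m : M0A G →ₗ[ℂ] ℂ}, IsLeftInvariantMean m →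
      ∀ φ s, m (M0A.translate φ s 1) = m φ := fun {m} hm φ s =>
    hm.left_invariant s⁻¹ φ _ fun h => by simp [M0A.translate]
  -- The involution exchanges left and right translations. Both means are compared with this one
  -- right invariant functional.
  have hn : IsUnitalContraction (adjointFunctional m) := by
    refine ⟨?_, fun φ C hφ => ?_⟩
    · have : M0A.adjoint (M0A.one : M0A G) = M0A.one := Subtype.ext (funext fun g => map_one _)
      change starRingEnd ℂ (m (M0A.adjoint (M0A.one : M0A G))) = 1
      rw [this, hm.isUnitalContraction.map_one, map_one]
    · change ‖starRingEnd ℂ (m (M0A.adjoint φ))‖ ≤ C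
      rw [RCLike.norm_conj]
      refine hm.norm_le _ C fun g => ?_
      change ‖starRingEnd ℂ ((φ : G → ℂ) g⁻¹)‖ ≤ C
      rw [RCLike.norm_conj]
      exact hφ _
  have hr : ∀ φ t, adjointFunctional m (M0A.translate φ 1 t) = adjointFunctional m φ := by
    intro φ t
    change starRingEnd ℂ (m _) = starRingEnd ℂ (m _)
    congr 1
    refine hm.left_invariant t _ _ fun h => ?_
    simp [M0A.translate, M0A.adjoint]
  rw [eq_of_left_right_invariant hm.isUnitalContraction hn (hl hm) hr,
    eq_of_left_right_invariant hm'.isUnitalContraction hn (hl hm') hr]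

end Uniqueness

/-! ### Schur multipliers on finite orthogonal families. -/

section FiniteSchur

variable {G : Type*} [Group G] {φ : G → ℂ} {C : ℝ}

/-- A rectangular matrix becomes an off-diagonal block of a square one on `ι ⊕ κ`, padded with
zeros; the group elements on the padding are irrelevant. -/
theorem SchurBound.matBound {ι κ : Type*} [Fintype ι] [Fintype κ] (h : SchurBound φ C) (y : ι → G)
    (z : κ → G) {b : ι → κ → ℂ} {K : ℝ} (hb : MatBound b K) :
    MatBound (fun i j => φ (y i * z j) * b i j) (C * K) := by
  classical
  let e : Fin (Fintype.card (ι ⊕ κ)) ≃ ι ⊕ κ := (Fintype.equivFin (ι ⊕ κ)).symm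
  let b' : ι ⊕ κ → ι ⊕ κ → ℂ := fun s t => Sum.elim (fun i => Sum.elim (fun _ => 0) (b i) t)
    (fun _ => 0) s
  have hb' : MatBound (fun k l => b' (e k) (e l)) K := by
    refine ⟨hb.1, fun c d => ?_⟩
    have h1 := hb.2 (fun j => c (e.symm (Sum.inr j))) (fun i => d (e.symm (Sum.inl i)))
    have h2 : ∑ k, ∑ l, b' (e k) (e l) * (starRingEnd ℂ (d k) * c l) =
        ∑ i, ∑ j, b i j * (starRingEnd ℂ (d (e.symm (Sum.inl i))) * c (e.symm (Sum.inr j))) := by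
      rw [← e.symm.sum_comp, Fintype.sum_sum_type]
      simp_rw [← e.symm.sum_comp (fun l => _ * (_ * c l)), Fintype.sum_sum_type]
      simp [b']
    rw [h2]
    refine h1.trans ?_
    have hc : ∑ j, ‖c (e.symm (Sum.inr j))‖ ^ 2 ≤ ∑ l, ‖c l‖ ^ 2 := by
      rw [← e.symm.sum_comp, Fintype.sum_sum_type]
      exact le_add_of_nonneg_left (Finset.sum_nonneg fun _ _ => sq_nonneg _)
    have hd : ∑ i, ‖d (e.symm (Sum.inl i))‖ ^ 2 ≤ ∑ l, ‖d l‖ ^ 2 := by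
      rw [← e.symm.sum_comp, Fintype.sum_sum_type]
      exact le_add_of_nonneg_right (Finset.sum_nonneg fun _ _ => sq_nonneg _)
    have := hb.1
    gcongr
  have key := h.2 _ (fun k => Sum.elim y (fun _ => 1) (e k)) (fun l => Sum.elim (fun _ => 1) z (e l))
    _ K hb'
  refine ⟨key.1, fun c d => ?_⟩
  have h1 := key.2 (fun l => Sum.elim (fun _ => 0) c (e l)) (fun k => Sum.elim d (fun _ => 0) (e k))
  rw [e.sum_comp (fun s => ∑ l, φ (Sum.elim y (fun _ => 1) s *
      Sum.elim (fun _ => 1) z (e l)) * b' s (e l) *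
      (starRingEnd ℂ (Sum.elim d (fun _ => 0) s) * Sum.elim (fun _ => 0) c (e l))),
    e.sum_comp (fun s => ‖Sum.elim (fun _ => (0 : ℂ)) c s‖ ^ 2),
    e.sum_comp (fun s => ‖Sum.elim d (fun _ => (0 : ℂ)) s‖ ^ 2)] at h1
  simp_rw [fun s => e.sum_comp (fun t => φ (Sum.elim y (fun _ => 1) s *
      Sum.elim (fun _ => 1) z t) * b' s t *
      (starRingEnd ℂ (Sum.elim d (fun _ => 0) s) * Sum.elim (fun _ => 0) c t)),
    Fintype.sum_sum_type] at h1
  simpa [b'] using h1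

variable {F : Type*} [NormedAddCommGroup F] [InnerProductSpace ℂ F]

theorem norm_sq_sum_of_orthogonal {ι : Type*} [Fintype ι] {v : ι → F}
    (hv : Pairwise fun i j => inner ℂ (v i) (v j) = 0) : ‖∑ i, v i‖ ^ 2 = ∑ i, ‖v i‖ ^ 2 := by
  have h : ((‖∑ i, v i‖ ^ 2 : ℝ) : ℂ) = ((∑ i, ‖v i‖ ^ 2 : ℝ) : ℂ) := by
    have h1 := inner_self_eq_norm_sq_to_K (𝕜 := ℂ) (∑ i, v i)
    push_cast
    refine (h1.symm).trans ?_
    rw [sum_inner]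
    refine Finset.sum_congr rfl fun i _ => ?_
    rw [inner_sum, Finset.sum_eq_single i (fun j _ hj => hv hj.symm) (by simp),
      inner_self_eq_norm_sq_to_K]
    rfl
  exact_mod_cast h

theorem norm_sum_smul_normalize_le {ι : Type*} [Fintype ι] {v : ι → F}
    (hv : Pairwise fun i j => inner ℂ (v i) (v j) = 0) (c : ι → ℂ) :
    ‖∑ i, c i • ((‖v i‖⁻¹ : ℂ) • v i)‖ ≤ √(∑ i, ‖c i‖ ^ 2) := by
  refine Real.le_sqrt_of_sq_le ?_
  rw [norm_sq_sum_of_orthogonal]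
  · refine Finset.sum_le_sum fun i _ => ?_
    rw [norm_smul]
    exact pow_le_pow_left₀ (by positivity)
      (mul_le_of_le_one_right (norm_nonneg _) (norm_normalize_le _)) 2
  · intro i j hij
    rw [inner_smul_left, inner_smul_right, inner_smul_left, inner_smul_right, hv hij]
    simp only [mul_zero]

/-- Schur multipliers acting on the matrix coefficients of an operator. -/
theorem SchurBound.norm_sum_inner_le {ι κ : Type*} [Fintype ι] [Fintype κ] (h : SchurBound φ C)
    (y : ι → G) (z : κ → G) (X : F →L[ℂ] F) {α : ι → F} {β : κ → F}
    (hα : Pairwise fun i j => inner ℂ (α i) (α j) = 0)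
    (hβ : Pairwise fun i j => inner ℂ (β i) (β j) = 0) :
    ‖∑ i, ∑ j, φ (y i * z j) * inner ℂ (α i) (X (β j))‖ ≤
      C * ‖X‖ * √(∑ j, ‖β j‖ ^ 2) * √(∑ i, ‖α i‖ ^ 2) := by
  -- The matrix of `X` in normalised orthogonal systems is bounded by `‖X‖`; zero vectors normalise
  -- to zero, which is harmless.
  let b : ι → κ → ℂ := fun i j =>
    inner ℂ ((‖α i‖⁻¹ : ℂ) • α i) (X ((‖β j‖⁻¹ : ℂ) • β j))
  have hb : MatBound b ‖X‖ := by
    refine ⟨norm_nonneg _, fun c d => ?_⟩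
    have h1 : ∑ i, ∑ j, b i j * (starRingEnd ℂ (d i) * c j) =
        inner ℂ (∑ i, d i • ((‖α i‖⁻¹ : ℂ) • α i)) (X (∑ j, c j • ((‖β j‖⁻¹ : ℂ) • β j))) := by
      rw [sum_inner]
      refine Finset.sum_congr rfl fun i _ => ?_
      rw [map_sum, inner_sum]
      refine Finset.sum_congr rfl fun j _ => ?_
      rw [map_smul, inner_smul_left, inner_smul_right]
      ring
    rw [h1]
    calc _ ≤ ‖∑ i, d i • ((‖α i‖⁻¹ : ℂ) • α i)‖ * ‖X (∑ j, c j • ((‖β j‖⁻¹ : ℂ) • β j))‖ :=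
          norm_inner_le_norm _ _
      _ ≤ √(∑ i, ‖d i‖ ^ 2) * (‖X‖ * √(∑ j, ‖c j‖ ^ 2)) := by
          gcongr
          · exact norm_sum_smul_normalize_le hα d
          · exact (X.le_opNorm _).trans (by gcongr; exact norm_sum_smul_normalize_le hβ c)
      _ = _ := by ring
  have h2 := (h.matBound y z hb).2 (fun j => (‖β j‖ : ℂ)) (fun i => (‖α i‖ : ℂ))
  simp only [Complex.norm_real, norm_norm] at h2
  refine le_trans (le_of_eq ?_) h2
  congr 1
  refine Finset.sum_congr rfl fun i _ => Finset.sum_congr rfl fun j _ => ?_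
  have h3 : inner ℂ (α i) (X (β j)) = b i j * (starRingEnd ℂ (‖α i‖ : ℂ) * (‖β j‖ : ℂ)) := by
    conv_lhs => rw [← norm_smul_normalize (α i), ← norm_smul_normalize (β j), map_smul,
      inner_smul_left, inner_smul_right]
    simp only [b]
    ring
  rw [h3]
  ring

end FiniteSchur

/-! ### Approximation by compactly supported functions, and Fubini without σ-finiteness. -/

section Approximation

/-- Compactly supported continuous functions are dense in `Lᵖ` for a regular measure on a locally
compact regular space. -/
theorem exists_hasCompactSupport_eLpNorm_sub_le {Y : Type*} [TopologicalSpace Y] [RegularSpace Y]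
    [LocallyCompactSpace Y] [MeasurableSpace Y] [BorelSpace Y] {ν : Measure Y} [ν.Regular]
    {p : ℝ≥0∞} (hp : p ≠ ∞) {f : Y → ℂ} (hf : MemLp f p ν) {ε : ℝ≥0∞} (hε : ε ≠ 0) :
    ∃ g : Y → ℂ, eLpNorm (f - g) p ν ≤ ε ∧ Continuous g ∧ MemLp g p ν ∧ HasCompactSupport g := by
  refine hf.induction_dense hp _ ?_ ?_ ?_ hε
  rotate_left
  · rintro f g ⟨f_cont, f_mem, hf⟩ ⟨g_cont, g_mem, hg⟩
    exact ⟨f_cont.add g_cont, f_mem.add g_mem, hf.add hg⟩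
  · rintro f ⟨_, f_mem, _⟩
    exact f_mem.aestronglyMeasurable
  intro c t ht htμ ε hε
  rcases exists_Lp_half ℂ ν p hε with ⟨δ, δpos, hδ⟩
  obtain ⟨η, ηpos, hη⟩ : ∃ η : ℝ≥0, 0 < η ∧ ∀ s : Set Y, ν s ≤ η →
      eLpNorm (s.indicator fun _x => c) p ν ≤ δ := exists_eLpNorm_indicator_le hp c δpos.ne'
  have hη_pos' : (0 : ℝ≥0∞) < η := ENNReal.coe_pos.2 ηpos
  obtain ⟨s, st, s_compact, s_closed, μs⟩ :
      ∃ s, s ⊆ t ∧ IsCompact s ∧ IsClosed s ∧ ν (t \ s) < η :=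
    ht.exists_isCompact_isClosed_sdiff_lt htμ.ne hη_pos'.ne'
  have hsμ : ν s < ∞ := (measure_mono st).trans_lt htμ
  obtain ⟨V, sV, V_open, -, hV⟩ : ∃ V, V ⊇ s ∧ IsOpen V ∧ ν V < ∞ ∧ ν (V \ s) < η :=
    s_closed.measurableSet.exists_isOpen_sdiff_lt hsμ.ne hη_pos'.ne'
  obtain ⟨g, hgs, hgV, hgc, hg_range⟩ := exists_continuous_one_zero_of_isCompact s_compact
    V_open.isClosed_compl (Set.disjoint_compl_right_iff_subset.2 sV)
  have hcont : Continuous fun x => ((g x : ℝ) : ℂ) * c := by fun_prop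
  have hcs : HasCompactSupport fun x => ((g x : ℝ) : ℂ) * c := by
    refine HasCompactSupport.mul_right ?_
    exact hgc.comp_left Complex.ofReal_zero
  refine ⟨fun x => ((g x : ℝ) : ℂ) * c, ?_, hcont, hcont.memLp_of_hasCompactSupport hcs, hcs⟩
  have hgsub : (fun x => ((g x : ℝ) : ℂ) * c) - t.indicator (fun _ => c) =
      ((fun x => ((g x : ℝ) : ℂ) * c) - s.indicator fun _ => c) +
        (-((t \ s).indicator fun _ => c)) := by
    rw [Set.indicator_sdiff st]
    ring
  rw [hgsub]
  have hsm : AEStronglyMeasurable (s.indicator fun _ => c) ν :=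
    aestronglyMeasurable_const.indicator s_closed.measurableSet
  refine (hδ _ _ (hcont.aestronglyMeasurable.sub hsm)
    (aestronglyMeasurable_const.indicator (ht.diff s_closed.measurableSet)).neg ?_ ?_).le
  · refine le_trans (eLpNorm_mono fun x => ?_) (hη _ hV.le)
    by_cases hxs : x ∈ s
    · have : g x = 1 := hgs hxs
      simp [hxs, this]
    · by_cases hxV : x ∈ V
      · simp only [Pi.sub_apply, Set.indicator_of_notMem hxs, sub_zero,
          Set.indicator_of_mem (show x ∈ V \ s from ⟨hxV, hxs⟩), norm_mul, Complex.norm_real,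
          Real.norm_of_nonneg (hg_range x).1]
        exact mul_le_of_le_one_left (norm_nonneg _) (hg_range x).2
      · have : g x = 0 := hgV hxV
        simp [hxs, this]
  · rw [eLpNorm_neg]
    exact hη _ μs.le

theorem exists_hasCompactSupport_integral_sub_le {Y : Type*} [TopologicalSpace Y] [RegularSpace Y]
    [LocallyCompactSpace Y] [MeasurableSpace Y] [BorelSpace Y] {ν : Measure Y} [ν.Regular]
    {f : Y → ℂ} (hf : Integrable f ν) {ε : ℝ} (hε : 0 < ε) :
    ∃ g : Y → ℂ, HasCompactSupport g ∧ (∫ x, ‖f x - g x‖ ∂ν) ≤ ε ∧ Continuous g ∧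
      Integrable g ν := by
  obtain ⟨g, hg, hgc, hgm, hgs⟩ := exists_hasCompactSupport_eLpNorm_sub_le (p := 1) (by norm_num)
    (memLp_one_iff_integrable.2 hf) (ε := ENNReal.ofReal ε) (by simpa using hε)
  have hgi := memLp_one_iff_integrable.1 hgm
  refine ⟨g, hgs, ?_, hgc, hgi⟩
  have h := integral_norm_eq_lintegral_enorm (hf.sub hgi).aestronglyMeasurable
  simp only [Pi.sub_apply] at h
  rw [h]
  rw [eLpNorm_one_eq_lintegral_enorm] at hg
  exact ENNReal.toReal_le_of_le_ofReal hε.le hg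

theorem exists_finite_measurable_partition {Ω M : Type*} [MeasurableSpace Ω] [PseudoMetricSpace M]
    [MeasurableSpace M] [OpensMeasurableSpace M] {f : Ω → M} (hf : Measurable f)
    (hb : TotallyBounded (Set.range f)) {ε : ℝ} (hε : 0 < ε) :
    ∃ (N : ℕ) (A : Fin N → Set Ω) (t : Fin N → Ω), (∀ j, MeasurableSet (A j)) ∧
      Pairwise (Function.onFun Disjoint A) ∧ (⋃ j, A j) = Set.univ ∧
      ∀ j, ∀ x ∈ A j, dist (f x) (f (t j)) < ε := by
  obtain ⟨s, hs, hfin, hcov⟩ := Metric.finite_approx_of_totallyBounded hb ε hε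
  have : Fintype s := hfin.fintype
  let e : Fin (Fintype.card s) ≃ s := (Fintype.equivFin s).symm
  have hex : ∀ j, ∃ x, f x = e j := fun j => hs (e j).2
  choose t ht using hex
  let U : Fin (Fintype.card s) → Set Ω := fun j => f ⁻¹' Metric.ball (e j : M) ε
  have hU : ∀ j, MeasurableSet (U j) := fun j => hf Metric.isOpen_ball.measurableSet
  refine ⟨_, disjointed U, t, fun j => ?_, disjoint_disjointed U, ?_, fun j x hx => ?_⟩
  · rw [disjointed_eq_inter_compl]
    exact (hU j).inter (.biInter (Set.to_countable _) fun i _ => (hU i).compl)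
  · rw [iUnion_disjointed]
    refine Set.eq_univ_of_forall fun x => ?_
    obtain ⟨y, hy, hxy⟩ := Set.mem_iUnion₂.1 (hcov ⟨x, rfl⟩)
    refine Set.mem_iUnion.2 ⟨e.symm ⟨y, hy⟩, ?_⟩
    simpa [U] using hxy
  · rw [ht]
    exact disjointed_subset U j hx

/-- The hypothesis allows the arguments to be chosen independently, so near-maximisers can be taken
in all summands at once. -/
theorem sum_iSup_le {ι Y : Type*} [Fintype ι] [Nonempty Y] {g : ι → Y → ℝ} {R : ℝ}
    (h : ∀ y : ι → Y, ∑ i, g i (y i) ≤ R) :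
    ∑ i, ⨆ y, g i y ≤ R := by
  refine le_of_forall_pos_le_add fun ε hε => ?_
  have hδ : 0 < ε / (Fintype.card ι + 1) := by positivity
  have hex : ∀ i, ∃ y, (⨆ y, g i y) - ε / (Fintype.card ι + 1) < g i y := fun i =>
    exists_lt_of_lt_ciSup (by linarith)
  choose y hy using hex
  have h1 : ∑ i, ((⨆ y, g i y) - ε / (Fintype.card ι + 1)) ≤ ∑ i, g i (y i) :=
    Finset.sum_le_sum fun i _ => (hy i).le
  rw [Finset.sum_sub_distrib, Finset.sum_const, Finset.card_univ, nsmul_eq_mul] at h1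
  have h2 : (Fintype.card ι : ℝ) * (ε / (Fintype.card ι + 1)) ≤ ε := by
    rw [mul_div_assoc', div_le_iff₀ (by positivity)]
    nlinarith
  linarith [h y]

variable {X Y : Type*} [TopologicalSpace X] [MeasurableSpace X] [BorelSpace X]
  [TopologicalSpace Y] [MeasurableSpace Y] [BorelSpace Y]
  {μ : Measure X} [IsFiniteMeasureOnCompacts μ] {ν : Measure Y} [ν.Regular]

theorem continuous_integral_mul_of_hasCompactSupport {X Y : Type*} [TopologicalSpace X]
    [MeasurableSpace X] [BorelSpace X] [TopologicalSpace Y] {μ : Measure X}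
    [IsFiniteMeasureOnCompacts μ] {w : X → ℝ}
    (hw : Continuous w) (hws : HasCompactSupport w) {F : X → Y → ℂ}
    (hF : Continuous (Function.uncurry F)) :
    Continuous fun t => ∫ y, (w y : ℂ) * F y t ∂μ := by
  rw [← continuousOn_univ]
  refine continuousOn_integral_of_compact_support (k := tsupport w) hws ?_ fun t y _ hy => ?_
  · refine Continuous.continuousOn ?_
    have h1 : Continuous fun p : Y × X => F p.2 p.1 := hF.comp continuous_swap
    exact (Complex.continuous_ofReal.comp (hw.comp continuous_snd)).mul h1
  · rw [image_eq_zero_of_notMem_tsupport hy]; simp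

theorem norm_integral_mul_le {w : X → ℝ} (hw : Continuous w) (hws : HasCompactSupport w)
    {f : X → ℂ} {B : ℝ} (hf : ∀ y, ‖f y‖ ≤ B) :
    ‖∫ y, (w y : ℂ) * f y ∂μ‖ ≤ B * ∫ y, |w y| ∂μ := by
  rw [← integral_const_mul]
  refine norm_integral_le_of_norm_le ((hw.abs.integrable_of_hasCompactSupport
    (hws.comp_left abs_zero)).const_mul B) (Filter.Eventually.of_forall fun y => ?_)
  rw [norm_mul, Complex.norm_real, Real.norm_eq_abs, mul_comm]
  exact mul_le_mul_of_nonneg_right (hf y) (abs_nonneg _)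

/-- A form of Fubini's theorem without σ-finiteness: integrating a bounded continuous kernel
against a compactly supported function does not increase its norm as a functional on `L¹`. -/
theorem norm_integral_integral_mul_le [R1Space X] [RegularSpace Y] [LocallyCompactSpace Y] {w : X → ℝ}
    (hw : Continuous w) (hws : HasCompactSupport w) {F : X → Y → ℂ}
    (hF : Continuous (Function.uncurry F)) {B : ℝ} (hB : ∀ y t, ‖F y t‖ ≤ B) {ρ : Y → ℂ}
    (hρ : Integrable ρ ν) {S : ℝ} (hS : ∀ y, ‖∫ t, ρ t * F y t ∂ν‖ ≤ S) :
    ‖∫ t, ρ t * (∫ y, (w y : ℂ) * F y t ∂μ) ∂ν‖ ≤ S * ∫ y, |w y| ∂μ := by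
  set D := ∫ y, |w y| ∂μ with hD
  have hD0 : 0 ≤ D := integral_nonneg fun y => abs_nonneg _
  rcases isEmpty_or_nonempty X with hX | hX
  · have h0 : ∀ t, ∫ y, (w y : ℂ) * F y t ∂μ = 0 := fun t => by
      simp [Measure.eq_zero_of_isEmpty μ]
    have hD' : D = 0 := by simp [hD, Measure.eq_zero_of_isEmpty μ]
    simp [h0, hD']
  obtain ⟨y₀⟩ := hX
  rcases isEmpty_or_nonempty Y with hY | ⟨⟨t₀⟩⟩
  · have hS0 : 0 ≤ S := (norm_nonneg _).trans (hS y₀)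
    rw [Measure.eq_zero_of_isEmpty ν]
    simp only [integral_zero_measure, norm_zero]
    positivity
  have hB0 : 0 ≤ B := (norm_nonneg _).trans (hB y₀ t₀)
  have hrc : Continuous fun t => ∫ y, (w y : ℂ) * F y t ∂μ :=
    continuous_integral_mul_of_hasCompactSupport hw hws hF
  have hrb : ∀ t, ‖∫ y, (w y : ℂ) * F y t ∂μ‖ ≤ B * D := fun t =>
    norm_integral_mul_le hw hws fun y => hB y t
  have hint : ∀ (ρ : Y → ℂ), Integrable ρ ν → ∀ (f : Y → ℂ), Continuous f → (b : ℝ) →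
      (∀ t, ‖f t‖ ≤ b) → Integrable (fun t => ρ t * f t) ν := fun ρ hρ f hf b hb =>
    hρ.mul_bdd (c := b) hf.aestronglyMeasurable (Filter.Eventually.of_forall hb)
  have hdiff : ∀ (ρ' : Y → ℂ), Integrable ρ' ν → ∀ (f : Y → ℂ), Continuous f → ∀ (b : ℝ),
      (∀ t, ‖f t‖ ≤ b) →
      ‖(∫ t, ρ t * f t ∂ν) - ∫ t, ρ' t * f t ∂ν‖ ≤ b * ∫ t, ‖ρ t - ρ' t‖ ∂ν := by
    intro ρ' hρ' f hf b hb
    rw [← integral_sub (hint ρ hρ f hf b hb) (hint ρ' hρ' f hf b hb), ← integral_const_mul]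
    refine norm_integral_le_of_norm_le ((hρ.sub hρ').norm.const_mul b)
      (Filter.Eventually.of_forall fun t => ?_)
    rw [← sub_mul, norm_mul, mul_comm]
    exact mul_le_mul_of_nonneg_right (hb t) (norm_nonneg _)
  refine le_of_forall_pos_le_add fun δ hδ => ?_
  -- The error `B * D * ε` enters twice, from replacing `ρ` in the outer integral and from the inner
  -- bound `S + B * ε`; the `+ 1` keeps the denominator positive.
  set ε := δ / (2 * B * D + 1) with hε
  have hε0 : 0 < ε := by positivity
  obtain ⟨ρ', hρ's, hρ'ε, hρ'c, hρ'i⟩ := exists_hasCompactSupport_integral_sub_le hρ hε0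
  -- With `ρ'` in place of `ρ` the integrand is continuous with compact support on the product,
  -- where the order of integration can be exchanged.
  have hswap : ∫ t, ρ' t * (∫ y, (w y : ℂ) * F y t ∂μ) ∂ν =
      ∫ y, (w y : ℂ) * (∫ t, ρ' t * F y t ∂ν) ∂μ := by
    simp_rw [← integral_const_mul]
    rw [integral_integral_swap_of_hasCompactSupport]
    · refine integral_congr_ae (Filter.Eventually.of_forall fun y => integral_congr_ae
        (Filter.Eventually.of_forall fun t => ?_))
      change ρ' t * ((w y : ℂ) * F y t) = (w y : ℂ) * (ρ' t * F y t)
      ring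
    · have h1 : Continuous fun p : Y × X => F p.2 p.1 := hF.comp continuous_swap
      exact (hρ'c.comp continuous_fst).mul
        ((Complex.continuous_ofReal.comp (hw.comp continuous_snd)).mul h1)
    · refine HasCompactSupport.of_support_subset_isCompact (hρ's.prod hws) fun p hp => ?_
      simp only [Function.mem_support, Function.uncurry] at hp
      refine ⟨subset_tsupport _ (left_ne_zero_of_mul hp), subset_tsupport _ ?_⟩
      have := left_ne_zero_of_mul (right_ne_zero_of_mul hp)
      simpa using this
  have hFc : ∀ y, Continuous (F y) := fun y => hF.comp (Continuous.prodMk_right y)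
  have h1 : ∀ y, ‖∫ t, ρ' t * F y t ∂ν‖ ≤ S + B * ε := fun y => by
    have h2 := hdiff ρ' hρ'i (F y) (hFc y) B (hB y)
    have h3 := mul_le_mul_of_nonneg_left hρ'ε hB0
    have h4 := norm_sub_norm_le (∫ t, ρ' t * F y t ∂ν) (∫ t, ρ t * F y t ∂ν)
    rw [norm_sub_rev] at h4
    linarith [hS y]
  have h5 : ‖∫ y, (w y : ℂ) * (∫ t, ρ' t * F y t ∂ν) ∂μ‖ ≤ (S + B * ε) * D :=
    norm_integral_mul_le hw hws h1
  have h6 := hdiff ρ' hρ'i _ hrc _ hrb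
  have h7 := mul_le_mul_of_nonneg_left hρ'ε (mul_nonneg hB0 hD0)
  rw [hswap] at h6
  have h8 := norm_sub_norm_le (∫ t, ρ t * (∫ y, (w y : ℂ) * F y t ∂μ) ∂ν)
    (∫ y, (w y : ℂ) * (∫ t, ρ' t * F y t ∂ν) ∂μ)
  have h9 : 2 * B * D * ε ≤ δ := by
    rw [hε, mul_div_assoc', div_le_iff₀ (by positivity)]
    nlinarith
  linarith

end Approximation

/-! ### Multiplication operators on `L²` and its finite direct sums. -/

section Multiplication

variable {Y : Type*} [MeasurableSpace Y] {ν : Measure Y}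

/-- `r` is measurable and bounded by `B`. -/
structure IsBddMeas (ν : Measure Y) (r : Y → ℂ) (B : ℝ) : Prop where
  aesm : AEStronglyMeasurable r ν
  bound : ∀ t, ‖r t‖ ≤ B
  nonneg : 0 ≤ B

theorem IsBddMeas.sub {r s : Y → ℂ} {B B' : ℝ} (hr : IsBddMeas ν r B) (hs : IsBddMeas ν s B') :
    IsBddMeas ν (r - s) (B + B') :=
  ⟨hr.aesm.sub hs.aesm, fun t => (norm_sub_le _ _).trans (add_le_add (hr.bound t) (hs.bound t)),
    add_nonneg hr.nonneg hs.nonneg⟩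

theorem IsBddMeas.memLp {r : Y → ℂ} {B : ℝ} (hr : IsBddMeas ν r B) {f : Y → ℂ} (hf : MemLp f 2 ν) :
    MemLp (fun t => r t * f t) 2 ν :=
  hf.of_le_mul (hr.aesm.mul hf.1) (c := B) (Filter.Eventually.of_forall fun t => by
    rw [norm_mul]
    exact mul_le_mul_of_nonneg_right (hr.bound t) (norm_nonneg _))

theorem isBddMeas_indicator {A : Set Y} (hA : MeasurableSet A) :
    IsBddMeas ν (A.indicator fun _ => (1 : ℂ)) 1 :=
  ⟨(stronglyMeasurable_const.indicator hA).aestronglyMeasurable, fun t => by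
    by_cases h : t ∈ A <;> simp [h], zero_le_one⟩

open Classical in
/-- The operator of multiplication by a bounded measurable function on `L²`. -/
noncomputable def mulOp (ν : Measure Y) (r : Y → ℂ) : Lp ℂ 2 ν →L[ℂ] Lp ℂ 2 ν :=
  if h : ∃ B, IsBddMeas ν r B then
    LinearMap.mkContinuous
      { toFun := fun f => (h.choose_spec.memLp (Lp.memLp f)).toLp
        map_add' := fun f g => by
          rw [← MemLp.toLp_add]
          refine MemLp.toLp_congr _ _ ?_
          filter_upwards [Lp.coeFn_add f g] with t ht
          rw [ht, Pi.add_apply, mul_add]; rfl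
        map_smul' := fun c f => by
          rw [RingHom.id_apply, ← MemLp.toLp_const_smul]
          refine MemLp.toLp_congr _ _ ?_
          filter_upwards [Lp.coeFn_smul c f] with t ht
          simp only [ht, Pi.smul_apply, smul_eq_mul]
          ring }
      h.choose fun f => by
        refine Lp.norm_le_mul_norm_of_ae_le_mul ?_
        filter_upwards [(h.choose_spec.memLp (Lp.memLp f)).coeFn_toLp] with t ht
        simp only [LinearMap.coe_mk, AddHom.coe_mk, ht, norm_mul]
        exact mul_le_mul_of_nonneg_right (h.choose_spec.bound t) (norm_nonneg _)
  else 0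

theorem IsBddMeas.coeFn_mulOp {r : Y → ℂ} {B : ℝ} (hr : IsBddMeas ν r B) (f : Lp ℂ 2 ν) :
    mulOp ν r f =ᵐ[ν] fun t => r t * f t := by
  have h : ∃ B, IsBddMeas ν r B := ⟨B, hr⟩
  rw [mulOp, dif_pos h]
  exact (h.choose_spec.memLp (Lp.memLp f)).coeFn_toLp

theorem IsBddMeas.norm_mulOp_apply_le {r : Y → ℂ} {B : ℝ} (hr : IsBddMeas ν r B) (f : Lp ℂ 2 ν) :
    ‖mulOp ν r f‖ ≤ B * ‖f‖ := by
  refine Lp.norm_le_mul_norm_of_ae_le_mul ?_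
  filter_upwards [hr.coeFn_mulOp f] with t ht
  rw [ht, norm_mul]
  exact mul_le_mul_of_nonneg_right (hr.bound t) (norm_nonneg _)

theorem IsBddMeas.norm_mulOp_le {r : Y → ℂ} {B : ℝ} (hr : IsBddMeas ν r B) : ‖mulOp ν r‖ ≤ B :=
  ContinuousLinearMap.opNorm_le_bound _ hr.nonneg hr.norm_mulOp_apply_le

theorem IsBddMeas.inner_mulOp {r : Y → ℂ} {B : ℝ} (hr : IsBddMeas ν r B) (ζ ξ : Lp ℂ 2 ν) :
    inner ℂ ζ (mulOp ν r ξ) = ∫ t, inner ℂ (ζ t) (ξ t) * r t ∂ν := by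
  rw [L2.inner_def]
  refine integral_congr_ae ?_
  filter_upwards [hr.coeFn_mulOp ξ] with t ht
  rw [ht, ← smul_eq_mul, inner_smul_right, mul_comm]

theorem IsBddMeas.mulOp_sub {r s : Y → ℂ} {B B' : ℝ} (hr : IsBddMeas ν r B)
    (hs : IsBddMeas ν s B') (f : Lp ℂ 2 ν) : mulOp ν (r - s) f = mulOp ν r f - mulOp ν s f := by
  refine Lp.ext ?_
  filter_upwards [(hr.sub hs).coeFn_mulOp f, hr.coeFn_mulOp f, hs.coeFn_mulOp f,
    Lp.coeFn_sub (mulOp ν r f) (mulOp ν s f)] with t h1 h2 h3 h4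
  rw [h1, h4, Pi.sub_apply, Pi.sub_apply, h2, h3, sub_mul]

theorem inner_mulOp_indicator_of_disjoint {A A' : Set Y} (hA : MeasurableSet A)
    (hA' : MeasurableSet A') (h : Disjoint A A') (f g : Lp ℂ 2 ν) :
    inner ℂ (mulOp ν (A.indicator fun _ => 1) f) (mulOp ν (A'.indicator fun _ => 1) g) = 0 := by
  rw [L2.inner_def]
  refine (integral_congr_ae (g := fun _ => 0) ?_).trans (integral_zero _ _)
  filter_upwards [(isBddMeas_indicator hA).coeFn_mulOp f, (isBddMeas_indicator hA').coeFn_mulOp g]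
    with t h1 h2
  rw [h1, h2]
  by_cases ht : t ∈ A
  · simp [Set.disjoint_left.1 h ht]
  · simp [ht]

variable {n : ℕ}

/-- Multiplication by a bounded measurable function on `n` copies of `L²`. -/
noncomputable def mulVec (ν : Measure Y) (r : Y → ℂ) (v : PiLp 2 fun _ : Fin n => Lp ℂ 2 ν) :
    PiLp 2 fun _ : Fin n => Lp ℂ 2 ν :=
  WithLp.toLp 2 fun q => mulOp ν r (v q)

theorem IsBddMeas.norm_mulVec_le {r : Y → ℂ} {B : ℝ} (hr : IsBddMeas ν r B)
    (v : PiLp 2 fun _ : Fin n => Lp ℂ 2 ν) : ‖mulVec ν r v‖ ≤ B * ‖v‖ :=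
  (norm_toLp_apply_le _ v).trans (mul_le_mul_of_nonneg_right hr.norm_mulOp_le (norm_nonneg _))

theorem IsBddMeas.mulVec_sub {r s : Y → ℂ} {B B' : ℝ} (hr : IsBddMeas ν r B)
    (hs : IsBddMeas ν s B') (v : PiLp 2 fun _ : Fin n => Lp ℂ 2 ν) :
    mulVec ν (r - s) v = mulVec ν r v - mulVec ν s v := by
  ext q : 1
  exact hr.mulOp_sub hs (v q)

theorem inner_mulVec_indicator_of_disjoint {A A' : Set Y} (hA : MeasurableSet A)
    (hA' : MeasurableSet A') (h : Disjoint A A') (f g : PiLp 2 fun _ : Fin n => Lp ℂ 2 ν) :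
    inner ℂ (mulVec ν (A.indicator fun _ => 1) f) (mulVec ν (A'.indicator fun _ => 1) g) = 0 := by
  rw [PiLp.inner_apply]
  exact Finset.sum_eq_zero fun q _ => inner_mulOp_indicator_of_disjoint hA hA' h _ _

theorem integrable_sum_inner (ζ ξ : PiLp 2 fun _ : Fin n => Lp ℂ 2 ν) :
    Integrable (fun t => ∑ q, inner ℂ (ζ q t) (ξ q t)) ν :=
  integrable_finsetSum _ fun q _ => L2.integrable_inner (ζ q) (ξ q)

theorem IsBddMeas.inner_mulVec {r : Y → ℂ} {B : ℝ} (hr : IsBddMeas ν r B)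
    (ζ ξ : PiLp 2 fun _ : Fin n => Lp ℂ 2 ν) :
    inner ℂ ζ (mulVec ν r ξ) = ∫ t, (∑ q, inner ℂ (ζ q t) (ξ q t)) * r t ∂ν := by
  rw [PiLp.inner_apply]
  simp_rw [Finset.sum_mul]
  rw [integral_finsetSum]
  · exact Finset.sum_congr rfl fun q _ => hr.inner_mulOp _ _
  · intro q _
    exact (L2.integrable_inner (𝕜 := ℂ) (ζ q) (ξ q)).mul_bdd (c := B) hr.aesm
      (Filter.Eventually.of_forall hr.bound)

variable {ι : Type*} [Fintype ι]

theorem isBddMeas_step {A : ι → Set Y} (hA : ∀ i, MeasurableSet (A i))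
    (hd : Pairwise (Function.onFun Disjoint A)) {c : ι → ℂ} {B : ℝ} (hB : 0 ≤ B)
    (hc : ∀ i, ‖c i‖ ≤ B) : IsBddMeas ν (fun t => ∑ i, c i * (A i).indicator (fun _ => 1) t) B := by
  classical
  refine ⟨?_, fun t => ?_, hB⟩
  · refine Finset.aestronglyMeasurable_fun_sum _ fun i _ => ?_
    exact (isBddMeas_indicator (hA i)).aesm.const_mul _
  · by_cases h : ∃ i, t ∈ A i
    · obtain ⟨i, hi⟩ := h
      rw [Finset.sum_eq_single i]
      · simpa [hi] using hc i
      · intro j _ hj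
        have : t ∉ A j := fun h' => Set.disjoint_left.1 (hd hj) h' hi
        simp [this]
      · simp
    · push Not at h
      simp [h, hB]

theorem mulOp_step {A : ι → Set Y} (hA : ∀ i, MeasurableSet (A i)) {c : ι → ℂ} {B : ℝ}
    (h : IsBddMeas ν (fun t => ∑ i, c i * (A i).indicator (fun _ => 1) t) B) (f : Lp ℂ 2 ν) :
    mulOp ν (fun t => ∑ i, c i * (A i).indicator (fun _ => 1) t) f =
      ∑ i, c i • mulOp ν ((A i).indicator fun _ => 1) f := by
  refine Lp.ext ?_
  have h1 : ∀ᵐ t ∂ν, ∀ i, mulOp ν ((A i).indicator fun _ => 1) f t =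
      (A i).indicator (fun _ => 1) t * f t :=
    ae_all_iff.2 fun i => (isBddMeas_indicator (hA i)).coeFn_mulOp f
  have h2 : ∀ᵐ t ∂ν, ∀ i, (c i • mulOp ν ((A i).indicator fun _ => 1) f : Lp ℂ 2 ν) t =
      c i • mulOp ν ((A i).indicator fun _ => 1) f t :=
    ae_all_iff.2 fun i => Lp.coeFn_smul _ _
  filter_upwards [h.coeFn_mulOp f, h1, h2, Lp.coeFn_finsetSum Finset.univ
    (fun i => c i • mulOp ν ((A i).indicator fun _ => 1) f)] with t h3 h4 h5 h6
  rw [h3, h6, Finset.sum_apply, Finset.sum_mul]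
  refine Finset.sum_congr rfl fun i _ => ?_
  rw [h5, h4, smul_eq_mul, mul_assoc]

theorem mulVec_step {A : ι → Set Y} (hA : ∀ i, MeasurableSet (A i)) {c : ι → ℂ} {B : ℝ}
    (h : IsBddMeas ν (fun t => ∑ i, c i * (A i).indicator (fun _ => 1) t) B)
    (v : PiLp 2 fun _ : Fin n => Lp ℂ 2 ν) :
    mulVec ν (fun t => ∑ i, c i * (A i).indicator (fun _ => 1) t) v =
      ∑ i, c i • mulVec ν ((A i).indicator fun _ => 1) v := by
  ext q : 1
  rw [WithLp.ofLp_sum, Finset.sum_apply]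
  exact mulOp_step hA h (v q)

/-- The pieces are orthogonal and add up to the restriction of `v` to the union, a contraction of
`v`. -/
theorem sum_norm_sq_mulVec_indicator_le {A : ι → Set Y} (hA : ∀ i, MeasurableSet (A i))
    (hd : Pairwise (Function.onFun Disjoint A)) (v : PiLp 2 fun _ : Fin n => Lp ℂ 2 ν) :
    ∑ i, ‖mulVec ν ((A i).indicator fun _ => 1) v‖ ^ 2 ≤ ‖v‖ ^ 2 := by
  have h := isBddMeas_step (ν := ν) hA hd (c := fun _ => 1) zero_le_one (by simp)
  have h1 := h.norm_mulVec_le v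
  rw [mulVec_step hA h, one_mul] at h1
  simp only [one_smul] at h1
  rw [← norm_sq_sum_of_orthogonal fun i j hij =>
    inner_mulVec_indicator_of_disjoint (hA i) (hA j) (hd hij) v v]
  exact pow_le_pow_left₀ (norm_nonneg _) h1 2

end Multiplication

/-! ### The Schur inequality with a continuous second variable and averaged rows. -/

section Schur

variable {G : Type*} [Group G] {φ : G → ℂ} {C : ℝ} {Y : Type*} [MeasurableSpace Y] {ν : Measure Y}
  {n : ℕ} {ι : Type*} [Fintype ι]

/-- The finitely many functions `t ↦ φ(yᵢ z(t))` form one map into a compact ball of `ℂ^ι`, so all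
of them are within `ε` of constants on the cells of one finite partition. For such step functions
the vectors `1_{A j} ξ` are orthogonal and the finite Schur inequality applies. -/
theorem SchurBound.norm_sum_inner_mulVec_le (h : SchurBound φ C) {z : Y → G}
    (hz : ∀ y, Measurable fun t => φ (y * z t)) (y : ι → G)
    (X : (PiLp 2 fun _ : Fin n => Lp ℂ 2 ν) →L[ℂ] (PiLp 2 fun _ : Fin n => Lp ℂ 2 ν))
    {α : ι → PiLp 2 fun _ : Fin n => Lp ℂ 2 ν}
    (hα : Pairwise fun i j => inner ℂ (α i) (α j) = 0) (ξ : PiLp 2 fun _ : Fin n => Lp ℂ 2 ν) :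
    ‖∑ i, inner ℂ (α i) (X (mulVec ν (fun t => φ (y i * z t)) ξ))‖ ≤
      C * ‖X‖ * ‖ξ‖ * √(∑ i, ‖α i‖ ^ 2) := by
  have hC := h.1
  have hr : ∀ i, IsBddMeas ν (fun t => φ (y i * z t)) C := fun i =>
    ⟨(hz (y i)).aestronglyMeasurable, fun t => h.norm_le _, hC⟩
  refine le_of_forall_pos_le_add fun δ hδ => ?_
  set K := (∑ i, ‖α i‖) * ‖X‖ * ‖ξ‖ with hK
  have hK0 : 0 ≤ K := by positivity
  have hε0 : 0 < δ / (K + 1) := by positivity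
  set ε := δ / (K + 1)
  obtain ⟨N, A, t, hA, hd, hcov, hdist⟩ := exists_finite_measurable_partition
    (f := fun t (i : ι) => φ (y i * z t)) (measurable_pi_iff.2 fun i => hz (y i))
    (by
      refine (isCompact_closedBall (0 : ι → ℂ) C).totallyBounded.subset ?_
      rintro _ ⟨t, rfl⟩
      rw [mem_closedBall_zero_iff, pi_norm_le_iff_of_nonneg hC]
      exact fun i => h.norm_le _) hε0
  let s : ι → Y → ℂ := fun i t' => ∑ j, φ (y i * z (t j)) * (A j).indicator (fun _ => 1) t'
  have hs : ∀ i, IsBddMeas ν (s i) C := fun i => isBddMeas_step hA hd hC fun j => h.norm_le _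
  have hrs : ∀ i, IsBddMeas ν ((fun t => φ (y i * z t)) - s i) ε := fun i => by
    refine ⟨((hr i).sub (hs i)).aesm, fun t' => ?_, hε0.le⟩
    obtain ⟨j, hj⟩ := Set.mem_iUnion.1 (hcov ▸ Set.mem_univ t' : t' ∈ ⋃ j, A j)
    have h1 : s i t' = φ (y i * z (t j)) := by
      simp only [s]
      rw [Finset.sum_eq_single j]
      · simp [hj]
      · intro k _ hk
        have : t' ∉ A k := fun h' => Set.disjoint_left.1 (hd hk) h' hj
        simp [this]
      · simp
    rw [Pi.sub_apply, h1, ← dist_eq_norm]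
    exact (dist_le_pi_dist _ _ i).trans (hdist j t' hj).le
  have h1 : ‖∑ i, inner ℂ (α i) (X (mulVec ν (s i) ξ))‖ ≤
      C * ‖X‖ * ‖ξ‖ * √(∑ i, ‖α i‖ ^ 2) := by
    have h2 : ∑ i, inner ℂ (α i) (X (mulVec ν (s i) ξ)) = ∑ i, ∑ j, φ (y i * z (t j)) *
        inner ℂ (α i) (X (mulVec ν ((A j).indicator fun _ => 1) ξ)) := by
      refine Finset.sum_congr rfl fun i _ => ?_
      rw [mulVec_step hA (hs i), map_sum, inner_sum]
      refine Finset.sum_congr rfl fun j _ => ?_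
      rw [map_smul, inner_smul_right]
    rw [h2]
    refine (h.norm_sum_inner_le y (fun j => z (t j)) X hα fun i j hij =>
      inner_mulVec_indicator_of_disjoint (hA i) (hA j) (hd hij) ξ ξ).trans ?_
    gcongr
    exact Real.sqrt_le_iff.2 ⟨norm_nonneg _, sum_norm_sq_mulVec_indicator_le hA hd ξ⟩
  have h3 : ‖∑ i, inner ℂ (α i) (X (mulVec ν ((fun t => φ (y i * z t)) - s i) ξ))‖ ≤ K * ε := by
    refine (norm_sum_le _ _).trans ?_
    rw [hK, Finset.sum_mul, Finset.sum_mul, Finset.sum_mul]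
    refine Finset.sum_le_sum fun i _ => ?_
    calc _ ≤ ‖α i‖ * ‖X (mulVec ν ((fun t => φ (y i * z t)) - s i) ξ)‖ := norm_inner_le_norm _ _
      _ ≤ ‖α i‖ * (‖X‖ * (ε * ‖ξ‖)) := by
        gcongr
        exact (X.le_opNorm _).trans (by gcongr; exact (hrs i).norm_mulVec_le ξ)
      _ = _ := by ring
  have h4 : ∑ i, inner ℂ (α i) (X (mulVec ν (fun t => φ (y i * z t)) ξ)) =
      ∑ i, inner ℂ (α i) (X (mulVec ν (s i) ξ)) +
        ∑ i, inner ℂ (α i) (X (mulVec ν ((fun t => φ (y i * z t)) - s i) ξ)) := by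
    rw [← Finset.sum_add_distrib]
    refine Finset.sum_congr rfl fun i _ => ?_
    rw [(hr i).mulVec_sub (hs i), map_sub, inner_sub_right]
    ring
  have h5 : K * ε ≤ δ := by
    simp only [ε]
    rw [mul_div_assoc', div_le_iff₀ (by positivity)]
    nlinarith
  rw [h4]
  exact (norm_add_le _ _).trans (add_le_add h1 (h3.trans h5))

/-- Unimodular phases absorbed into the `α i` preserve orthogonality and norms and make every
summand nonnegative. -/
theorem SchurBound.sum_norm_inner_mulVec_le (h : SchurBound φ C) {z : Y → G}
    (hz : ∀ y, Measurable fun t => φ (y * z t)) (y : ι → G)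
    (X : (PiLp 2 fun _ : Fin n => Lp ℂ 2 ν) →L[ℂ] (PiLp 2 fun _ : Fin n => Lp ℂ 2 ν))
    {α : ι → PiLp 2 fun _ : Fin n => Lp ℂ 2 ν}
    (hα : Pairwise fun i j => inner ℂ (α i) (α j) = 0) (ξ : PiLp 2 fun _ : Fin n => Lp ℂ 2 ν) :
    ∑ i, ‖inner ℂ (α i) (X (mulVec ν (fun t => φ (y i * z t)) ξ))‖ ≤
      C * ‖X‖ * ‖ξ‖ * √(∑ i, ‖α i‖ ^ 2) := by
  have hex : ∀ c : ℂ, ∃ θ : ℂ, ‖θ‖ = 1 ∧ starRingEnd ℂ θ * c = ‖c‖ := fun c => by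
    rcases eq_or_ne c 0 with rfl | hc
    · exact ⟨1, by simp, by simp⟩
    · have hc' : (‖c‖ : ℂ) ≠ 0 := by simpa using hc
      refine ⟨c / ‖c‖, by simp [hc], ?_⟩
      rw [map_div₀, Complex.conj_ofReal, div_mul_eq_mul_div, mul_comm, Complex.mul_conj,
        Complex.normSq_eq_norm_sq, div_eq_iff hc']
      push_cast
      ring
  choose θ hθ1 hθ2 using hex
  let c : ι → ℂ := fun i => inner ℂ (α i) (X (mulVec ν (fun t => φ (y i * z t)) ξ))
  have h1 := h.norm_sum_inner_mulVec_le hz y X (α := fun i => θ (c i) • α i) (fun i j hij => by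
    simp [hα hij]) ξ
  have h2 : ∑ i, inner ℂ (θ (c i) • α i) (X (mulVec ν (fun t => φ (y i * z t)) ξ)) =
      ((∑ i, ‖c i‖ : ℝ) : ℂ) := by
    push_cast
    refine Finset.sum_congr rfl fun i _ => ?_
    rw [inner_smul_left]
    exact hθ2 (c i)
  rw [h2, Complex.norm_real, Real.norm_eq_abs] at h1
  simp only [norm_smul, hθ1, one_mul] at h1
  exact (le_abs_self _).trans h1

variable [TopologicalSpace G] [IsTopologicalGroup G] [MeasurableSpace G] [BorelSpace G]
  [TopologicalSpace Y] [BorelSpace Y] [RegularSpace Y] [LocallyCompactSpace Y]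
  {μ : Measure G} [IsFiniteMeasureOnCompacts μ]

theorem SchurBound.isBddMeas_integral (h : SchurBound φ C) (hφ : Continuous φ) {z : Y → G}
    (hz : Continuous z) {w : G → ℝ} (hw : Continuous w) (hws : HasCompactSupport w) :
    IsBddMeas ν (fun t => ∫ x, (w x : ℂ) * φ (x⁻¹ * z t) ∂μ) (C * ∫ x, |w x| ∂μ) :=
  ⟨(continuous_integral_mul_of_hasCompactSupport hw hws (F := fun x t => φ (x⁻¹ * z t))
    (by unfold Function.uncurry; fun_prop)).aestronglyMeasurable,
    fun t => norm_integral_mul_le hw hws fun _ => h.norm_le _,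
    mul_nonneg h.1 (integral_nonneg fun _ => abs_nonneg _)⟩

/-- The bound holds for every choice of one group element per index, hence for the sum of the
suprema. Averaging with a weight of `L¹` norm at most `D` costs at most `D` times the supremum in
each summand. -/
theorem SchurBound.sum_norm_inner_integral_le [ν.Regular] (h : SchurBound φ C) (hφ : Continuous φ) {z : Y → G}
    (hz : Continuous z) {w : ι → G → ℝ} (hw : ∀ i, Continuous (w i))
    (hws : ∀ i, HasCompactSupport (w i)) {D : ℝ} (hD : ∀ i, ∫ x, |w i x| ∂μ ≤ D) (hD0 : 0 ≤ D)
    (X : (PiLp 2 fun _ : Fin n => Lp ℂ 2 ν) →L[ℂ] (PiLp 2 fun _ : Fin n => Lp ℂ 2 ν))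
    {α : ι → PiLp 2 fun _ : Fin n => Lp ℂ 2 ν}
    (hα : Pairwise fun i j => inner ℂ (α i) (α j) = 0) (ξ : PiLp 2 fun _ : Fin n => Lp ℂ 2 ν) :
    ∑ i, ‖inner ℂ (α i) (X (mulVec ν (fun t => ∫ x, (w i x : ℂ) * φ (x⁻¹ * z t) ∂μ) ξ))‖ ≤
      C * D * ‖X‖ * ‖ξ‖ * √(∑ i, ‖α i‖ ^ 2) := by
  have hC := h.1
  have hr : ∀ x, IsBddMeas ν (fun t => φ (x * z t)) C := fun x =>
    ⟨(hφ.comp (continuous_const.mul hz)).aestronglyMeasurable, fun t => h.norm_le _, hC⟩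
  -- Writing the coefficient as the integral of `r` against a fixed `L¹` density brings it into the
  -- scope of `norm_integral_integral_mul_le`.
  have hX : ∀ i (r : Y → ℂ) (B : ℝ), IsBddMeas ν r B → inner ℂ (α i) (X (mulVec ν r ξ)) =
      ∫ t, (∑ q, inner ℂ ((ContinuousLinearMap.adjoint X (α i)) q t) (ξ q t)) * r t ∂ν :=
    fun i r B hr => by
      rw [← ContinuousLinearMap.adjoint_inner_left, hr.inner_mulVec]
  let g : ι → G → ℝ := fun i x => ‖inner ℂ (α i) (X (mulVec ν (fun t => φ (x * z t)) ξ))‖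
  have hg : ∀ i, BddAbove (Set.range (g i)) := fun i => by
    refine ⟨‖α i‖ * (‖X‖ * (C * ‖ξ‖)), ?_⟩
    rintro _ ⟨x, rfl⟩
    refine (norm_inner_le_norm _ _).trans ?_
    gcongr
    exact (X.le_opNorm _).trans (by gcongr; exact (hr x).norm_mulVec_le ξ)
  have h1 : ∑ i, ⨆ x, g i x ≤ C * ‖X‖ * ‖ξ‖ * √(∑ i, ‖α i‖ ^ 2) :=
    sum_iSup_le fun y => h.sum_norm_inner_mulVec_le
      (fun x => (hφ.comp (continuous_const.mul hz)).measurable) y X hα ξ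
  have h2 : ∀ i, ‖inner ℂ (α i)
      (X (mulVec ν (fun t => ∫ x, (w i x : ℂ) * φ (x⁻¹ * z t) ∂μ) ξ))‖ ≤ (⨆ x, g i x) * D := by
    intro i
    have hsup : 0 ≤ ⨆ x, g i x := (norm_nonneg _).trans (le_ciSup (hg i) 1)
    rw [hX i _ _ (h.isBddMeas_integral hφ hz (hw i) (hws i))]
    refine (norm_integral_integral_mul_le (hw i) (hws i) (F := fun x t => φ (x⁻¹ * z t))
      (by unfold Function.uncurry; fun_prop) (fun _ _ => h.norm_le _)
      (integrable_sum_inner _ _) fun x => ?_).trans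
      (mul_le_mul_of_nonneg_left (hD i) hsup)
    rw [← hX i _ _ (hr x⁻¹)]
    exact le_ciSup (hg i) x⁻¹
  calc _ ≤ ∑ i, (⨆ x, g i x) * D := Finset.sum_le_sum fun i _ => h2 i
    _ = (∑ i, ⨆ x, g i x) * D := by rw [Finset.sum_mul]
    _ ≤ _ := mul_le_mul_of_nonneg_right h1 hD0
    _ = _ := by ring

end Schur

/-- The norms are dominated by products of square-summable sequences, so the series converges in
norm within the closed predual. -/
theorem exists_vectorFunctional_tsum {E : Type*} [NormedAddCommGroup E] [InnerProductSpace ℂ E]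
    [CompleteSpace E] {ω : ℕ → StrongDual ℂ (E →L[ℂ] E)} (hω : ∀ k, ω k ∈ normalFunctionals E)
    {K : ℝ} {ξ₀ η₀ : lp (fun _ : ℕ => E) 2} (hK : ∀ k, ‖ω k‖ ≤ K * ‖ξ₀ k‖ * ‖η₀ k‖) :
    ∃ ξ η : lp (fun _ : ℕ => E) 2, ∀ x, ∑' k, ω k x = vectorFunctional ξ η x := by
  have hs : Summable ω := by
    have h1 : Summable fun k => ‖ξ₀ k‖ * ‖η₀ k‖ :=
      lp.summable_mul (by rw [Real.holderConjugate_iff]; norm_num) ξ₀ η₀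
    refine Summable.of_norm_bounded (h1.mul_left K) fun k => ?_
    rw [← mul_assoc]
    exact hK k
  have hc : IsClosed (normalFunctionals E : Set (StrongDual ℂ (E →L[ℂ] E))) :=
    Submodule.isClosed_topologicalClosure _
  have hmem : ∑' k, ω k ∈ normalFunctionals E :=
    hc.mem_of_tendsto hs.hasSum (Filter.Eventually.of_forall fun s =>
      Submodule.sum_mem _ fun k _ => hω k)
  obtain ⟨ξ, η, h⟩ := exists_vectorFunctional_of_mem hmem
  refine ⟨ξ, η, fun x => ?_⟩
  rw [← h]
  exact (hs.hasSum.mapL (ContinuousLinearMap.apply ℂ ℂ x)).tsum_eq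

/-! ### Recovering a normal multiplier map from its coefficient functionals. -/

section MultiplierForm

variable {H : Type*} [Group H] [TopologicalSpace H] [IsTopologicalGroup H] [LocallyCompactSpace H]
  [MeasurableSpace H] [BorelSpace H]

/-- The normal functionals `x ↦ ⟨M x ξ, η⟩` for a multiplier map `M` with symbol `ψ` whose
completely bounded norm is at most `K`. -/
structure IsMultiplierForm (ψ : H → ℂ) (K : ℝ)
    (Ω : LTwo H → LTwo H → StrongDual ℂ (LTwo H →L[ℂ] LTwo H)) : Prop where
  nonneg : 0 ≤ K
  add_left : ∀ ξ ξ' η, Ω (ξ + ξ') η = Ω ξ η + Ω ξ' η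
  smul_left : ∀ (c : ℂ) ξ η, Ω (c • ξ) η = c • Ω ξ η
  add_right : ∀ ξ η η', Ω ξ (η + η') = Ω ξ η + Ω ξ η'
  smul_right : ∀ (c : ℂ) ξ η, Ω ξ (c • η) = starRingEnd ℂ c • Ω ξ η
  mem : ∀ ξ η, Ω ξ η ∈ normalFunctionals (LTwo H)
  norm_le : ∀ ξ η, ‖Ω ξ η‖ ≤ K * ‖ξ‖ * ‖η‖
  bound : ∀ (n : ℕ) (a : Matrix (Fin n) (Fin n) (LTwo H →L[ℂ] LTwo H))
    (v w : PiLp 2 fun _ : Fin n => LTwo H),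
    ‖∑ p, ∑ q, Ω (v q) (w p) (a p q)‖ ≤ K * ‖matrixOp a‖ * ‖v‖ * ‖w‖
  apply_leftRegular : ∀ g ξ η, Ω ξ η (leftRegular g) = ψ g * inner ℂ η (leftRegular g ξ)

variable {ψ : H → ℂ} {K : ℝ} {Ω : LTwo H → LTwo H → StrongDual ℂ (LTwo H →L[ℂ] LTwo H)}

theorem IsMultiplierForm.exists_operator (h : IsMultiplierForm ψ K Ω) (x : LTwo H →L[ℂ] LTwo H) :
    ∃ T : LTwo H →L[ℂ] LTwo H, ∀ ξ η, inner ℂ η (T ξ) = Ω ξ η x := by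
  let B : LTwo H →ₗ⋆[ℂ] LTwo H →ₗ[ℂ] ℂ :=
    { toFun := fun η =>
        { toFun := fun ξ => Ω ξ η x
          map_add' := fun ξ ξ' => by rw [h.add_left]; rfl
          map_smul' := fun c ξ => by rw [h.smul_left]; rfl }
      map_add' := fun η η' => by ext ξ; exact congrArg (fun ω => ω x) (h.add_right ξ η η')
      map_smul' := fun c η => by ext ξ; exact congrArg (fun ω => ω x) (h.smul_right c ξ η) }
  let B' : LTwo H →L⋆[ℂ] LTwo H →L[ℂ] ℂ := LinearMap.mkContinuous₂ B (K * ‖x‖) fun η ξ => by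
    calc ‖Ω ξ η x‖ ≤ ‖Ω ξ η‖ * ‖x‖ := (Ω ξ η).le_opNorm x
      _ ≤ K * ‖ξ‖ * ‖η‖ * ‖x‖ := by gcongr; exact h.norm_le ξ η
      _ = _ := by ring
  refine ⟨ContinuousLinearMap.adjoint (InnerProductSpace.continuousLinearMapOfBilin B'),
    fun ξ η => ?_⟩
  rw [ContinuousLinearMap.adjoint_inner_right,
    InnerProductSpace.continuousLinearMapOfBilin_apply]
  rfl

/-- The set `λ(H)` is a self-adjoint semigroup, so the double commutant argument shows that it
determines normal functionals on `L(H)`. -/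
theorem eq_zero_of_mem_normalFunctionals {ω : StrongDual ℂ (LTwo H →L[ℂ] LTwo H)}
    (hω : ω ∈ normalFunctionals (LTwo H)) (h : ∀ g : H, ω (leftRegular g) = 0)
    {x : LTwo H →L[ℂ] LTwo H} (hx : x ∈ groupVN H) : ω x = 0 := by
  obtain ⟨ξ, η, hξη⟩ := exists_vectorFunctional_of_mem hω
  rw [hξη]
  refine vectorFunctional_eq_zero_of_commutant (S := Set.range (leftRegular (G := H)))
    ⟨1, leftRegular_one⟩ ?_ ?_ ?_ ?_
  · rintro _ ⟨g, rfl⟩ _ ⟨g', rfl⟩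
    exact ⟨g * g', leftRegular_mul g g'⟩
  · rintro _ ⟨g, rfl⟩
    exact ⟨g⁻¹, (star_leftRegular g).symm⟩
  · rintro _ ⟨g, rfl⟩
    rw [← hξη, h]
  · intro y hy
    refine (((StarSubalgebra.mem_centralizer_iff ℂ).1 hx y ?_).1).symm
    refine (StarSubalgebra.mem_centralizer_iff ℂ).2 ?_
    rintro _ ⟨g, rfl⟩
    refine ⟨hy _ ⟨g, rfl⟩, ?_⟩
    rw [star_leftRegular]
    exact hy _ ⟨g⁻¹, rfl⟩

/-- For `y` in the commutant, `Ω ξ (y*η) - Ω (yξ) η` is normal and vanishes on `λ(H)`, because `y`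
commutes there. Its vanishing at `x` says that `T` commutes with `y`. -/
theorem IsMultiplierForm.mem_groupVN (h : IsMultiplierForm ψ K Ω) {x T : LTwo H →L[ℂ] LTwo H}
    (hx : x ∈ groupVN H) (hT : ∀ ξ η, inner ℂ η (T ξ) = Ω ξ η x) : T ∈ groupVN H := by
  have key : ∀ y : LTwo H →L[ℂ] LTwo H,
      (∀ g : H, leftRegular g * y = y * leftRegular g) → y * T = T * y := by
    intro y hy
    ext1 ξ
    refine ext_inner_left ℂ fun η => ?_
    have h1 : (Ω ξ (ContinuousLinearMap.adjoint y η) - Ω (y ξ) η) x = 0 := by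
      refine eq_zero_of_mem_normalFunctionals (Submodule.sub_mem _ (h.mem _ _) (h.mem _ _))
        (fun g => ?_) hx
      have h2 : leftRegular g (y ξ) = y (leftRegular g ξ) :=
        congrArg (fun S : LTwo H →L[ℂ] LTwo H => S ξ) (hy g)
      rw [sub_apply, h.apply_leftRegular, h.apply_leftRegular,
        ContinuousLinearMap.adjoint_inner_left, h2, sub_self]
    rw [sub_apply, sub_eq_zero, ← hT, ← hT, ContinuousLinearMap.adjoint_inner_left] at h1
    exact h1
  refine (StarSubalgebra.mem_centralizer_iff ℂ).2 fun y hy => ?_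
  have hy' := fun z => (StarSubalgebra.mem_centralizer_iff ℂ).1 hy z
  refine ⟨key y fun g => (hy' _ ⟨g, rfl⟩).1, key (star y) fun g => ?_⟩
  have h3 := congrArg star (hy' (leftRegular g) ⟨g, rfl⟩).2
  rw [star_mul, star_mul, star_star] at h3
  exact h3.symm

theorem IsMultiplierForm.exists_linearMap (h : IsMultiplierForm ψ K Ω) :
    ∃ M : groupVN H →ₗ[ℂ] groupVN H, ∀ (x : groupVN H) ξ η,
      inner ℂ η ((M x : LTwo H →L[ℂ] LTwo H) ξ) = Ω ξ η x := by
  choose T hT using h.exists_operator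
  let M : groupVN H →ₗ[ℂ] groupVN H :=
    { toFun := fun x => ⟨T x, h.mem_groupVN x.2 (hT x)⟩
      map_add' := fun x y => Subtype.ext <| ContinuousLinearMap.ext fun ξ =>
        ext_inner_left ℂ fun η => by
          change inner ℂ η (T (x + y : LTwo H →L[ℂ] LTwo H) ξ) = inner ℂ η (T x ξ + T y ξ)
          rw [inner_add_right, hT, hT, hT, map_add]
      map_smul' := fun c x => Subtype.ext <| ContinuousLinearMap.ext fun ξ =>
        ext_inner_left ℂ fun η => by
          change inner ℂ η (T (c • (x : LTwo H →L[ℂ] LTwo H)) ξ) = inner ℂ η (c • T x ξ)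
          rw [inner_smul_right, hT, hT, map_smul, smul_eq_mul] }
  exact ⟨M, fun x ξ η => hT x ξ η⟩

/-- Normality holds since pulling back an ultraweak functional gives `∑ₖ Ω (ξ k) (η k)`, again of
that type; `bound` is exactly the estimate for every amplification. -/
theorem IsMultiplierForm.exists_isMultiplierMap (h : IsMultiplierForm ψ K Ω) :
    ∃ M : groupVN H →ₗ[ℂ] groupVN H, IsMultiplierMap ψ M ∧ IsCBBound M K := by
  obtain ⟨M, hM⟩ := h.exists_linearMap
  refine ⟨M, ⟨isNormalMap_of_forall_exists fun ξ η => ?_, fun g => ?_⟩, h.nonneg, fun n a => ?_⟩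
  · obtain ⟨ξ', η', h'⟩ := exists_vectorFunctional_tsum (fun k => h.mem (ξ k) (η k))
      (fun k => h.norm_le (ξ k) (η k))
    refine ⟨ξ', η', fun x => ?_⟩
    rw [← h', vectorFunctional]
    exact tsum_congr fun k => hM x (ξ k) (η k)
  · refine Subtype.ext <| ContinuousLinearMap.ext fun ξ => ext_inner_left ℂ fun η => ?_
    rw [hM]
    change Ω ξ η (leftRegular g) = inner ℂ η (ψ g • leftRegular g ξ)
    rw [h.apply_leftRegular, inner_smul_right]
  · refine opNorm_le_of_inner (mul_nonneg h.nonneg (norm_nonneg _)) fun v w => ?_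
    rw [inner_matrixOp]
    simp only [Matrix.of_apply, hM]
    exact h.bound n _ v w

end MultiplierForm

/-! ### Restriction to measurable sets and algebra of vector functionals. -/

section Support

variable {Y : Type*} [MeasurableSpace Y] {ν : Measure Y}

theorem inner_mulOp_indicator_left {A : Set Y} (hA : MeasurableSet A) (f g : Lp ℂ 2 ν) :
    inner ℂ (mulOp ν (A.indicator fun _ => 1) f) g =
      inner ℂ f (mulOp ν (A.indicator fun _ => 1) g) := by
  rw [L2.inner_def, L2.inner_def]
  refine integral_congr_ae ?_
  filter_upwards [(isBddMeas_indicator hA).coeFn_mulOp f, (isBddMeas_indicator hA).coeFn_mulOp g]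
    with t h1 h2
  rw [h1, h2]
  by_cases ht : t ∈ A <;> simp [ht]

theorem mulOp_indicator_eq_self {A : Set Y} (hA : MeasurableSet A) {f : Lp ℂ 2 ν}
    (hf : ∀ᵐ t ∂ν, t ∉ A → f t = 0) : mulOp ν (A.indicator fun _ => 1) f = f := by
  refine Lp.ext ?_
  filter_upwards [(isBddMeas_indicator hA).coeFn_mulOp f, hf] with t h1 h2
  rw [h1]
  by_cases ht : t ∈ A
  · simp [ht]
  · simp [h2 ht]

theorem mulOp_indicator_eq_sum {ι : Type*} [Fintype ι] {A : Set Y} (hA : MeasurableSet A)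
    {A' : ι → Set Y} (hA' : ∀ j, MeasurableSet (A' j)) (hd : Pairwise (Function.onFun Disjoint A'))
    {f : Lp ℂ 2 ν} (hf : ∀ᵐ t ∂ν, t ∉ ⋃ j, A' j → f t = 0) :
    mulOp ν (A.indicator fun _ => 1) f = ∑ j, mulOp ν ((A ∩ A' j).indicator fun _ => 1) f := by
  have hd' : Pairwise (Function.onFun Disjoint fun j => A ∩ A' j) := fun i j hij =>
    (hd hij).mono Set.inter_subset_right Set.inter_subset_right
  have h := isBddMeas_step (ν := ν) (fun j => hA.inter (hA' j)) hd' (c := fun _ => 1)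
    zero_le_one (by simp)
  have h1 := mulOp_step (fun j => hA.inter (hA' j)) h f
  simp only [one_smul] at h1
  rw [← h1]
  refine Lp.ext ?_
  filter_upwards [(isBddMeas_indicator hA).coeFn_mulOp f, h.coeFn_mulOp f, hf] with t h2 h3 h4
  rw [h2, h3]
  by_cases ht : t ∈ ⋃ j, A' j
  · obtain ⟨j, hj⟩ := Set.mem_iUnion.1 ht
    congr 1
    rw [Finset.sum_eq_single j]
    · by_cases htA : t ∈ A <;> simp [htA, hj]
    · intro k _ hk
      have : t ∉ A' k := fun h' => Set.disjoint_left.1 (hd hk) h' hj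
      simp [this]
    · simp
  · simp [h4 ht]

theorem mulOp_indicator_empty (f : Lp ℂ 2 ν) :
    mulOp ν ((∅ : Set Y).indicator fun _ => 1) f = 0 := by
  refine Lp.ext ?_
  filter_upwards [(isBddMeas_indicator (MeasurableSet.empty)).coeFn_mulOp f,
    Lp.coeFn_zero ℂ 2 ν] with t h1 h2
  rw [h1, h2]
  simp

theorem vecFun_add_left {E : Type*} [NormedAddCommGroup E] [InnerProductSpace ℂ E] (ξ ξ' η : E) :
    vecFun (ξ + ξ') η = vecFun ξ η + vecFun ξ' η := by
  ext x; simp [vecFun_apply]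

theorem vecFun_smul_left {E : Type*} [NormedAddCommGroup E] [InnerProductSpace ℂ E] (c : ℂ)
    (ξ η : E) : vecFun (c • ξ) η = c • vecFun ξ η := by
  ext x; simp [vecFun_apply]

theorem vecFun_add_right {E : Type*} [NormedAddCommGroup E] [InnerProductSpace ℂ E] (ξ η η' : E) :
    vecFun ξ (η + η') = vecFun ξ η + vecFun ξ η' := by
  ext x; simp [vecFun_apply]

theorem vecFun_smul_right {E : Type*} [NormedAddCommGroup E] [InnerProductSpace ℂ E] (c : ℂ)
    (ξ η : E) : vecFun ξ (c • η) = starRingEnd ℂ c • vecFun ξ η := by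
  ext x; simp [vecFun_apply, mul_comm]

theorem vecFun_sub_left {E : Type*} [NormedAddCommGroup E] [InnerProductSpace ℂ E] (ξ ξ' η : E) :
    vecFun (ξ - ξ') η = vecFun ξ η - vecFun ξ' η := by
  ext x; simp [vecFun_apply]

theorem vecFun_zero_right {E : Type*} [NormedAddCommGroup E] [InnerProductSpace ℂ E] (ξ : E) :
    vecFun ξ 0 = 0 := by
  ext x; simp [vecFun_apply]

theorem vecFun_sum_right {E ι : Type*} [NormedAddCommGroup E] [InnerProductSpace ℂ E] [Fintype ι]
    (ξ : E) (η : ι → E) : vecFun ξ (∑ i, η i) = ∑ i, vecFun ξ (η i) := by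
  ext x; simp [vecFun_apply]

theorem norm_toLp_fin_one {E : Type*} [NormedAddCommGroup E] (v : E) :
    ‖(WithLp.toLp 2 fun _ : Fin 1 => v : PiLp 2 fun _ : Fin 1 => E)‖ = ‖v‖ := by
  rw [PiLp.norm_eq_of_L2]
  simp

theorem norm_matrixOp_fin_one_le {E : Type*} [NormedAddCommGroup E] [InnerProductSpace ℂ E]
    (x : E →L[ℂ] E) : ‖matrixOp (Matrix.of fun _ _ : Fin 1 => x)‖ ≤ ‖x‖ := by
  refine ContinuousLinearMap.opNorm_le_bound _ (norm_nonneg _) fun v => ?_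
  rw [PiLp.norm_eq_of_L2, PiLp.norm_eq_of_L2]
  have h : matrixOp (Matrix.of fun _ _ : Fin 1 => x) v 0 = x (v 0) := by
    rw [matrixOp_apply]
    simp
  simp only [Finset.univ_unique, Fin.default_eq_zero, Finset.sum_singleton,
    Real.sqrt_sq (norm_nonneg _), h]
  exact x.le_opNorm _

end Support

/-! ### Step forms: approximate multiplier maps with finitely many weights. -/

section StepForm

variable {G : Type*} [Group G] [TopologicalSpace G] [IsTopologicalGroup G] [LocallyCompactSpace G]
  [MeasurableSpace G] [BorelSpace G] {φ : G → ℂ} {C : ℝ}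
  {Y : Type*} [MeasurableSpace Y] {ν : Measure Y}
  {ι κ : Type*} [Fintype ι] [Fintype κ]

/-- The average `t ↦ ∫ w(x) φ(x⁻¹ z(t)) dx`. -/
noncomputable def averaged (φ : G → ℂ) (z : Y → G) (w : G → ℝ) (t : Y) : ℂ :=
  ∫ x, (w x : ℂ) * φ (x⁻¹ * z t) ∂(Measure.haar : Measure G)

theorem integrable_weight_mul (hφ : Continuous φ) {w : G → ℝ} (hw : Continuous w)
    (hws : HasCompactSupport w) (g : G) :
    Integrable (fun x => (w x : ℂ) * φ (x⁻¹ * g)) (Measure.haar : Measure G) :=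
  Continuous.integrable_of_hasCompactSupport (by fun_prop)
    ((hws.comp_left Complex.ofReal_zero).mul_right)

theorem averaged_sub (hφ : Continuous φ) {Y : Type*} (z : Y → G) {w w' : G → ℝ} (hw : Continuous w)
    (hws : HasCompactSupport w) (hw' : Continuous w') (hws' : HasCompactSupport w') :
    averaged φ z (w - w') = averaged φ z w - averaged φ z w' := by
  ext t
  rw [Pi.sub_apply, averaged, averaged, averaged,
    ← integral_sub (integrable_weight_mul hφ hw hws _) (integrable_weight_mul hφ hw' hws' _)]
  refine integral_congr_ae (Filter.Eventually.of_forall fun x => ?_)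
  simp only [Pi.sub_apply]
  push_cast
  ring

/-- The functional `a ↦ ∑ᵢ ⟨a mᵢ ξ, 1_{Aᵢ} η⟩`, where `mᵢ` is the multiplication by the average
of `φ` with weight `wᵢ`. -/
noncomputable def stepForm (ν : Measure Y) (φ : G → ℂ) (z : Y → G) (A : ι → Set Y)
    (w : ι → G → ℝ) (ξ η : Lp ℂ 2 ν) : StrongDual ℂ (Lp ℂ 2 ν →L[ℂ] Lp ℂ 2 ν) :=
  ∑ i, vecFun (mulOp ν (averaged φ z (w i)) ξ) (mulOp ν ((A i).indicator fun _ => 1) η)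

theorem stepForm_apply (z : Y → G) (A : ι → Set Y) (w : ι → G → ℝ) (ξ η : Lp ℂ 2 ν)
    (x : Lp ℂ 2 ν →L[ℂ] Lp ℂ 2 ν) : stepForm ν φ z A w ξ η x =
      ∑ i, inner ℂ (mulOp ν ((A i).indicator fun _ => 1) η)
        (x (mulOp ν (averaged φ z (w i)) ξ)) := by
  rw [stepForm, sum_apply]
  exact Finset.sum_congr rfl fun i _ => vecFun_apply _ _ _

theorem stepForm_mem (z : Y → G) (A : ι → Set Y) (w : ι → G → ℝ) (ξ η : Lp ℂ 2 ν) :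
    stepForm ν φ z A w ξ η ∈ normalFunctionals (Lp ℂ 2 ν) :=
  Submodule.sum_mem _ fun _ _ => vecFun_mem_normalFunctionals _ _

theorem stepForm_add_left (z : Y → G) (A : ι → Set Y) (w : ι → G → ℝ) (ξ ξ' η : Lp ℂ 2 ν) :
    stepForm ν φ z A w (ξ + ξ') η = stepForm ν φ z A w ξ η + stepForm ν φ z A w ξ' η := by
  simp only [stepForm, map_add, vecFun_add_left, Finset.sum_add_distrib]

theorem stepForm_smul_left (z : Y → G) (A : ι → Set Y) (w : ι → G → ℝ) (c : ℂ) (ξ η : Lp ℂ 2 ν) :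
    stepForm ν φ z A w (c • ξ) η = c • stepForm ν φ z A w ξ η := by
  simp only [stepForm, map_smul, vecFun_smul_left, Finset.smul_sum]

theorem stepForm_add_right (z : Y → G) (A : ι → Set Y) (w : ι → G → ℝ) (ξ η η' : Lp ℂ 2 ν) :
    stepForm ν φ z A w ξ (η + η') = stepForm ν φ z A w ξ η + stepForm ν φ z A w ξ η' := by
  simp only [stepForm, map_add, vecFun_add_right, Finset.sum_add_distrib]

theorem stepForm_smul_right (z : Y → G) (A : ι → Set Y) (w : ι → G → ℝ) (c : ℂ)
    (ξ η : Lp ℂ 2 ν) :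
    stepForm ν φ z A w ξ (c • η) = starRingEnd ℂ c • stepForm ν φ z A w ξ η := by
  simp only [stepForm, map_smul, vecFun_smul_right, Finset.smul_sum]

variable [TopologicalSpace Y] [BorelSpace Y] [RegularSpace Y] [LocallyCompactSpace Y]

/-- A matrix sum of step forms is one such sum for the operator `matrixOp a` on `n` copies of `L²`,
with the orthogonal vectors `1_{A i} η`. The bound is therefore independent of `n`. -/
theorem SchurBound.norm_sum_stepForm_le [ν.Regular] (h : SchurBound φ C) (hφ : Continuous φ)
    {z : Y → G} (hz : Continuous z) {A : ι → Set Y} (hA : ∀ i, MeasurableSet (A i))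
    (hd : Pairwise (Function.onFun Disjoint A)) {w : ι → G → ℝ} (hw : ∀ i, Continuous (w i))
    (hws : ∀ i, HasCompactSupport (w i)) {D : ℝ}
    (hD : ∀ i, ∫ x, |w i x| ∂(Measure.haar : Measure G) ≤ D) (hD0 : 0 ≤ D)
    (n : ℕ) (a : Matrix (Fin n) (Fin n) (Lp ℂ 2 ν →L[ℂ] Lp ℂ 2 ν))
    (ξ η : PiLp 2 fun _ : Fin n => Lp ℂ 2 ν) :
    ‖∑ p, ∑ q, stepForm ν φ z A w (ξ q) (η p) (a p q)‖ ≤ C * D * ‖matrixOp a‖ * ‖ξ‖ * ‖η‖ := by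
  have h1 : ∑ p, ∑ q, stepForm ν φ z A w (ξ q) (η p) (a p q) =
      ∑ i, inner ℂ (mulVec ν ((A i).indicator fun _ => 1) η)
        (matrixOp a (mulVec ν (averaged φ z (w i)) ξ)) := by
    simp_rw [inner_matrixOp, stepForm_apply]
    rw [Finset.sum_comm_cycle]
    rfl
  rw [h1]
  refine ((norm_sum_le _ _).trans (h.sum_norm_inner_integral_le hφ hz hw hws hD hD0 (matrixOp a)
    (fun i j hij => inner_mulVec_indicator_of_disjoint (hA i) (hA j) (hd hij) η η) ξ)).trans ?_
  have hC := h.1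
  gcongr
  exact Real.sqrt_le_iff.2 ⟨norm_nonneg _, sum_norm_sq_mulVec_indicator_le hA hd η⟩

theorem SchurBound.norm_stepForm_le [ν.Regular] (h : SchurBound φ C) (hφ : Continuous φ)
    {z : Y → G} (hz : Continuous z) {A : ι → Set Y} (hA : ∀ i, MeasurableSet (A i))
    (hd : Pairwise (Function.onFun Disjoint A)) {w : ι → G → ℝ} (hw : ∀ i, Continuous (w i))
    (hws : ∀ i, HasCompactSupport (w i)) {D : ℝ}
    (hD : ∀ i, ∫ x, |w i x| ∂(Measure.haar : Measure G) ≤ D) (hD0 : 0 ≤ D) (ξ η : Lp ℂ 2 ν) :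
    ‖stepForm ν φ z A w ξ η‖ ≤ C * D * ‖ξ‖ * ‖η‖ := by
  have hC := h.1
  refine ContinuousLinearMap.opNorm_le_bound _ (by positivity) fun x => ?_
  have h1 := h.norm_sum_stepForm_le hφ hz hA hd hw hws hD hD0 1 (Matrix.of fun _ _ => x)
    (WithLp.toLp 2 fun _ => ξ) (WithLp.toLp 2 fun _ => η)
  simp only [Finset.univ_unique, Finset.sum_singleton, norm_toLp_fin_one, Matrix.of_apply] at h1
  refine h1.trans ?_
  calc _ ≤ C * D * ‖x‖ * ‖ξ‖ * ‖η‖ := by gcongr; exact norm_matrixOp_fin_one_le x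
    _ = _ := by ring

/-- Both forms are rewritten on the common refinement, which is possible because `η` lives on both
unions. On empty cells the weight `W` is irrelevant. -/
theorem SchurBound.stepForm_sub_stepForm (h : SchurBound φ C) (hφ : Continuous φ)
    {z : Y → G} (hz : Continuous z)
    {A : ι → Set Y} (hA : ∀ i, MeasurableSet (A i)) (hd : Pairwise (Function.onFun Disjoint A))
    {A' : κ → Set Y} (hA' : ∀ i, MeasurableSet (A' i))
    (hd' : Pairwise (Function.onFun Disjoint A'))
    {w : ι → G → ℝ} (hw : ∀ i, Continuous (w i)) (hws : ∀ i, HasCompactSupport (w i))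
    {w' : κ → G → ℝ} (hw' : ∀ i, Continuous (w' i)) (hws' : ∀ i, HasCompactSupport (w' i))
    {η : Lp ℂ 2 ν} (hη : ∀ᵐ t ∂ν, t ∉ ⋃ i, A i → η t = 0)
    (hη' : ∀ᵐ t ∂ν, t ∉ ⋃ i, A' i → η t = 0) {W : ι × κ → G → ℝ}
    (hW : ∀ i j, (A i ∩ A' j).Nonempty → W (i, j) = w i - w' j) (ξ : Lp ℂ 2 ν) :
    stepForm ν φ z A w ξ η - stepForm ν φ z A' w' ξ η =
      stepForm ν φ z (fun p : ι × κ => A p.1 ∩ A' p.2) W ξ η := by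
  have hsub : ∀ i j, averaged φ z (w i - w' j) = averaged φ z (w i) - averaged φ z (w' j) :=
    fun i j => averaged_sub hφ z (hw i) (hws i) (hw' j) (hws' j)
  have hb : ∀ {w : G → ℝ}, Continuous w → HasCompactSupport w → IsBddMeas ν (averaged φ z w) _ :=
    fun hw hws => h.isBddMeas_integral hφ hz hw hws
  have e1 : stepForm ν φ z A w ξ η = ∑ i, ∑ j, vecFun (mulOp ν (averaged φ z (w i)) ξ)
      (mulOp ν ((A i ∩ A' j).indicator fun _ => 1) η) := by
    refine Finset.sum_congr rfl fun i _ => ?_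
    rw [mulOp_indicator_eq_sum (hA i) hA' hd' hη', vecFun_sum_right]
  have e2 : stepForm ν φ z A' w' ξ η = ∑ i, ∑ j, vecFun (mulOp ν (averaged φ z (w' j)) ξ)
      (mulOp ν ((A i ∩ A' j).indicator fun _ => 1) η) := by
    rw [Finset.sum_comm]
    refine Finset.sum_congr rfl fun j _ => ?_
    rw [mulOp_indicator_eq_sum (hA' j) hA hd hη, vecFun_sum_right]
    simp_rw [Set.inter_comm]
  rw [e1, e2, ← Finset.sum_sub_distrib, stepForm, Fintype.sum_prod_type]
  refine Finset.sum_congr rfl fun i _ => ?_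
  rw [← Finset.sum_sub_distrib]
  refine Finset.sum_congr rfl fun j _ => ?_
  by_cases hij : (A i ∩ A' j).Nonempty
  · rw [hW i j hij, hsub, (hb (hw i) (hws i)).mulOp_sub (hb (hw' j) (hws' j)), vecFun_sub_left]
  · simp only [Set.not_nonempty_iff_eq_empty.1 hij, mulOp_indicator_empty, vecFun_zero_right,
      sub_self]

theorem SchurBound.norm_stepForm_sub_le [ν.Regular] (h : SchurBound φ C) (hφ : Continuous φ)
    {z : Y → G} (hz : Continuous z)
    {A : ι → Set Y} (hA : ∀ i, MeasurableSet (A i)) (hd : Pairwise (Function.onFun Disjoint A))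
    {A' : κ → Set Y} (hA' : ∀ i, MeasurableSet (A' i))
    (hd' : Pairwise (Function.onFun Disjoint A'))
    {w : ι → G → ℝ} (hw : ∀ i, Continuous (w i)) (hws : ∀ i, HasCompactSupport (w i))
    {w' : κ → G → ℝ} (hw' : ∀ i, Continuous (w' i)) (hws' : ∀ i, HasCompactSupport (w' i))
    {ε : ℝ} (hε : 0 ≤ ε) (hww' : ∀ i j, (A i ∩ A' j).Nonempty →
      ∫ x, |w i x - w' j x| ∂(Measure.haar : Measure G) ≤ ε) {η : Lp ℂ 2 ν}
    (hη : ∀ᵐ t ∂ν, t ∉ ⋃ i, A i → η t = 0) (hη' : ∀ᵐ t ∂ν, t ∉ ⋃ i, A' i → η t = 0)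
    (ξ : Lp ℂ 2 ν) :
    ‖stepForm ν φ z A w ξ η - stepForm ν φ z A' w' ξ η‖ ≤ C * ε * ‖ξ‖ * ‖η‖ := by
  have hdp : Pairwise (Function.onFun Disjoint fun p : ι × κ => A p.1 ∩ A' p.2) := by
    rintro ⟨i, j⟩ ⟨i', j'⟩ hne
    by_cases hi : i = i'
    · have hj : j ≠ j' := fun hj => hne (by rw [hi, hj])
      exact (hd' hj).mono Set.inter_subset_right Set.inter_subset_right
    · exact (hd hi).mono Set.inter_subset_left Set.inter_subset_left
  -- Nothing is known about `w i - w' j` over an empty cell, so zero is used there to keep the `L¹`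
  -- bound uniform.
  have hW : ∀ p : ι × κ, ∃ W : G → ℝ, ((A p.1 ∩ A' p.2).Nonempty → W = w p.1 - w' p.2) ∧
      Continuous W ∧ HasCompactSupport W ∧ ∫ x, |W x| ∂(Measure.haar : Measure G) ≤ ε := by
    intro p
    by_cases hp : (A p.1 ∩ A' p.2).Nonempty
    · exact ⟨w p.1 - w' p.2, fun _ => rfl, (hw p.1).sub (hw' p.2), (hws p.1).sub (hws' p.2),
        hww' p.1 p.2 hp⟩
    · exact ⟨0, fun h => absurd h hp, continuous_zero, HasCompactSupport.zero, by simpa using hε⟩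
  choose W hW hWc hWs hWε using hW
  rw [h.stepForm_sub_stepForm hφ hz hA hd hA' hd' hw hws hw' hws' hη hη' (W := W)
    (fun i j hij => hW (i, j) hij)]
  have key := h.norm_stepForm_le (ν := ν) (D := ε) hφ hz (A := fun p : ι × κ => A p.1 ∩ A' p.2)
    (w := W) (fun p => (hA p.1).inter (hA' p.2)) hdp hWc hWs hWε hε ξ η
  exact key

end StepForm

/-! ### Values of step forms on the regular representation. -/

section LeftRegular

variable {G : Type*} [Group G] [TopologicalSpace G] [IsTopologicalGroup G] [LocallyCompactSpace G]
  [MeasurableSpace G] [BorelSpace G] {φ : G → ℂ} {C : ℝ}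
  {H : Type*} [Group H] [TopologicalSpace H] [IsTopologicalGroup H] [LocallyCompactSpace H]
  [MeasurableSpace H] [BorelSpace H] {ι : Type*} [Fintype ι]

/-- At a point `s` of `A i`, translating the product of the average with `ξ` gives the average at
`g⁻¹s` times `λ(g)ξ`; the factor is within `δ` of `c` by assumption. Outside the cells `η` vanishes.
-/
theorem SchurBound.norm_stepForm_leftRegular_sub_le (h : SchurBound φ C) (hφ : Continuous φ)
    {z : H → G} (hz : Continuous z)
    {A : ι → Set H} (hA : ∀ i, MeasurableSet (A i)) (hd : Pairwise (Function.onFun Disjoint A))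
    {w : ι → G → ℝ} (hw : ∀ i, Continuous (w i)) (hws : ∀ i, HasCompactSupport (w i))
    {δ : ℝ} (hδ : 0 ≤ δ) {c : ℂ} {g : H}
    (hc : ∀ i, ∀ s ∈ A i, ‖averaged φ z (w i) (g⁻¹ * s) - c‖ ≤ δ) {η : LTwo H}
    (hη : ∀ᵐ t ∂(Measure.haar : Measure H), t ∉ ⋃ i, A i → η t = 0) (ξ : LTwo H) :
    ‖stepForm Measure.haar φ z A w ξ η (leftRegular g) - c * inner ℂ η (leftRegular g ξ)‖ ≤
      δ * ‖ξ‖ * ‖η‖ := by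
  have hU : MeasurableSet (⋃ i, A i) := .iUnion hA
  have hb : ∀ i, IsBddMeas Measure.haar (averaged φ z (w i)) _ :=
    fun i => h.isBddMeas_integral hφ hz (hw i) (hws i)
  set S : LTwo H := ∑ i, mulOp Measure.haar ((A i).indicator fun _ => 1)
    (leftRegular g (mulOp Measure.haar (averaged φ z (w i)) ξ)) with hS
  set S' : LTwo H := mulOp Measure.haar ((⋃ i, A i).indicator fun _ => 1) (leftRegular g ξ) with hS'
  have h1 : stepForm Measure.haar φ z A w ξ η (leftRegular g) - c * inner ℂ η (leftRegular g ξ) =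
      inner ℂ η (S - c • S') := by
    rw [stepForm_apply, inner_sub_right, inner_smul_right, hS', ← inner_mulOp_indicator_left hU,
      mulOp_indicator_eq_self hU hη, hS, inner_sum]
    simp_rw [inner_mulOp_indicator_left (hA _)]
  have h2 : ‖S - c • S'‖ ≤ δ * ‖leftRegular g ξ‖ := by
    refine Lp.norm_le_mul_norm_of_ae_le_mul ?_
    have e1 : ∀ᵐ s ∂(Measure.haar : Measure H), ∀ i, mulOp Measure.haar
        ((A i).indicator fun _ => 1)
        (leftRegular g (mulOp Measure.haar (averaged φ z (w i)) ξ)) s =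
          (A i).indicator (fun _ => 1) s * (averaged φ z (w i) (g⁻¹ * s) * leftRegular g ξ s) := by
      refine ae_all_iff.2 fun i => ?_
      have e2 := (measurePreserving_mul_left (Measure.haar : Measure H)
        g⁻¹).quasiMeasurePreserving.ae_eq_comp ((hb i).coeFn_mulOp ξ)
      filter_upwards [(isBddMeas_indicator (hA i)).coeFn_mulOp
        (leftRegular g (mulOp Measure.haar (averaged φ z (w i)) ξ)),
        coeFn_leftRegular g (mulOp Measure.haar (averaged φ z (w i)) ξ), coeFn_leftRegular g ξ, e2]
        with s h3 h4 h5 h6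
      rw [h3, h4, h5]
      exact congrArg _ h6
    filter_upwards [e1, Lp.coeFn_sub S (c • S'), Lp.coeFn_smul c S',
      Lp.coeFn_finsetSum Finset.univ (fun i => mulOp Measure.haar ((A i).indicator fun _ => 1)
        (leftRegular g (mulOp Measure.haar (averaged φ z (w i)) ξ))),
      (isBddMeas_indicator hU).coeFn_mulOp (leftRegular g ξ)] with s h3 h4 h5 h6 h7
    rw [h4, Pi.sub_apply, h5, Pi.smul_apply, h7, hS, h6, Finset.sum_apply]
    by_cases hs : s ∈ ⋃ i, A i
    · obtain ⟨i, hi⟩ := Set.mem_iUnion.1 hs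
      rw [Finset.sum_eq_single i]
      · rw [h3 i, Set.indicator_of_mem hi, Set.indicator_of_mem hs, one_mul, one_mul,
          smul_eq_mul, ← sub_mul, norm_mul]
        exact mul_le_mul_of_nonneg_right (hc i s hi) (norm_nonneg _)
      · intro k _ hk
        have : s ∉ A k := fun h' => Set.disjoint_left.1 (hd hk) h' hi
        rw [h3 k, Set.indicator_of_notMem this, zero_mul]
      · simp
    · rw [Set.indicator_of_notMem hs, Finset.sum_eq_zero]
      · simp only [zero_mul, smul_zero, sub_zero, norm_zero]
        positivity
      · intro i _
        have : s ∉ A i := fun h' => hs (Set.mem_iUnion.2 ⟨i, h'⟩)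
        rw [h3 i, Set.indicator_of_notMem this, zero_mul]
  rw [norm_leftRegular_apply] at h2
  rw [h1]
  calc _ ≤ ‖η‖ * ‖S - c • S'‖ := norm_inner_le_norm _ _
    _ ≤ ‖η‖ * (δ * ‖ξ‖) := by gcongr
    _ = _ := by ring

end LeftRegular

/-! ### Continuity of translation in `L¹` and compactly supported vectors. -/

section Translation

open Filter Topology Pointwise

variable {G : Type*} [Group G] [TopologicalSpace G] [IsTopologicalGroup G] [LocallyCompactSpace G]
  [MeasurableSpace G] [BorelSpace G]

theorem hasCompactSupport_comp_mul_left {f : G → ℝ} (hfs : HasCompactSupport f) (v : G) :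
    HasCompactSupport fun y => f (v * y) :=
  hfs.comp_homeomorph (Homeomorph.mulLeft v)

theorem continuous_comp_mul_left {f : G → ℝ} (hf : Continuous f) (v : G) :
    Continuous fun y => f (v * y) := hf.comp (continuous_const.mul continuous_id)

theorem integrable_abs_translate_sub {f : G → ℝ} (hf : Continuous f) (hfs : HasCompactSupport f)
    (v v' : G) : Integrable (fun y => |f (v * y) - f (v' * y)|) (Measure.haar : Measure G) :=
  ((continuous_comp_mul_left hf v).sub (continuous_comp_mul_left hf v')).abs.integrable_of_hasCompactSupport
    (((hasCompactSupport_comp_mul_left hfs v).sub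
      (hasCompactSupport_comp_mul_left hfs v')).comp_left abs_zero)

theorem integral_abs_translate (f : G → ℝ) (v : G) :
    ∫ y, |f (v * y)| ∂(Measure.haar : Measure G) = ∫ y, |f y| ∂(Measure.haar : Measure G) :=
  integral_mul_left_eq_self (fun y => |f y|) v

/-- For `v` in a compact neighbourhood `V`, all translates are supported in the compact set `V⁻¹ ·
supp f`, so the parameter integral is continuous. -/
theorem tendsto_integral_abs_translate_sub {f : G → ℝ} (hf : Continuous f)
    (hfs : HasCompactSupport f) (v₀ : G) :
    Tendsto (fun v => ∫ y, |f (v * y) - f (v₀ * y)| ∂(Measure.haar : Measure G)) (𝓝 v₀) (𝓝 0) := by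
  obtain ⟨V, hV, hVn⟩ := exists_compact_mem_nhds v₀
  have hk : IsCompact (V⁻¹ * tsupport f) := hV.inv.mul hfs
  have hmem : ∀ v ∈ V, ∀ y, y ∉ V⁻¹ * tsupport f → f (v * y) = 0 := fun v hv y hy => by
    refine image_eq_zero_of_notMem_tsupport fun h => hy ?_
    exact ⟨v⁻¹, Set.inv_mem_inv.2 hv, v * y, h, by simp⟩
  have h1 : ContinuousOn (fun v => ∫ y, |f (v * y) - f (v₀ * y)| ∂(Measure.haar : Measure G)) V := by
    refine continuousOn_integral_of_compact_support hk ?_ fun v y hv hy => ?_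
    · refine Continuous.continuousOn ?_
      unfold Function.uncurry
      fun_prop
    · rw [hmem v hv y hy, hmem v₀ (mem_of_mem_nhds hVn) y hy, sub_zero, abs_zero]
  have h2 := (h1.continuousAt hVn).tendsto
  simpa using h2

theorem exists_compact_support_approx {H : Type*} [Group H] [TopologicalSpace H]
    [IsTopologicalGroup H] [LocallyCompactSpace H] [MeasurableSpace H] [BorelSpace H]
    (η : LTwo H) {ε : ℝ} (hε : 0 < ε) :
    ∃ (η' : LTwo H) (K : Set H), IsCompact K ∧ ‖η - η'‖ ≤ ε ∧
      ∀ᵐ t ∂(Measure.haar : Measure H), t ∉ K → η' t = 0 := by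
  obtain ⟨g, hg, hgc, hgm, hgs⟩ := exists_hasCompactSupport_eLpNorm_sub_le (p := 2) (by norm_num)
    (Lp.memLp η) (ε := ENNReal.ofReal ε) (by simpa using hε)
  refine ⟨hgm.toLp g, tsupport g, hgs, ?_, ?_⟩
  · rw [Lp.norm_def]
    refine ENNReal.toReal_le_of_le_ofReal hε.le (le_trans (le_of_eq ?_) hg)
    refine eLpNorm_congr_ae ?_
    filter_upwards [Lp.coeFn_sub η (hgm.toLp g), hgm.coeFn_toLp] with t h1 h2
    rw [h1, Pi.sub_apply, Pi.sub_apply, h2]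
  · filter_upwards [hgm.coeFn_toLp] with t ht h
    rw [ht, image_eq_zero_of_notMem_tsupport h]

end Translation

/-! ### Partitions of `H` adapted to the moving weight. -/

section StepData

open Filter Topology

variable {G : Type*} [Group G] [TopologicalSpace G] [IsTopologicalGroup G] [LocallyCompactSpace G]
  [MeasurableSpace G] [BorelSpace G]
  {H : Type*} [Group H] [TopologicalSpace H] [IsTopologicalGroup H] [LocallyCompactSpace H]
  [MeasurableSpace H] [BorelSpace H]

/-- A finite measurable partition of a set containing `K`, on the pieces of which the translates
of `f` by `π` vary by at most `ε` in `L¹`. -/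
structure StepData (π : H → G) (f : G → ℝ) (K : Set H) (ε : ℝ) where
  N : ℕ
  B : Fin N → Set H
  g : Fin N → G
  meas : ∀ i, MeasurableSet (B i)
  disj : Pairwise (Function.onFun Disjoint B)
  cover : K ⊆ ⋃ i, B i
  small : ∀ i, ∀ s ∈ B i, ∫ y, |f (g i * y) - f (π s * y)| ∂(Measure.haar : Measure G) ≤ ε

theorem nonempty_stepData {π : H → G} (hπ : Continuous π) {f : G → ℝ} (hf : Continuous f)
    (hfs : HasCompactSupport f) {K : Set H} (hK : IsCompact K) {ε : ℝ} (hε : 0 < ε) :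
    Nonempty (StepData π f K ε) := by
  let U : H → Set H := fun s =>
    interior {t | ∫ y, |f (π t * y) - f (π s * y)| ∂(Measure.haar : Measure G) < ε}
  have hU : ∀ s, U s ∈ 𝓝 s := fun s => by
    refine interior_mem_nhds.2 ?_
    exact ((tendsto_integral_abs_translate_sub hf hfs (π s)).comp hπ.continuousAt).eventually
      (gt_mem_nhds hε)
  obtain ⟨t, -, ht⟩ := hK.elim_nhds_subcover U fun s _ => hU s
  let e : Fin (Fintype.card t) ≃ t := (Fintype.equivFin t).symm
  have hmeas : ∀ i, MeasurableSet (U (e i)) := fun i => isOpen_interior.measurableSet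
  refine ⟨⟨_, disjointed fun i => U (e i), fun i => π (e i), fun i => ?_, disjoint_disjointed _,
    ?_, fun i s hs => ?_⟩⟩
  · rw [disjointed_eq_inter_compl]
    exact (hmeas i).inter (.biInter (Set.to_countable _) fun j _ => (hmeas j).compl)
  · rw [iUnion_disjointed]
    intro s hs
    obtain ⟨x, hx, hxs⟩ := Set.mem_iUnion₂.1 (ht hs)
    exact Set.mem_iUnion.2 ⟨e.symm ⟨x, hx⟩, by simpa using hxs⟩
  · have h1 := interior_subset (disjointed_subset (fun i => U (e i)) i hs)
    simp_rw [abs_sub_comm (f (π (e i) * _))]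
    exact h1.le

variable {π : H → G} {f : G → ℝ} {K K' : Set H} {ε ε' : ℝ} {φ : G → ℂ} {C : ℝ}

/-- The approximate multiplier form given by a partition. -/
noncomputable def StepData.form (d : StepData π f K ε) (φ : G → ℂ) (ξ η : LTwo H) :
    StrongDual ℂ (LTwo H →L[ℂ] LTwo H) :=
  stepForm Measure.haar φ (fun t => (π t)⁻¹) d.B (fun i y => f (d.g i * y)) ξ η

theorem StepData.bound (d : StepData π f K ε) (h : SchurBound φ C) (hφ : Continuous φ)
    (hπ : Continuous π) (hf : Continuous f) (hfs : HasCompactSupport f) (n : ℕ)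
    (a : Matrix (Fin n) (Fin n) (LTwo H →L[ℂ] LTwo H)) (v w : PiLp 2 fun _ : Fin n => LTwo H) :
    ‖∑ p, ∑ q, d.form φ (v q) (w p) (a p q)‖ ≤
      C * (∫ y, |f y| ∂(Measure.haar : Measure G)) * ‖matrixOp a‖ * ‖v‖ * ‖w‖ :=
  h.norm_sum_stepForm_le hφ hπ.inv d.meas d.disj (fun _ => continuous_comp_mul_left hf _)
    (fun _ => hasCompactSupport_comp_mul_left hfs _) (fun _ => (integral_abs_translate f _).le)
    (integral_nonneg fun _ => abs_nonneg _) n a v w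

theorem StepData.norm_form_le (d : StepData π f K ε) (h : SchurBound φ C) (hφ : Continuous φ)
    (hπ : Continuous π) (hf : Continuous f) (hfs : HasCompactSupport f) (ξ η : LTwo H) :
    ‖d.form φ ξ η‖ ≤ C * (∫ y, |f y| ∂(Measure.haar : Measure G)) * ‖ξ‖ * ‖η‖ :=
  h.norm_stepForm_le hφ hπ.inv d.meas d.disj (fun _ => continuous_comp_mul_left hf _)
    (fun _ => hasCompactSupport_comp_mul_left hfs _) (fun _ => (integral_abs_translate f _).le)
    (integral_nonneg fun _ => abs_nonneg _) ξ η

theorem StepData.ae_cover (d : StepData π f K ε) {K₀ : Set H} (hK : K₀ ⊆ K) {η : LTwo H}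
    (hη : ∀ᵐ t ∂(Measure.haar : Measure H), t ∉ K₀ → η t = 0) :
    ∀ᵐ t ∂(Measure.haar : Measure H), t ∉ ⋃ i, d.B i → η t = 0 := by
  filter_upwards [hη] with t ht h
  exact ht fun h' => h (d.cover (hK h'))

/-- On a nonempty intersection of cells both weights are compared with the exact weight `f(π(s)·)`
at a common point `s`. -/
theorem StepData.norm_form_sub_le (d : StepData π f K ε) (d' : StepData π f K' ε')
    (hε : 0 ≤ ε) (hε' : 0 ≤ ε')
    (h : SchurBound φ C) (hφ : Continuous φ) (hπ : Continuous π) (hf : Continuous f)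
    (hfs : HasCompactSupport f) {K₀ : Set H} (hK : K₀ ⊆ K) (hK' : K₀ ⊆ K') {η : LTwo H}
    (hη : ∀ᵐ t ∂(Measure.haar : Measure H), t ∉ K₀ → η t = 0) (ξ : LTwo H) :
    ‖d.form φ ξ η - d'.form φ ξ η‖ ≤ C * (ε + ε') * ‖ξ‖ * ‖η‖ := by
  refine h.norm_stepForm_sub_le hφ hπ.inv d.meas d.disj d'.meas d'.disj
    (fun _ => continuous_comp_mul_left hf _) (fun _ => hasCompactSupport_comp_mul_left hfs _)
    (fun _ => continuous_comp_mul_left hf _) (fun _ => hasCompactSupport_comp_mul_left hfs _)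
    (add_nonneg hε hε') (fun i j hij => ?_) (d.ae_cover hK hη) (d'.ae_cover hK' hη) ξ
  obtain ⟨s, hs, hs'⟩ := hij
  refine le_trans ?_ (add_le_add (d.small i s hs) (d'.small j s hs'))
  rw [← integral_add (integrable_abs_translate_sub hf hfs _ _)
    (integrable_abs_translate_sub hf hfs _ _)]
  refine integral_mono (integrable_abs_translate_sub hf hfs _ _)
    ((integrable_abs_translate_sub hf hfs _ _).add (integrable_abs_translate_sub hf hfs _ _))
    fun y => ?_
  rw [abs_sub_comm (f (d'.g j * y)) (f (π s * y))]
  exact abs_sub_le _ _ _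

/-- This identity dictates the choice of weights: with the exact weight at `s` the variable `s`
cancels under `y ↦ π(s)y`, leaving the symbol at `g`. -/
theorem averaged_translate (π : H →* G) (f : G → ℝ) (φ : G → ℂ) (g s : H) :
    averaged φ (fun t => (π t)⁻¹) (fun y => f (π s * y)) (g⁻¹ * s) =
      groupConvolution f φ (π g) := by
  rw [averaged, groupConvolution,
    ← integral_mul_left_eq_self (fun y => (f y : ℂ) * φ (y⁻¹ * π g)) (π s)]
  refine integral_congr_ae (Eventually.of_forall fun y => ?_)
  simp [mul_assoc]

theorem StepData.norm_form_leftRegular_sub_le {π : H →* G} (d : StepData π f K ε) (hε : 0 ≤ ε)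
    (h : SchurBound φ C) (hφ : Continuous φ) (hπ : Continuous π) (hf : Continuous f)
    (hfs : HasCompactSupport f) {K₀ : Set H} (hK : K₀ ⊆ K) {η : LTwo H}
    (hη : ∀ᵐ t ∂(Measure.haar : Measure H), t ∉ K₀ → η t = 0) (ξ : LTwo H) (g : H) :
    ‖d.form φ ξ η (leftRegular g) -
      groupConvolution f φ (π g) * inner ℂ η (leftRegular g ξ)‖ ≤ C * ε * ‖ξ‖ * ‖η‖ := by
  refine h.norm_stepForm_leftRegular_sub_le hφ hπ.inv d.meas d.disj
    (fun _ => continuous_comp_mul_left hf _) (fun _ => hasCompactSupport_comp_mul_left hfs _)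
    (mul_nonneg h.1 hε) (fun i s hs => ?_) (d.ae_cover hK hη) ξ
  have hc : ∀ v : G, Continuous fun y => f (v * y) := continuous_comp_mul_left hf
  have hcs : ∀ v : G, HasCompactSupport fun y => f (v * y) := hasCompactSupport_comp_mul_left hfs
  have h1 : averaged φ (fun t => (π t)⁻¹) (fun y => f (d.g i * y)) (g⁻¹ * s) -
      groupConvolution f φ (π g) = averaged φ (fun t => (π t)⁻¹)
        ((fun y => f (d.g i * y)) - fun y => f (π s * y)) (g⁻¹ * s) := by
    rw [averaged_sub hφ _ (hc _) (hcs _) (hc _) (hcs _), Pi.sub_apply, averaged_translate]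
  change ‖averaged φ (fun t => (π t)⁻¹) (fun y => f (d.g i * y)) (g⁻¹ * s) -
    groupConvolution f φ (π g)‖ ≤ _
  rw [h1]
  refine (norm_integral_mul_le ((hc _).sub (hc _)) ((hcs _).sub (hcs _)) fun _ =>
    h.norm_le _).trans ?_
  exact mul_le_mul_of_nonneg_left (d.small i s hs) h.1

end StepData

/-! ### Passing to the limit along compact sets and mesh sizes. -/

section Limit

open Filter Topology

variable {G : Type*} [Group G] [TopologicalSpace G] [IsTopologicalGroup G] [LocallyCompactSpace G]
  [MeasurableSpace G] [BorelSpace G]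
  {H : Type*} [Group H] [TopologicalSpace H] [IsTopologicalGroup H] [LocallyCompactSpace H]
  [MeasurableSpace H] [BorelSpace H] {π : H →* G} {f : G → ℝ} {φ : G → ℂ} {C : ℝ}

theorem norm_add_sub_le_of_le {V : Type*} [NormedAddCommGroup V] {a b c : V} {r s t : ℝ}
    (ha : ‖a‖ ≤ r) (hb : ‖b‖ ≤ s) (hc : ‖c‖ ≤ t) : ‖a + b - c‖ ≤ r + s + t :=
  (norm_sub_le _ _).trans (add_le_add ((norm_add_le _ _).trans (add_le_add ha hb)) hc)

theorem norm_le_of_tendsto {V β : Type*} [NormedAddCommGroup V] {l : Filter β} [l.NeBot]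
    {u : β → V} {v : V} {r : ℝ} (h : Tendsto u l (𝓝 v)) (hr : ∀ p, ‖u p‖ ≤ r) : ‖v‖ ≤ r :=
  le_of_tendsto h.norm (Eventually.of_forall hr)

/-- A general `η` is split as `η'` plus a remainder. Partition estimates apply to the compactly
carried `η'`, the uniform norm bound to the remainder, once for each form. -/
theorem StepData.norm_form_sub_form_le {K K' : Set H} {ε ε' : ℝ} (d : StepData π f K ε)
    (d' : StepData π f K' ε') (hε : 0 ≤ ε) (hε' : 0 ≤ ε')
    (h : SchurBound φ C) (hφ : Continuous φ) (hπ : Continuous π) (hf : Continuous f)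
    (hfs : HasCompactSupport f) {K₀ : Set H} (hK : K₀ ⊆ K) (hK' : K₀ ⊆ K') {η' : LTwo H}
    (hη : ∀ᵐ t ∂(Measure.haar : Measure H), t ∉ K₀ → η' t = 0) (ξ η : LTwo H) :
    ‖d.form φ ξ η - d'.form φ ξ η‖ ≤ C * (ε + ε') * ‖ξ‖ * ‖η'‖ +
      2 * (C * (∫ y, |f y| ∂(Measure.haar : Measure G)) * ‖ξ‖ * ‖η - η'‖) := by
  have h1 := d.norm_form_sub_le d' hε hε' h hφ hπ hf hfs hK hK' hη ξ
  have h2 := d.norm_form_le h hφ hπ hf hfs ξ (η - η')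
  have h3 := d'.norm_form_le h hφ hπ hf hfs ξ (η - η')
  have h4 : d.form φ ξ η - d'.form φ ξ η =
      (d.form φ ξ η' - d'.form φ ξ η') + d.form φ ξ (η - η') - d'.form φ ξ (η - η') := by
    have e1 : d.form φ ξ (η' + (η - η')) = _ := stepForm_add_right _ _ _ ξ η' (η - η')
    have e2 : d'.form φ ξ (η' + (η - η')) = _ := stepForm_add_right _ _ _ ξ η' (η - η')
    rw [add_sub_cancel] at e1 e2
    rw [e1, e2]
    simp only [StepData.form]
    abel
  rw [h4]
  refine (norm_add_sub_le_of_le (V := StrongDual ℂ (LTwo H →L[ℂ] LTwo H)) h1 h2 h3).trans ?_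
  linarith

theorem StepData.norm_form_leftRegular_le {K : Set H} {ε : ℝ} (d : StepData π f K ε)
    (hε : 0 ≤ ε) (h : SchurBound φ C) (hφ : Continuous φ) (hπ : Continuous π) (hf : Continuous f)
    (hfs : HasCompactSupport f) {K₀ : Set H} (hK : K₀ ⊆ K) {η' : LTwo H}
    (hη : ∀ᵐ t ∂(Measure.haar : Measure H), t ∉ K₀ → η' t = 0) (ξ η : LTwo H) (g : H) :
    ‖d.form φ ξ η (leftRegular g) - groupConvolution f φ (π g) * inner ℂ η (leftRegular g ξ)‖ ≤
      C * ε * ‖ξ‖ * ‖η'‖ +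
      2 * (C * (∫ y, |f y| ∂(Measure.haar : Measure G)) * ‖ξ‖ * ‖η - η'‖) := by
  have h1 := d.norm_form_leftRegular_sub_le hε h hφ hπ hf hfs hK hη ξ g
  have h2 : ‖d.form φ ξ (η - η') (leftRegular g)‖ ≤
      C * (∫ y, |f y| ∂(Measure.haar : Measure G)) * ‖ξ‖ * ‖η - η'‖ := by
    have e1 : ‖leftRegular g‖ ≤ 1 := ContinuousLinearMap.opNorm_le_bound _ zero_le_one fun v => by
      rw [norm_leftRegular_apply, one_mul]
    have e2 := d.norm_form_le h hφ hπ hf hfs ξ (η - η')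
    have e3 := ContinuousLinearMap.le_of_opNorm_le (d.form φ ξ (η - η')) e2 (leftRegular g)
    refine e3.trans (mul_le_of_le_one_right ?_ e1)
    exact mul_nonneg (mul_nonneg (mul_nonneg h.1 (integral_nonneg fun _ => abs_nonneg _))
      (norm_nonneg _)) (norm_nonneg _)
  have h3 : ‖groupConvolution f φ (π g) * inner ℂ (η - η') (leftRegular g ξ)‖ ≤
      C * (∫ y, |f y| ∂(Measure.haar : Measure G)) * ‖ξ‖ * ‖η - η'‖ := by
    have e1 : ‖groupConvolution f φ (π g)‖ ≤ C * (∫ y, |f y| ∂(Measure.haar : Measure G)) :=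
      norm_integral_mul_le hf hfs fun _ => h.norm_le _
    have e2 : ‖inner ℂ (η - η') (leftRegular g ξ)‖ ≤ ‖η - η'‖ * ‖ξ‖ := by
      refine (norm_inner_le_norm _ _).trans ?_
      rw [norm_leftRegular_apply]
    rw [norm_mul]
    calc _ ≤ C * (∫ y, |f y| ∂(Measure.haar : Measure G)) * (‖η - η'‖ * ‖ξ‖) :=
          mul_le_mul e1 e2 (norm_nonneg _) ((norm_nonneg _).trans e1)
      _ = _ := by ring
  have h4 : d.form φ ξ η (leftRegular g) -
      groupConvolution f φ (π g) * inner ℂ η (leftRegular g ξ) =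
      (d.form φ ξ η' (leftRegular g) -
        groupConvolution f φ (π g) * inner ℂ η' (leftRegular g ξ)) +
      d.form φ ξ (η - η') (leftRegular g) -
        groupConvolution f φ (π g) * inner ℂ (η - η') (leftRegular g ξ) := by
    have e1 : d.form φ ξ (η' + (η - η')) = _ := stepForm_add_right _ _ _ ξ η' (η - η')
    rw [add_sub_cancel] at e1
    rw [e1, add_apply, inner_sub_left]
    simp only [StepData.form]
    ring
  rw [h4]
  refine (norm_sub_le _ _).trans ?_
  have h5 := norm_add_le (d.form φ ξ η' (leftRegular g) -
        groupConvolution f φ (π g) * inner ℂ η' (leftRegular g ξ))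
      (d.form φ ξ (η - η') (leftRegular g))
  linarith

theorem exists_tendsto_of_norm_sub_le {V β : Type*} [NormedAddCommGroup V] [CompleteSpace V]
    [Nonempty β] [SemilatticeSup β] {u : β → V}
    (h : ∀ δ > 0, ∃ P, ∀ p ≥ P, ∀ q ≥ P, ‖u p - u q‖ ≤ δ) : ∃ v, Tendsto u atTop (𝓝 v) := by
  refine cauchySeq_tendsto_of_complete (Metric.cauchySeq_iff (β := β) (u := u) |>.2 fun δ hδ => ?_)
  obtain ⟨P, hP⟩ := h (δ / 2) (half_pos hδ)
  refine ⟨P, fun p hp q hq => ?_⟩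
  rw [dist_eq_norm]
  exact (hP p hp q hq).trans_lt (half_lt_self hδ)

theorem exists_approximation (h : SchurBound φ C) (f : G → ℝ) (ξ η : LTwo H) {δ : ℝ}
    (hδ : 0 < δ) :
    ∃ (P : TopologicalSpace.Compacts H × ℕ) (η' : LTwo H) (K₀ : Set H),
      (∀ᵐ t ∂(Measure.haar : Measure H), t ∉ K₀ → η' t = 0) ∧ K₀ ⊆ P.1 ∧
      C * (1 / (P.2 + 1 : ℝ) + 1 / (P.2 + 1 : ℝ)) * ‖ξ‖ * ‖η'‖ +
      2 * (C * (∫ y, |f y| ∂(Measure.haar : Measure G)) * ‖ξ‖ * ‖η - η'‖) ≤ δ := by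
  have hC := h.1
  set D := ∫ y, |f y| ∂(Measure.haar : Measure G) with hD
  have hD0 : 0 ≤ D := integral_nonneg fun y => abs_nonneg _
  have hpos : 0 < 4 * (C * D * ‖ξ‖ + 1) := by positivity
  -- This accuracy bounds the remainder term by `δ / 2`; the integer `m` then makes the mesh term at
  -- most `δ / 2`, and must be chosen after `η'`.
  obtain ⟨η', K, hK, hηη', hη'⟩ := exists_compact_support_approx η (div_pos hδ hpos)
  obtain ⟨m, hm⟩ := exists_nat_gt (4 * (C * ‖ξ‖ * ‖η'‖) / δ)
  refine ⟨(⟨K, hK⟩, m), η', K, hη', subset_rfl, ?_⟩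
  have h1 : 2 * (C * D * ‖ξ‖ * ‖η - η'‖) ≤ δ / 2 := by
    have h2 := mul_le_mul_of_nonneg_left hηη' (show 0 ≤ C * D * ‖ξ‖ by positivity)
    have h3 : C * D * ‖ξ‖ * (δ / (4 * (C * D * ‖ξ‖ + 1))) ≤ δ / 4 := by
      rw [mul_div_assoc', div_le_iff₀ hpos]
      nlinarith
    linarith
  have h4 : C * (1 / (m + 1 : ℝ) + 1 / (m + 1 : ℝ)) * ‖ξ‖ * ‖η'‖ ≤ δ / 2 := by
    have h5 : (0 : ℝ) < m + 1 := by positivity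
    have h6 : C * (1 / (m + 1 : ℝ) + 1 / (m + 1 : ℝ)) * ‖ξ‖ * ‖η'‖ =
        2 * (C * ‖ξ‖ * ‖η'‖) / (m + 1) := by ring
    rw [h6, div_le_iff₀ h5]
    rw [div_lt_iff₀ hδ] at hm
    nlinarith
  change C * (1 / (m + 1 : ℝ) + 1 / (m + 1 : ℝ)) * ‖ξ‖ * ‖η'‖ + _ ≤ δ
  linarith

theorem SchurBound.exists_isMultiplierForm (h : SchurBound φ C) (hφ : Continuous φ)
    (hπ : Continuous π) (hf : Continuous f) (hfs : HasCompactSupport f) :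
    ∃ Ω, IsMultiplierForm (fun x => groupConvolution f φ (π x))
      (C * ∫ y, |f y| ∂(Measure.haar : Measure G)) Ω := by
  have hC := h.1
  have hpos : ∀ m : ℕ, (0 : ℝ) < 1 / (m + 1) := fun m => Nat.one_div_pos_of_nat
  have hd : ∀ p : TopologicalSpace.Compacts H × ℕ,
      Nonempty (StepData π f (p.1 : Set H) (1 / (p.2 + 1 : ℝ))) := fun p =>
    nonempty_stepData hπ hf hfs p.1.isCompact (hpos p.2)
  -- Arbitrary choices are harmless: any two partitions fine enough over a large compact set give
  -- close forms, so the net indexed by pairs of a compact set and an integer is Cauchy.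
  let d := fun p => (hd p).some
  have hmono : ∀ {P p : TopologicalSpace.Compacts H × ℕ}, P ≤ p →
      (P.1 : Set H) ⊆ p.1 ∧ 1 / (p.2 + 1 : ℝ) ≤ 1 / (P.2 + 1 : ℝ) := fun {P p} hp =>
    ⟨hp.1, Nat.one_div_le_one_div hp.2⟩
  have hlim : ∀ ξ η, ∃ Ω, Tendsto (fun p => (d p).form φ ξ η) atTop (𝓝 Ω) := fun ξ η => by
    refine exists_tendsto_of_norm_sub_le (V := StrongDual ℂ (LTwo H →L[ℂ] LTwo H))
      fun δ hδ => ?_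
    obtain ⟨P, η', K₀, hη', hK₀, hle⟩ := exists_approximation h f ξ η hδ
    refine ⟨P, fun p hp q hq => le_trans ((d p).norm_form_sub_form_le (d q) (hpos _).le (hpos _).le
      h hφ hπ hf hfs (hK₀.trans (hmono hp).1) (hK₀.trans (hmono hq).1) hη' ξ η)
      (le_trans ?_ hle)⟩
    have h1 := (hmono hp).2
    have h2 := (hmono hq).2
    gcongr
  choose Ω hΩ using hlim
  have happ : ∀ ξ η x, Tendsto (fun p => (d p).form φ ξ η x) atTop (𝓝 (Ω ξ η x)) :=
    fun ξ η x => ((ContinuousLinearMap.apply ℂ ℂ x).continuous.tendsto (Ω ξ η)).comp (hΩ ξ η)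
  refine ⟨Ω, ⟨mul_nonneg hC (integral_nonneg fun _ => abs_nonneg _), fun ξ ξ' η => ?_,
    fun c ξ η => ?_, fun ξ η η' => ?_, fun c ξ η => ?_, fun ξ η => ?_, fun ξ η => ?_,
    fun n a v w => ?_, fun g ξ η => ?_⟩⟩
  · refine tendsto_nhds_unique (hΩ _ _) (((hΩ ξ η).add (hΩ ξ' η)).congr fun p => ?_)
    exact (stepForm_add_left _ _ _ ξ ξ' η).symm
  · refine tendsto_nhds_unique (hΩ _ _) (((hΩ ξ η).const_smul c).congr fun p => ?_)
    exact (stepForm_smul_left _ _ _ c ξ η).symm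
  · refine tendsto_nhds_unique (hΩ _ _) (((hΩ ξ η).add (hΩ ξ η')).congr fun p => ?_)
    exact (stepForm_add_right _ _ _ ξ η η').symm
  · refine tendsto_nhds_unique (hΩ _ _)
      (((hΩ ξ η).const_smul (starRingEnd ℂ c)).congr fun p => ?_)
    exact (stepForm_smul_right _ _ _ c ξ η).symm
  · have hc : IsClosed (normalFunctionals (LTwo H) : Set (StrongDual ℂ (LTwo H →L[ℂ] LTwo H))) :=
      Submodule.isClosed_topologicalClosure _
    exact hc.mem_of_tendsto (hΩ ξ η) (Eventually.of_forall fun p => stepForm_mem _ _ _ ξ η)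
  · exact norm_le_of_tendsto (V := StrongDual ℂ (LTwo H →L[ℂ] LTwo H)) (hΩ ξ η)
      fun p => (d p).norm_form_le h hφ hπ hf hfs ξ η
  · refine le_of_tendsto (tendsto_finsetSum _ fun p _ => tendsto_finsetSum _ fun q _ =>
      happ (v q) (w p) (a p q)).norm (Eventually.of_forall fun i => ?_)
    exact (d i).bound h hφ hπ hf hfs n a v w
  · refine tendsto_nhds_unique (happ ξ η (leftRegular g)) ?_
    refine Metric.tendsto_atTop.2 fun δ hδ => ?_
    obtain ⟨P, η', K₀, hη', hK₀, hle⟩ := exists_approximation h f ξ η (half_pos hδ)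
    refine ⟨P, fun p hp => ?_⟩
    rw [dist_eq_norm]
    refine lt_of_le_of_lt (le_trans ((d p).norm_form_leftRegular_le (hpos _).le h hφ hπ hf hfs
      (hK₀.trans (hmono hp).1) hη' ξ η g) (le_trans ?_ hle)) (half_lt_self hδ)
    have h1 := (hmono hp).2
    have h2 : 1 / (p.2 + 1 : ℝ) ≤ 1 / (P.2 + 1 : ℝ) + 1 / (P.2 + 1 : ℝ) := by
      linarith [hpos P.2]
    gcongr

/-- The smoothing of a Schur multiplier of `G`, restricted to `H`, is a completely bounded
multiplier. -/
theorem SchurBound.exists_isMultiplierMap (h : SchurBound φ C) (hφ : Continuous φ)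
    (hπ : Continuous π) (hf : Continuous f) (hfs : HasCompactSupport f) :
    ∃ M, IsMultiplierMap (fun x => groupConvolution f φ (π x)) M ∧
      IsCBBound M (C * ∫ y, |f y| ∂(Measure.haar : Measure G)) := by
  obtain ⟨Ω, hΩ⟩ := h.exists_isMultiplierForm hφ hπ hf hfs
  exact hΩ.exists_isMultiplierMap

end Limit

/-! ### Uniqueness of the Haar integral for functionals, the modular function and inversion. -/

section HaarFunctional

open Filter Topology Pointwise CompactlySupported

variable {G : Type*} [Group G] [TopologicalSpace G] [IsTopologicalGroup G] [LocallyCompactSpace G]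
  [MeasurableSpace G] [BorelSpace G]

/-- Uniqueness of the Haar integral among positive left invariant functionals. -/
theorem exists_eq_const_mul_integral_of_nonneg [T2Space G] {Λ : (G → ℝ) → ℝ}
    (hadd : ∀ f g : G → ℝ, Continuous f → HasCompactSupport f → Continuous g →
      HasCompactSupport g → Λ (f + g) = Λ f + Λ g)
    (hsmul : ∀ (c : ℝ) (f : G → ℝ), Continuous f → HasCompactSupport f → Λ (c • f) = c * Λ f)
    (hnonneg : ∀ f : G → ℝ, Continuous f → HasCompactSupport f → (∀ x, 0 ≤ f x) → 0 ≤ Λ f)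
    (hinv : ∀ (g : G) (f : G → ℝ), Continuous f → HasCompactSupport f →
      Λ (fun x => f (g * x)) = Λ f) :
    ∃ c : ℝ, ∀ f : G → ℝ, Continuous f → HasCompactSupport f →
      Λ f = c * ∫ x, f x ∂(Measure.haar : Measure G) := by
  let Λ' : C_c(G, ℝ) →ₚ[ℝ] ℝ := PositiveLinearMap.mk₀
    { toFun := fun f => Λ f
      map_add' := fun f g => hadd f g f.continuous f.hasCompactSupport g.continuous
        g.hasCompactSupport
      map_smul' := fun c f => hsmul c f f.continuous f.hasCompactSupport }
    fun f hf => hnonneg f f.continuous f.hasCompactSupport fun x => hf x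
  -- The Riesz–Markov measure is regular, and invariance of the functional makes it left invariant,
  -- so it can be compared with Haar measure.
  let ρ := RealRMK.rieszMeasure Λ'
  have hρ : ∀ f : G → ℝ, Continuous f → HasCompactSupport f → ∫ x, f x ∂ρ = Λ f :=
    fun f hf hfs => RealRMK.integral_rieszMeasure Λ' ⟨⟨f, hf⟩, hfs⟩
  have hρr : ρ.Regular := inferInstanceAs (RealRMK.rieszMeasure Λ').Regular
  have hinvρ : ρ.IsMulLeftInvariant := by
    refine ⟨fun g => ?_⟩
    have : (Measure.map (g * ·) ρ).Regular := Measure.Regular.map (Homeomorph.mulLeft g)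
    refine Measure.ext_of_integral_eq_on_compactlySupported fun f => ?_
    have h1 : ∫ x, f x ∂(Measure.map (g * ·) ρ) = ∫ x, f (g * x) ∂ρ :=
      (Homeomorph.mulLeft g).measurableEmbedding.integral_map _
    have hfc : Continuous fun x => f x := f.continuous
    have hfs : HasCompactSupport fun x => f x := f.hasCompactSupport
    exact h1.trans ((hρ _ (continuous_comp_mul_left hfc g)
      (hasCompactSupport_comp_mul_left hfs g)).trans
      ((hinv g _ hfc hfs).trans (hρ _ hfc hfs).symm))
  refine ⟨Measure.haarScalarFactor ρ Measure.haar, fun f hf hfs => ?_⟩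
  rw [← hρ f hf hfs, Measure.integral_isMulLeftInvariant_eq_smul_of_hasCompactSupport ρ
    Measure.haar hf hfs, integral_smul_nnreal_measure]
  rfl

/-- Uniqueness of the Haar integral among left invariant functionals that are continuous for the
`L¹` norm. -/
theorem exists_eq_const_mul_integral_of_norm_le [T2Space G] {Λ : (G → ℝ) → ℂ}
    (hadd : ∀ f g : G → ℝ, Continuous f → HasCompactSupport f → Continuous g →
      HasCompactSupport g → Λ (f + g) = Λ f + Λ g)
    (hsmul : ∀ (c : ℝ) (f : G → ℝ), Continuous f → HasCompactSupport f → Λ (c • f) = c * Λ f)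
    {B : ℝ} (hnorm : ∀ f : G → ℝ, Continuous f → HasCompactSupport f →
      ‖Λ f‖ ≤ B * ∫ x, |f x| ∂(Measure.haar : Measure G))
    (hinv : ∀ (g : G) (f : G → ℝ), Continuous f → HasCompactSupport f →
      Λ (fun x => f (g * x)) = Λ f) :
    ∃ c : ℂ, ∀ f : G → ℝ, Continuous f → HasCompactSupport f →
      Λ f = c * ∫ x, f x ∂(Measure.haar : Measure G) := by
  -- Adding `B ∫ f` to a real part of `Λ` makes it positive, by the norm bound, and keeps
  -- invariance. The positive case applies and `B` is subtracted again; real and imaginary parts are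
  -- then recombined.
  have key : ∀ r : ℂ →ₗ[ℝ] ℝ, (∀ z, |r z| ≤ ‖z‖) → ∃ c : ℝ, ∀ f : G → ℝ, Continuous f →
      HasCompactSupport f → r (Λ f) = c * ∫ x, f x ∂(Measure.haar : Measure G) := by
    intro r hr
    obtain ⟨c, hc⟩ := exists_eq_const_mul_integral_of_nonneg
      (Λ := fun f => B * (∫ x, f x ∂(Measure.haar : Measure G)) + r (Λ f))
      (fun f g hf hfs hg hgs => by
        simp only [Pi.add_apply]
        rw [integral_add (hf.integrable_of_hasCompactSupport hfs)
          (hg.integrable_of_hasCompactSupport hgs), hadd f g hf hfs hg hgs, map_add]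
        ring)
      (fun c f hf hfs => by
        simp only [Pi.smul_apply, smul_eq_mul]
        rw [integral_const_mul, hsmul c f hf hfs, ← Complex.real_smul, map_smul, smul_eq_mul]
        ring)
      (fun f hf hfs h0 => by
        have h1 := (hr _).trans (hnorm f hf hfs)
        simp_rw [fun x => abs_of_nonneg (h0 x)] at h1
        linarith [neg_abs_le (r (Λ f))])
      (fun g f hf hfs => by
        rw [hinv g f hf hfs, integral_mul_left_eq_self (fun x => f x) g])
    refine ⟨c - B, fun f hf hfs => ?_⟩
    have := hc f hf hfs
    linear_combination this
  obtain ⟨c, hc⟩ := key Complex.reLm Complex.abs_re_le_norm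
  obtain ⟨d, hd⟩ := key Complex.imLm Complex.abs_im_le_norm
  refine ⟨c + d * Complex.I, fun f hf hfs => ?_⟩
  have h1 := hc f hf hfs
  have h2 := hd f hf hfs
  simp only [Complex.reLm_coe, Complex.imLm_coe] at h1 h2
  apply Complex.ext <;> simp [h1, h2]

/-- The modulus of right translations, `∫ h(yg) dy = m(g) ∫ h(y) dy`. -/
noncomputable def rightModulus (g : G) : ℝ := (Measure.modularCharacterFun g : ℝ)

theorem rightModulus_pos (g : G) : 0 < rightModulus g := Measure.modularCharacterFun_pos g

theorem rightModulus_mul (g h : G) : rightModulus (g * h) = rightModulus g * rightModulus h := by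
  simp [rightModulus, Measure.modularCharacterFun_map_mul]

theorem rightModulus_mul_inv (g : G) : rightModulus g * rightModulus g⁻¹ = 1 := by
  rw [← rightModulus_mul, mul_inv_cancel]
  simp [rightModulus, Measure.modularCharacterFun_map_one]

theorem modularFunction_inv (g : G) : modularFunction g⁻¹ = rightModulus g := by
  rw [modularFunction, inv_inv, rightModulus]

theorem integral_mul_right_eq_rightModulus_mul {E : Type*} [NormedAddCommGroup E]
    [NormedSpace ℝ E] (h : G → E) (g : G) :
    ∫ y, h (y * g) ∂(Measure.haar : Measure G) =
      rightModulus g • ∫ y, h y ∂(Measure.haar : Measure G) := by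
  have : (Measure.map (· * g) (Measure.haar : Measure G)).Regular :=
    Measure.Regular.map (Homeomorph.mulRight g)
  have h1 : Measure.map (· * g) (Measure.haar : Measure G) =
      Measure.modularCharacterFun g • (Measure.haar : Measure G) := by
    rw [Measure.modularCharacterFun_eq_haarScalarFactor Measure.haar g]
    exact Measure.isMulLeftInvariant_eq_smul_of_regular _ _
  have h2 : MeasurableEmbedding fun y : G => y * g :=
    (Homeomorph.mulRight g).measurableEmbedding
  rw [← h2.integral_map h, h1, integral_smul_nnreal_measure]
  rfl

theorem continuous_integral_mul_right {h : G → ℝ} (hh : Continuous h) (hhs : HasCompactSupport h) :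
    Continuous fun g => ∫ y, h (y * g) ∂(Measure.haar : Measure G) := by
  refine continuous_iff_continuousAt.2 fun g₀ => ?_
  obtain ⟨V, hV, hVn⟩ := exists_compact_mem_nhds g₀
  have h1 : ContinuousOn (fun g => ∫ y, h (y * g) ∂(Measure.haar : Measure G)) V := by
    refine continuousOn_integral_of_compact_support (hhs.mul hV.inv) ?_ fun v y hv hy => ?_
    · refine Continuous.continuousOn ?_
      unfold Function.uncurry
      fun_prop
    · refine image_eq_zero_of_notMem_tsupport fun h => hy ?_
      exact ⟨y * v, h, v⁻¹, Set.inv_mem_inv.2 hv, by simp⟩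
  exact h1.continuousAt hVn

theorem exists_continuous_integral_pos :
    ∃ h : G → ℝ, Continuous h ∧ HasCompactSupport h ∧ (∀ x, 0 ≤ h x) ∧
      0 < ∫ x, h x ∂(Measure.haar : Measure G) := by
  obtain ⟨⟨f, hf⟩, hfs, hf0, hf1⟩ : ∃ f : C(G, ℝ), HasCompactSupport f ∧ 0 ≤ f ∧ f 1 ≠ 0 :=
    exists_continuous_nonneg_pos 1
  exact ⟨f, hf, hfs, hf0, hf.integral_pos_of_hasCompactSupport_nonneg_nonzero hfs hf0 hf1⟩

theorem continuous_rightModulus : Continuous (rightModulus : G → ℝ) := by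
  obtain ⟨h, hh, hhs, -, hpos⟩ := exists_continuous_integral_pos (G := G)
  have h1 : (rightModulus : G → ℝ) = fun g => (∫ y, h (y * g) ∂(Measure.haar : Measure G)) /
      ∫ y, h y ∂(Measure.haar : Measure G) := by
    ext g
    rw [integral_mul_right_eq_rightModulus_mul, smul_eq_mul, mul_div_cancel_right₀ _ hpos.ne']
  rw [h1]
  exact (continuous_integral_mul_right hh hhs).div_const _

/-- The left side is a positive functional, and the modulus is exactly the factor that makes it left
invariant. The value of `c` plays no role later. -/
theorem exists_integral_inv_eq_real [T2Space G] :
    ∃ c : ℝ, ∀ F : G → ℝ, Continuous F → HasCompactSupport F →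
      ∫ y, F y⁻¹ * rightModulus y ∂(Measure.haar : Measure G) =
        c * ∫ y, F y ∂(Measure.haar : Measure G) := by
  have hint : ∀ F : G → ℝ, Continuous F → HasCompactSupport F →
      Integrable (fun y => F y⁻¹ * rightModulus y) (Measure.haar : Measure G) := fun F hF hFs =>
    ((hF.comp continuous_inv).mul continuous_rightModulus).integrable_of_hasCompactSupport
      (HasCompactSupport.mul_right (hFs.comp_homeomorph (Homeomorph.inv G)))
  refine exists_eq_const_mul_integral_of_nonneg (fun f g hf hfs hg hgs => ?_)
    (fun c f hf hfs => ?_) (fun f hf hfs h0 => ?_) fun g f hf hfs => ?_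
  · rw [← integral_add (hint f hf hfs) (hint g hg hgs)]
    simp [add_mul]
  · rw [← integral_const_mul]
    simp [mul_assoc]
  · exact integral_nonneg fun y => mul_nonneg (h0 _) (rightModulus_pos y).le
  · have h1 := integral_mul_right_eq_rightModulus_mul
      (fun y => f y⁻¹ * rightModulus y) g⁻¹
    have h2 : ∀ y, f (y * g⁻¹)⁻¹ * rightModulus (y * g⁻¹) =
        rightModulus g⁻¹ * (f (g * y⁻¹) * rightModulus y) := fun y => by
      rw [rightModulus_mul, mul_inv_rev, inv_inv]
      ring
    simp_rw [h2] at h1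
    rw [integral_const_mul, smul_eq_mul] at h1
    exact mul_left_cancel₀ (rightModulus_pos g⁻¹).ne' h1

theorem exists_integral_inv_eq [T2Space G] :
    ∃ c : ℝ, ∀ F : G → ℂ, Continuous F → HasCompactSupport F →
      ∫ y, F y⁻¹ * rightModulus y ∂(Measure.haar : Measure G) =
        c * ∫ y, F y ∂(Measure.haar : Measure G) := by
  obtain ⟨c, hc⟩ := exists_integral_inv_eq_real (G := G)
  refine ⟨c, fun F hF hFs => ?_⟩
  have hi : Integrable F (Measure.haar : Measure G) := hF.integrable_of_hasCompactSupport hFs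
  have hi' : Integrable (fun y => F y⁻¹ * rightModulus y) (Measure.haar : Measure G) :=
    ((hF.comp continuous_inv).mul
      (Complex.continuous_ofReal.comp continuous_rightModulus)).integrable_of_hasCompactSupport
      (HasCompactSupport.mul_right (hFs.comp_homeomorph (Homeomorph.inv G)))
  have hre := hc (fun y => (F y).re) (Complex.continuous_re.comp hF) (hFs.comp_left Complex.zero_re)
  have him := hc (fun y => (F y).im) (Complex.continuous_im.comp hF) (hFs.comp_left Complex.zero_im)
  have e1 := integral_re (𝕜 := ℂ) hi
  have e2 := integral_im (𝕜 := ℂ) hi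
  have e3 := integral_re (𝕜 := ℂ) hi'
  have e4 := integral_im (𝕜 := ℂ) hi'
  simp only [RCLike.re_to_complex, RCLike.im_to_complex, Complex.re_mul_ofReal,
    Complex.im_mul_ofReal] at e1 e2 e3 e4
  apply Complex.ext
  · rw [Complex.re_ofReal_mul, ← e1, ← e3, hre]
  · rw [Complex.im_ofReal_mul, ← e2, ← e4, him]

/-- Take a nonnegative bump `f`, symmetrise to `f + f*` and divide by the integral. -/
theorem exists_isSmoothingFunction : ∃ u : G → ℝ, IsSmoothingFunction u := by
  obtain ⟨f, hf, hfs, hf0, hpos⟩ := exists_continuous_integral_pos (G := G)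
  let f' : G → ℝ := fun x => rightModulus x * f x⁻¹
  have hf' : Continuous f' := continuous_rightModulus.mul (hf.comp continuous_inv)
  have hfs' : HasCompactSupport f' :=
    HasCompactSupport.mul_left (hfs.comp_homeomorph (Homeomorph.inv G))
  have hf0' : ∀ x, 0 ≤ f' x := fun x => mul_nonneg (rightModulus_pos x).le (hf0 _)
  set I := ∫ x, (f x + f' x) ∂(Measure.haar : Measure G) with hI
  have hIpos : 0 < I := by
    rw [hI, integral_add (hf.integrable_of_hasCompactSupport hfs)
      (hf'.integrable_of_hasCompactSupport hfs')]
    exact add_pos_of_pos_of_nonneg hpos (integral_nonneg hf0')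
  refine ⟨fun x => (f x + f' x) / I, (hf.add hf').div_const _, ?_, fun x => ?_, ?_, fun x => ?_⟩
  · have := (hfs.add hfs').mul_right (f' := fun _ => I⁻¹)
    exact this
  · exact div_nonneg (add_nonneg (hf0 x) (hf0' x)) hIpos.le
  · rw [integral_div, ← hI, div_self hIpos.ne']
  · rw [modularFunction_inv]
    simp only [f', inv_inv]
    have := rightModulus_mul_inv x
    field_simp
    linear_combination (-f x) * this

end HaarFunctional

/-! ### The map `T`: contractivity, invariance of means and weak* continuity. -/

section Smoothing

open Filter Topology Pointwise

variable {G : Type*} [Group G] [TopologicalSpace G] [IsTopologicalGroup G] [LocallyCompactSpace G]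
  [MeasurableSpace G] [BorelSpace G]
  {H : Type*} [Group H] [TopologicalSpace H] [IsTopologicalGroup H] [LocallyCompactSpace H]
  [MeasurableSpace H] [BorelSpace H] {π : H →* G}

theorem groupConvolution_mem_M0A (hπ : Continuous π) {f : G → ℝ} (hf : Continuous f)
    (hfs : HasCompactSupport f) (φ : M0A G) :
    (fun x => groupConvolution f (φ : G → ℂ) (π x)) ∈ M0A H := by
  obtain ⟨C, hC⟩ := M0A.exists_schurBound φ
  obtain ⟨M, hM, hMC⟩ := hC.exists_isMultiplierMap (M0A.continuous φ) hπ hf hfs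
  exact ⟨M, hM, _, hMC⟩

theorem norm_groupConvolution_le {f : G → ℝ} (hf : Continuous f) (hfs : HasCompactSupport f)
    {φ : G → ℂ} {C : ℝ} (hφ : ∀ x, ‖φ x‖ ≤ C) (x : G) :
    ‖groupConvolution f φ x‖ ≤ C * ∫ y, |f y| ∂(Measure.haar : Measure G) :=
  norm_integral_mul_le hf hfs fun _ => hφ _

/-- The map `φ ↦ (f * φ) ∘ π` from multipliers of `G` to multipliers of `H`. -/
noncomputable def smoothing (hπ : Continuous π) {f : G → ℝ} (hf : Continuous f)
    (hfs : HasCompactSupport f) : M0A G →ₗ[ℂ] M0A H where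
  toFun φ := ⟨fun x => groupConvolution f (φ : G → ℂ) (π x), groupConvolution_mem_M0A hπ hf hfs φ⟩
  map_add' φ ψ := by
    ext x
    change groupConvolution f ((φ : G → ℂ) + (ψ : G → ℂ)) (π x) =
      groupConvolution f (φ : G → ℂ) (π x) + groupConvolution f (ψ : G → ℂ) (π x)
    rw [groupConvolution, groupConvolution, groupConvolution,
      ← integral_add (integrable_weight_mul (M0A.continuous φ) hf hfs _)
        (integrable_weight_mul (M0A.continuous ψ) hf hfs _)]
    simp [mul_add]
  map_smul' c φ := by
    ext x
    change groupConvolution f (c • (φ : G → ℂ)) (π x) = c * groupConvolution f (φ : G → ℂ) (π x)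
    rw [groupConvolution, groupConvolution, ← integral_const_mul]
    simp [mul_left_comm]

theorem smoothing_apply (hπ : Continuous π) {f : G → ℝ} (hf : Continuous f)
    (hfs : HasCompactSupport f) (φ : M0A G) (x : H) :
    (smoothing hπ hf hfs φ : H → ℂ) x = groupConvolution f (φ : G → ℂ) (π x) := rfl

theorem m0aNorm_smoothing_le (hπ : Continuous π) {f : G → ℝ} (hf : Continuous f)
    (hfs : HasCompactSupport f) {φ : M0A G} {C : ℝ} (hC : 0 ≤ C) (hφ : m0aNorm φ ≤ C) :
    m0aNorm (smoothing hπ hf hfs φ) ≤ C * ∫ y, |f y| ∂(Measure.haar : Measure G) := by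
  obtain ⟨M, hM, hMC⟩ := (schurBound_of_m0aNorm_le hC hφ).exists_isMultiplierMap
    (M0A.continuous φ) hπ hf hfs
  exact m0aNorm_le hM hMC

/-- With `v = π(h)` this turns a translate of the weight on `G` into a translate on `H`, to which
the mean on `H` is blind. -/
theorem groupConvolution_translate (f : G → ℝ) (φ : G → ℂ) (v x : G) :
    groupConvolution (fun y => f (v * y)) φ x = groupConvolution f φ (v * x) := by
  rw [groupConvolution, groupConvolution,
    ← integral_mul_left_eq_self (fun y => (f y : ℂ) * φ (y⁻¹ * (v * x))) v]
  simp [mul_assoc]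

/-- As a function of the weight `f`, the left side is linear, `L¹`-bounded by the uniform norm of
`φ`, and left invariant, so uniqueness of the Haar integral applies. -/
theorem exists_mean_smoothing_eq [T2Space G] (hπ : Continuous π) (hdense : DenseRange π)
    {m : M0A H →ₗ[ℂ] ℂ} (hm : IsLeftInvariantMean m) (φ : M0A G) :
    ∃ c : ℂ, ∀ (f : G → ℝ) (hf : Continuous f) (hfs : HasCompactSupport f),
      m (smoothing hπ hf hfs φ) = c * ∫ x, f x ∂(Measure.haar : Measure G) := by
  classical
  obtain ⟨C, hC⟩ := M0A.exists_schurBound φ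
  let Λ : (G → ℝ) → ℂ := fun f =>
    if h : Continuous f ∧ HasCompactSupport f then m (smoothing hπ h.1 h.2 φ) else 0
  have hΛ : ∀ (f : G → ℝ) (hf : Continuous f) (hfs : HasCompactSupport f),
      Λ f = m (smoothing hπ hf hfs φ) := fun f hf hfs => dif_pos ⟨hf, hfs⟩
  have hint : ∀ (f : G → ℝ) (hf : Continuous f) (hfs : HasCompactSupport f) (x : G),
      Integrable (fun y => (f y : ℂ) * (φ : G → ℂ) (y⁻¹ * x)) (Measure.haar : Measure G) :=
    fun f hf hfs x => integrable_weight_mul (M0A.continuous φ) hf hfs x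
  have hadd : ∀ f g : G → ℝ, Continuous f → HasCompactSupport f → Continuous g →
      HasCompactSupport g → Λ (f + g) = Λ f + Λ g := by
    intro f g hf hfs hg hgs
    rw [hΛ f hf hfs, hΛ g hg hgs, hΛ (f + g) (hf.add hg) (hfs.add hgs), ← map_add]
    congr 1
    ext x
    change groupConvolution (f + g) (φ : G → ℂ) (π x) =
      groupConvolution f (φ : G → ℂ) (π x) + groupConvolution g (φ : G → ℂ) (π x)
    rw [groupConvolution, groupConvolution, groupConvolution,
      ← integral_add (hint f hf hfs _) (hint g hg hgs _)]
    simp [add_mul]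
  have hsmul : ∀ (c : ℝ) (f : G → ℝ), Continuous f → HasCompactSupport f →
      Λ (c • f) = c * Λ f := by
    intro c f hf hfs
    rw [hΛ f hf hfs, hΛ (c • f) (hf.const_smul c) (hfs.smul_left (f := fun _ => c)),
      ← smul_eq_mul (c : ℂ), ← map_smul]
    congr 1
    ext x
    change groupConvolution (c • f) (φ : G → ℂ) (π x) =
      (c : ℂ) * groupConvolution f (φ : G → ℂ) (π x)
    rw [groupConvolution, groupConvolution, ← integral_const_mul]
    simp [mul_assoc]
  have hnorm : ∀ f : G → ℝ, Continuous f → HasCompactSupport f →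
      ‖Λ f‖ ≤ C * ∫ x, |f x| ∂(Measure.haar : Measure G) := by
    intro f hf hfs
    rw [hΛ f hf hfs]
    exact hm.norm_le _ _ fun x => norm_groupConvolution_le hf hfs hC.norm_le (π x)
  have hsub : ∀ f g : G → ℝ, Continuous f → HasCompactSupport f → Continuous g →
      HasCompactSupport g → Λ (f - g) = Λ f - Λ g := by
    intro f g hf hfs hg hgs
    have := hadd (f - g) g (hf.sub hg) (hfs.sub hgs) hg hgs
    rw [sub_add_cancel] at this
    rw [this, add_sub_cancel_right]
  have hinv : ∀ (g : G) (f : G → ℝ), Continuous f → HasCompactSupport f →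
      Λ (fun x => f (g * x)) = Λ f := by
    intro g f hf hfs
    -- Invariance is known only for `v` in `π(H)`; `L¹`-continuity of translation and density extend
    -- it to all of `G`.
    have hcont : Continuous fun v => Λ (fun x => f (v * x)) := by
      refine continuous_iff_continuousAt.2 fun v₀ => ?_
      refine tendsto_iff_norm_sub_tendsto_zero.2 ?_
      have h1 := (tendsto_integral_abs_translate_sub hf hfs v₀).const_mul C
      rw [mul_zero] at h1
      refine squeeze_zero (fun _ => norm_nonneg _) (fun v => ?_) h1
      have hc := fun v => continuous_comp_mul_left hf v
      have hcs := fun v => hasCompactSupport_comp_mul_left hfs v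
      rw [← hsub _ _ (hc v) (hcs v) (hc v₀) (hcs v₀)]
      exact hnorm _ ((hc v).sub (hc v₀)) ((hcs v).sub (hcs v₀))
    have heq : (fun v => Λ (fun x => f (v * x))) = fun _ => Λ f := by
      refine hdense.equalizer hcont continuous_const (funext fun h => ?_)
      simp only [Function.comp_apply]
      rw [hΛ f hf hfs, hΛ _ (continuous_comp_mul_left hf _)
        (hasCompactSupport_comp_mul_left hfs _)]
      refine hm.left_invariant h⁻¹ _ _ fun x => ?_
      rw [smoothing_apply, smoothing_apply, groupConvolution_translate, inv_inv, map_mul]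
    exact congrFun heq g
  obtain ⟨c, hc⟩ := exists_eq_const_mul_integral_of_norm_le hadd hsmul hnorm hinv
  exact ⟨c, fun f hf hfs => (hΛ f hf hfs).symm.trans (hc f hf hfs)⟩

/-- Translating `φ` on the left becomes a right translation of the weight, with the modulus as
Jacobian. -/
theorem groupConvolution_comp_mul_left (u : G → ℝ) (φ : G → ℂ) (g x : G) :
    groupConvolution u (fun y => φ (g⁻¹ * y)) x =
      groupConvolution (fun y => rightModulus g * u (y * g⁻¹)) φ x := by
  have h := integral_mul_right_eq_rightModulus_mul
    (fun y => (u (y * g⁻¹) : ℂ) * φ (y⁻¹ * x)) g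
  simp only [mul_inv_cancel_right, mul_inv_rev] at h
  simp only [mul_assoc] at h
  rw [groupConvolution, groupConvolution, h, ← integral_smul]
  refine integral_congr_ae (Eventually.of_forall fun y => ?_)
  simp [mul_assoc]

theorem isLeftInvariantMean_comp_smoothing [T2Space G] (hπ : Continuous π)
    (hdense : DenseRange π) {m : M0A H →ₗ[ℂ] ℂ} (hm : IsLeftInvariantMean m) {u : G → ℝ}
    (hu : Continuous u) (hus : HasCompactSupport u) (hu0 : ∀ x, 0 ≤ u x)
    (hu1 : ∫ x, u x ∂(Measure.haar : Measure G) = 1) :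
    IsLeftInvariantMean (m ∘ₗ smoothing hπ hu hus) := by
  have habs : ∫ x, |u x| ∂(Measure.haar : Measure G) = 1 := by
    simp_rw [fun x => abs_of_nonneg (hu0 x)]
    exact hu1
  refine ⟨⟨fun φ hφ => ?_, ?_, fun φ C hC => ?_⟩, fun g φ ψ hψ => ?_⟩
  · refine hm.nonneg _ fun x => ?_
    rw [smoothing_apply, groupConvolution]
    have h1 : ∀ y, (u y : ℂ) * (φ : G → ℂ) (y⁻¹ * π x) =
        ((u y * ((φ : G → ℂ) (y⁻¹ * π x)).re : ℝ) : ℂ) := fun y => by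
      have h2 := Complex.nonneg_iff.1 (hφ (y⁻¹ * π x))
      apply Complex.ext <;> simp [← h2.2]
    simp_rw [h1]
    rw [integral_complex_ofReal]
    refine Complex.zero_le_real.2 (integral_nonneg fun y => mul_nonneg (hu0 y) ?_)
    exact (Complex.nonneg_iff.1 (hφ (y⁻¹ * π x))).1
  · rw [LinearMap.comp_apply]
    refine Eq.trans (congrArg m ?_) hm.map_one
    ext x
    rw [smoothing_apply, groupConvolution]
    simp only [mul_one]
    rw [integral_complex_ofReal, hu1, Complex.ofReal_one]
  · refine hm.norm_le _ _ fun x => ?_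
    have := norm_groupConvolution_le hu hus hC (π x)
    rwa [habs, mul_one] at this
  · obtain ⟨c, hc⟩ := exists_mean_smoothing_eq hπ hdense hm φ
    have hv : Continuous fun y => rightModulus g * u (y * g⁻¹) := by fun_prop
    have hvs : HasCompactSupport fun y => rightModulus g * u (y * g⁻¹) :=
      HasCompactSupport.mul_left (hus.comp_homeomorph (Homeomorph.mulRight g⁻¹))
    have h1 : smoothing hπ hu hus ψ = smoothing hπ hv hvs φ := by
      ext x
      rw [smoothing_apply, smoothing_apply, funext hψ, groupConvolution_comp_mul_left]
    -- The modulus compensates the right translation, so the new weight also has integral one and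
    -- the mean takes the same value `c`.
    have h2 : ∫ y, rightModulus g * u (y * g⁻¹) ∂(Measure.haar : Measure G) = 1 := by
      rw [integral_const_mul, integral_mul_right_eq_rightModulus_mul u g⁻¹, hu1, smul_eq_mul,
        mul_one, rightModulus_mul_inv]
    rw [LinearMap.comp_apply, LinearMap.comp_apply, h1, hc, hc, h2, hu1]

/-- After `y ↦ π(x)y`, Fubini for compactly supported functions gives `∫ w(y) φ(y⁻¹) dy` with `w ∈
C_c(G)`; inversion turns this into a pairing of `φ` with an integrable function. -/
theorem exists_pairing_smoothing_eq [T2Space G] (hπ : Continuous π) {u : G → ℝ}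
    (hu : Continuous u) (hus : HasCompactSupport u) {f : H → ℂ} (hf : Continuous f)
    (hfs : HasCompactSupport f) :
    ∃ v : G → ℂ, Integrable v (Measure.haar : Measure G) ∧
      ∀ φ : M0A G, pairing f (smoothing hπ hu hus φ) = pairing v φ := by
  let w : G → ℂ := fun y => ∫ x, f x * (u (π x * y) : ℂ) ∂(Measure.haar : Measure H)
  have hK : IsCompact ((π '' tsupport f)⁻¹ * tsupport u) := (hfs.isCompact.image hπ).inv.mul hus
  have hzero : ∀ x y, y ∉ (π '' tsupport f)⁻¹ * tsupport u → f x * (u (π x * y) : ℂ) = 0 := by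
    intro x y hy
    by_contra h
    have h1 := subset_tsupport f (left_ne_zero_of_mul h)
    have h2 : u (π x * y) ≠ 0 := by simpa using right_ne_zero_of_mul h
    exact hy ⟨(π x)⁻¹, Set.inv_mem_inv.2 ⟨x, h1, rfl⟩, π x * y, subset_tsupport u h2, by simp⟩
  have hw : Continuous w := by
    rw [← continuousOn_univ]
    refine continuousOn_integral_of_compact_support (k := tsupport f) hfs ?_ fun y x _ hx => ?_
    · refine Continuous.continuousOn ?_
      unfold Function.uncurry
      exact (hf.comp continuous_snd).mul (Complex.continuous_ofReal.comp
        (hu.comp ((hπ.comp continuous_snd).mul continuous_fst)))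
    · rw [image_eq_zero_of_notMem_tsupport hx, zero_mul]
  have hws : HasCompactSupport w :=
    HasCompactSupport.intro hK fun y hy => by
      simp only [w]
      simp_rw [fun x => hzero x y hy]
      simp
  obtain ⟨c, hc⟩ := exists_integral_inv_eq (G := G)
  have hm : Continuous fun y : G => (rightModulus y : ℂ) :=
    Complex.continuous_ofReal.comp continuous_rightModulus
  have hws' : HasCompactSupport fun y => w y⁻¹ := hws.comp_homeomorph (Homeomorph.inv G)
  refine ⟨fun y => c * (w y⁻¹ * rightModulus y), ?_, fun φ => ?_⟩
  · refine Integrable.const_mul ?_ _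
    exact ((hw.comp continuous_inv).mul hm).integrable_of_hasCompactSupport hws'.mul_right
  · have hφ := M0A.continuous φ
    have h1 : ∀ x, f x * groupConvolution u (φ : G → ℂ) (π x) =
        ∫ y, f x * ((u (π x * y) : ℂ) * (φ : G → ℂ) y⁻¹) ∂(Measure.haar : Measure G) := fun x => by
      rw [integral_const_mul, groupConvolution, ← integral_mul_left_eq_self
        (fun y => (u y : ℂ) * (φ : G → ℂ) (y⁻¹ * π x)) (π x)]
      simp
    have h2 : pairing f (smoothing hπ hu hus φ) =
        ∫ y, w y * (φ : G → ℂ) y⁻¹ ∂(Measure.haar : Measure G) := by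
      rw [pairing]
      simp_rw [smoothing_apply, h1]
      rw [integral_integral_swap_of_hasCompactSupport]
      · refine integral_congr_ae (Eventually.of_forall fun y => ?_)
        simp only [w]
        rw [← integral_mul_const]
        simp only [mul_assoc]
      · unfold Function.uncurry
        exact (hf.comp continuous_fst).mul ((Complex.continuous_ofReal.comp
          (hu.comp ((hπ.comp continuous_fst).mul continuous_snd))).mul
          (hφ.comp (continuous_inv.comp continuous_snd)))
      · refine HasCompactSupport.of_support_subset_isCompact (hfs.isCompact.prod hK) fun p hp => ?_
        simp only [Function.mem_support, Function.uncurry, ← mul_assoc] at hp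
        refine ⟨subset_tsupport _ (left_ne_zero_of_mul (left_ne_zero_of_mul hp)), ?_⟩
        by_contra h
        exact hp (by rw [hzero _ _ h, zero_mul])
    have h3 := hc (fun y => w y⁻¹ * rightModulus y * (φ : G → ℂ) y)
      (((hw.comp continuous_inv).mul hm).mul hφ) (hws'.mul_right.mul_right)
    rw [h2, pairing]
    have h4 : ∀ y, w y⁻¹⁻¹ * (rightModulus y⁻¹ : ℂ) * (φ : G → ℂ) y⁻¹ * (rightModulus y : ℂ) =
        w y * (φ : G → ℂ) y⁻¹ := fun y => by
      have h5 : (rightModulus y : ℂ) * (rightModulus y⁻¹ : ℂ) = 1 := by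
        exact_mod_cast rightModulus_mul_inv y
      rw [inv_inv]
      linear_combination (w y * (φ : G → ℂ) y⁻¹) * h5
    simp_rw [h4] at h3
    rw [h3, ← integral_const_mul]
    simp only [mul_assoc]

/-- As `T` maps the unit ball into the unit ball, uniform approximation of `l` there carries over.
Multipliers in the unit ball are bounded by one, so a second `L¹` approximation replaces `f` by a
compactly supported continuous function. -/
theorem comp_smoothing_mem_predual [T2Space G] (hπ : Continuous π) {u : G → ℝ}
    (hu : Continuous u) (hus : HasCompactSupport u)
    (hu1 : ∫ x, |u x| ∂(Measure.haar : Measure G) = 1) {l : Module.Dual ℂ (M0A H)}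
    (hl : l ∈ predual H) : l ∘ₗ smoothing hπ hu hus ∈ predual G := by
  intro ε hε
  obtain ⟨f, hf, hfl⟩ := hl (ε / 2) (half_pos hε)
  obtain ⟨f₀, hf₀s, hf₀ε, hf₀, hf₀i⟩ := exists_hasCompactSupport_integral_sub_le hf (half_pos hε)
  obtain ⟨v, hv, hfv⟩ := exists_pairing_smoothing_eq hπ hu hus hf₀ hf₀s
  refine ⟨v, hv, fun φ hφ => ?_⟩
  have hT : m0aNorm (smoothing hπ hu hus φ) ≤ 1 := by
    have := m0aNorm_smoothing_le hπ hu hus zero_le_one hφ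
    rwa [hu1, mul_one] at this
  have hb := (schurBound_of_m0aNorm_le zero_le_one hT).norm_le
  have hc := M0A.continuous (smoothing hπ hu hus φ)
  have h1 : ‖pairing f (smoothing hπ hu hus φ) - pairing f₀ (smoothing hπ hu hus φ)‖ ≤ ε / 2 := by
    have hint : ∀ {k : H → ℂ}, Integrable k (Measure.haar : Measure H) →
        Integrable (fun x => k x * (smoothing hπ hu hus φ : H → ℂ) x)
          (Measure.haar : Measure H) := fun hk =>
      hk.mul_bdd (c := 1) hc.aestronglyMeasurable (Eventually.of_forall hb)
    rw [pairing, pairing, ← integral_sub (hint hf) (hint hf₀i)]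
    refine (norm_integral_le_of_norm_le (hf.sub hf₀i).norm (Eventually.of_forall fun x => ?_)).trans
      hf₀ε
    rw [← sub_mul, norm_mul]
    exact mul_le_of_le_one_right (norm_nonneg _) (hb x)
  rw [← hfv, LinearMap.comp_apply]
  have h2 := hfl _ hT
  calc _ ≤ ‖l (smoothing hπ hu hus φ) - pairing f (smoothing hπ hu hus φ)‖ +
        ‖pairing f (smoothing hπ hu hus φ) - pairing f₀ (smoothing hπ hu hus φ)‖ :=
        norm_sub_le_norm_sub_add_norm_sub _ _ _
    _ ≤ ε := by linarith

theorem continuous_smoothing [T2Space G] (hπ : Continuous π) {u : G → ℝ}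
    (hu : Continuous u) (hus : HasCompactSupport u)
    (hu1 : ∫ x, |u x| ∂(Measure.haar : Measure G) = 1) :
    @Continuous (M0A G) (M0A H) (weakStarTopology G) (weakStarTopology H)
      (smoothing hπ hu hus) := by
  refine continuous_iInf_rng.2 fun l => continuous_iInf_rng.2 fun hl =>
    continuous_induced_rng.2 ?_
  exact continuous_iInf_dom (i := l ∘ₗ smoothing hπ hu hus)
    (continuous_iInf_dom (i := comp_smoothing_mem_predual hπ hu hus hu1 hl) continuous_induced_dom)

end Smoothing

end PropertyTStar

theorem mainTheorem5
    {G : Type*} [Group G] [TopologicalSpace G] [IsTopologicalGroup G] [LocallyCompactSpace G]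
    [T2Space G] [MeasurableSpace G] [BorelSpace G]
    {H : Type*} [Group H] [TopologicalSpace H] [IsTopologicalGroup H] [LocallyCompactSpace H]
    [T2Space H] [MeasurableSpace H] [BorelSpace H]
    (π : H →* G) (hπ : Continuous π) (hdense : DenseRange π) :
    (HasPropertyTStar H → HasPropertyTStar G) ∧
    (∃ u : G → ℝ, IsSmoothingFunction u) ∧
    ∀ u : G → ℝ, IsSmoothingFunction u →
      ∃ T : M0A G →ₗ[ℂ] M0A H,
        (∀ (φ : M0A G) (x : H),
          (T φ : H → ℂ) x = groupConvolution u (φ : G → ℂ) (π x)) ∧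
        @Continuous (M0A G) (M0A H) (weakStarTopology G) (weakStarTopology H) T ∧
        ∀ mH : M0A H →ₗ[ℂ] ℂ, IsLeftInvariantMean mH →
          IsLeftInvariantMean (mH ∘ₗ T) ∧
          ∀ mG : M0A G →ₗ[ℂ] ℂ, IsLeftInvariantMean mG → mG = mH ∘ₗ T := by
  have habs : ∀ {u : G → ℝ}, IsSmoothingFunction u →
      ∫ x, |u x| ∂(Measure.haar : Measure G) = 1 := fun {u} hu => by
    simp_rw [fun x => abs_of_nonneg (hu.nonneg x)]
    exact hu.integral_eq_one
  have hmean : ∀ {u : G → ℝ} (hu : IsSmoothingFunction u) {mH : M0A H →ₗ[ℂ] ℂ},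
      IsLeftInvariantMean mH →
      IsLeftInvariantMean (mH ∘ₗ smoothing hπ hu.continuous hu.hasCompactSupport) :=
    fun {u} hu {mH} hm => isLeftInvariantMean_comp_smoothing hπ hdense hm hu.continuous
      hu.hasCompactSupport hu.nonneg hu.integral_eq_one
  refine ⟨?_, exists_isSmoothingFunction, fun u hu => ?_⟩
  · rintro ⟨mH, hm, -, hc⟩
    obtain ⟨u, hu⟩ := exists_isSmoothingFunction (G := G)
    -- Only existence and weak* continuity are inherited from `H`; uniqueness holds on every group.
    refine ⟨_, hmean hu hm, fun m' hm' => hm'.unique (hmean hu hm), ?_⟩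
    exact @Continuous.comp _ _ _ (weakStarTopology G) (weakStarTopology H) _ _ _ hc
      (continuous_smoothing hπ hu.continuous hu.hasCompactSupport (habs hu))
  · exact ⟨smoothing hπ hu.continuous hu.hasCompactSupport, fun _ _ => rfl,
      continuous_smoothing hπ hu.continuous hu.hasCompactSupport (habs hu),
      fun mH hm => ⟨hmean hu hm, fun mG hmG => hmG.unique (hmean hu hm)⟩⟩
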